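/- Let $n,k\ge 1$ be integers. **Weights.** Let $\mathcal A^+_k(n)=\{\lambda\in\mathbb Z^k : n\ge\lambda_1\ge\dots\ge\lambda_k\ge 1\}$, write $|\lambda|=\sum_i\lambda_i$, let $m_n(\lambda)$ be the number of $i$ with $\lambda_i=n$, and let $n^k=(n,\dots,n)$. Extend $\lambda\in\mathcal A^+_k(n)$ to a map $\lambda:\mathbb Z\to\mathbb Z$ by $\lambda_{i+k}=\lambda_i-n$, and put $(\lambda\circ\tau^d)_i=\lambda_{i-d}$ for $d\in\mathbb Z$. Let $\tilde{\mathsf S}_k$ be the group of bijections $w:\mathbb Z\to\mathbb Z$ with $w(m+k)=w(m)+k$ for all $m$ and $\sum_{m=1}^k w(m)=\sum_{m=1}^k m$; write $\mu\circ\tilde{\mathsf S}_k=\{\mu\circ w : w\in\tilde{\mathsf S}_k\}$. **Cylindric functions.** For $\lambda,\mu\in\mathcal A^+_k(n)$ and $d\in\mathbb Z$, call $\lambda/d/\mu$ a cylindric shape if $\mu_i\le(\lambda\circ\tau^d)_i$ for all $i\in\mathbb Z$, and a cylindric vertical strip if $(\lambda\circ\tau^d)_i-\mu_i\in\{0,1\}$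 for all $i$. Put $$\theta_{\lambda/d/\mu}=\#\{\alpha\in\mu\circ\tilde{\mathsf S}_k : \alpha_i\le(\lambda\circ\tau^d)_i\ \forall i\},\qquad \psi_{\lambda/d/\mu}=\#\{\alpha\in\mu\circ\tilde{\mathsf S}_k : (\lambda\circ\tau^d)_i-\alpha_i\in\{0,1\}\ \forall i\}.$$ A cylindric reverse plane partition (CRPP) $\pi$ of shape $\lambda/d/\mu$ is a sequence $(\lambda^{(i)},d_i)_{i\ge 0}$ in $\mathcal A^+_k(n)\times\mathbb Z$ with $(\lambda^{(0)},d_0)=(\mu,0)$, with $(\lambda^{(i)},d_i)=(\lambda,d)$ for all large $i$, with $d_{i-1}\le d_i$, and such that every $\lambda^{(i)}/(d_i-d_{i-1})/\lambda^{(i-1)}$ is a cylindric shape. Let $\mathrm{wt}_i(\pi)=\sum_{j=1}^k\big((\lambda^{(i)}\circ\tau^{d_i-d_{i-1}})_j-\lambda^{(i-1)}_j\big)$ be its number of boxes, and put $u^\pi=\prod_{i\ge1}u_i^{\mathrm{wt}_i(\pi)}$, $\theta_\pi=\prod_{i\ge 1}\theta_{\lambda^{(i)}/(d_i-d_{i-1})/\lambda^{(i-1)}}$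 and likewise $\psi_\pi$. Call $\pi$ row strict if every $\lambda^{(i)}/(d_i-d_{i-1})/\lambda^{(i-1)}$ is a cylindric vertical strip. Define formal power series in $u_1,u_2,\dots$ by $$h_{\lambda/d/\mu}=\sum_{\pi}\theta_\pi u^\pi,\qquad e_{\lambda/d/\mu}=\sum_{T}\psi_T u^T,$$ where $\pi$ runs over all CRPPs and $T$ over all row strict CRPPs of shape $\lambda/d/\mu$ (there are none if $d<0$). The non-skew functions are $h_{\lambda/d/\emptyset}:=h_{\lambda/(d+k)/n^k}$ and $e_{\lambda/d/\emptyset}:=e_{\lambda/(d+k)/n^k}$. **Hopf algebra.** Let $\Lambda=\mathbb C[p_1,p_2,\dots]$, $p_r=\sum_i u_i^r$, be the ring of symmetric functions, with the Hopf algebra structure in which every $p_r$ is primitive: $\Delta p_r=p_r\otimes 1+1\otimes p_r$. **Fusion coefficients.** Let $G(n,1,k)=C_n^k\rtimes\mathsf S_k$, where $C_n$ is the group of complex $n$-th roots of unity. Each $\lambda\in\mathcal A^+_k(n)$ gives the character $y\mapsto\prod_i y_i^{\lambda_i}$ of $C_n^k$. An irreducible complex representation $U$ of $G(n,1,k)$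 has type $\lambda$ if this character occurs in $U|_{C_n^k}$; let $f_{U,\lambda}$ be its multiplicity there. Let $L_\lambda$ be the representation of $G(n,1,k)$ induced from $C_n^k\rtimes\mathsf S_\lambda$, with $\mathsf S_\lambda\subset\mathsf S_k$ the stabiliser of $\lambda$, where $C_n^k$ acts through the character of $\lambda$ and $\mathsf S_\lambda$ acts trivially. Put $$N_{\mu\nu}^{\lambda}=\sum_{U}[L_\mu\otimes L_\nu:U]\,f_{U,\lambda}\in\mathbb Z_{\ge 0},$$ the sum over the isomorphism classes of irreducible representations $U$ of type $\lambda$, where $[\,\cdot:U]$ denotes the multiplicity of $U$. **Theorem.** All $h_{\lambda/d/\mu}$ and $e_{\lambda/d/\mu}$ lie in $\Lambda$. Let $f$ stand for $h$ throughout or for $e$ throughout, and let $$\mathcal B_f=\{f_{\lambda/d/\emptyset} : \lambda\in\mathcal A^+_k(n),\ d\in\mathbb Z,\ d\ge -m_n(\lambda)\}.$$ 1. The functions in $\mathcal B_f$ (indexed by $(\lambda,d)$) are linearly independent, and their span is a positive subcoalgebra of $\Lambda$ with structure constants $N^\lambda_{\mu\nu}$: the coproduct maps the span $W$ into $W\otimes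 W$, and for $\lambda\in\mathcal A^+_k(n)$, $d\ge-m_n(\lambda)$, $$\Delta(f_{\lambda/d/\emptyset})=\sum N_{\mu\nu}^{\lambda}\,f_{\mu/d_1/\emptyset}\otimes f_{\nu/d_2/\emptyset},$$ where the sum, which has finitely many non-zero terms, runs over all $(\mu,d_1),(\nu,d_2)$ with $\mu,\nu\in\mathcal A^+_k(n)$, $d_1\ge-m_n(\mu)$, $d_2\ge-m_n(\nu)$ and $|\lambda|+dn=|\mu|+d_1n+|\nu|+d_2n$. 2. For $\lambda\in\mathcal A^+_k(n)$ and $d\ge-m_n(\lambda)$, $$\Delta(f_{\lambda/d/\emptyset})=\sum_{d_1+d_2=d}\ \sum_{\mu\in\mathcal A^+_k(n)}f_{\lambda/d_1/\mu}\otimes f_{\mu/d_2/\emptyset},$$ where, for given $\mu$, the sum runs over $d_1\ge 0$ and $d_2\ge-m_n(\mu)$. 3. For $\lambda,\mu\in\mathcal A^+_k(n)$ and $d_1\ge 0$, $$f_{\lambda/d_1/\mu}=\sum_{d_1'\in\mathbb Z}\ \sum_{\nu}N^{\lambda}_{\mu\nu}\,f_{\nu/(d_1-d_1')/\emptyset},$$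 where the second sum runs over all $\nu\in\mathcal A^+_k(n)$ with $|\nu|=|\lambda|+d_1'n-|\mu|$. -/

import Mathlib

open scoped TensorProduct

/-! ## The Hopf algebra of symmetric functions

`SymFun` is the algebra `ℂ[p₁, p₂, …]` of symmetric functions, realised as a subalgebra of the
formal power series in the variables `u₀, u₁, u₂, …`. The Hopf structure is the one for which all
power sums are primitive. -/

/-- The power sum `p_r = ∑ᵢ uᵢ ^ r` (used for `r ≥ 1`), given by its coefficients. -/
noncomputable def powerSum (r : ℕ) : MvPowerSeries ℕ ℂ :=
  open Classical in fun m => if ∃ i, m = Finsupp.single i r then 1 else 0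

/-- The algebra `Λ = ℂ[p₁, p₂, …]` of symmetric functions. -/
noncomputable def SymFun : Subalgebra ℂ (MvPowerSeries ℕ ℂ) :=
  Algebra.adjoin ℂ (Set.range fun j : ℕ => powerSum (j + 1))

theorem ringHom_injective_of_surjective {R : Type*} [CommRing R] [IsNoetherianRing R] (f : R →+* R)
    (hf : Function.Surjective f) : Function.Injective f := by
  have hmono : Monotone fun m : ℕ => RingHom.ker (f ^ m) := by
    refine monotone_nat_of_le_succ fun m x hx => ?_
    simp only [RingHom.mem_ker, RingHom.coe_pow] at hx ⊢
    rw [Function.iterate_succ_apply', hx, map_zero]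
  obtain ⟨m, hm⟩ := monotone_stabilizes_iff_noetherian.mpr ‹IsNoetherianRing R›
    ⟨fun m : ℕ => RingHom.ker (f ^ m), hmono⟩
  rw [injective_iff_map_eq_zero]
  intro x hx
  obtain ⟨y, rfl⟩ := (hf.iterate m) x
  have h1 : y ∈ RingHom.ker (f ^ (m + 1)) := by
    rw [RingHom.mem_ker, RingHom.coe_pow, Function.iterate_succ_apply', hx]
  have h2 : y ∈ RingHom.ker (f ^ m) := by
    have := hm (m + 1) (Nat.le_succ m)
    simp only [OrderHom.coe_mk] at this
    rwa [this]
  rwa [RingHom.mem_ker, RingHom.coe_pow] at h2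

theorem psum_algebraicIndependent (N : ℕ) :
    AlgebraicIndependent ℂ (fun i : Fin N => MvPolynomial.psum (Fin N) ℂ (i + 1)) := by
  classical
  let S := MvPolynomial.symmetricSubalgebra (Fin N) ℂ
  let φ : MvPolynomial (Fin N) ℂ →ₐ[ℂ] S :=
    MvPolynomial.aeval fun i : Fin N =>
      (⟨MvPolynomial.psum (Fin N) ℂ (i + 1), MvPolynomial.psum_isSymmetric _ _ _⟩ : S)
  let A : Subalgebra ℂ (MvPolynomial (Fin N) ℂ) := (S.val.comp φ).range
  have hp : ∀ j, 0 < j → j ≤ N → MvPolynomial.psum (Fin N) ℂ j ∈ A := by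
    intro j hj hjN
    refine ⟨MvPolynomial.X ⟨j - 1, by omega⟩, ?_⟩
    have : j - 1 + 1 = j := by omega
    simp [φ, this]
  have he : ∀ j, j ≤ N → MvPolynomial.esymm (Fin N) ℂ j ∈ A := by
    intro j
    induction j using Nat.strong_induction_on with
    | _ j ih =>
      intro hjN
      rcases Nat.eq_zero_or_pos j with rfl | hj
      · simp
      have h := MvPolynomial.mul_esymm_eq_sum (Fin N) ℂ j
      have h2 : (j : MvPolynomial (Fin N) ℂ) * MvPolynomial.esymm (Fin N) ℂ j ∈ A := by
        rw [h]
        refine A.mul_mem (A.pow_mem (A.neg_mem A.one_mem) _) (A.sum_mem fun a ha => ?_)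
        rw [Finset.mem_filter, Finset.HasAntidiagonal.mem_antidiagonal] at ha
        exact A.mul_mem (A.mul_mem (A.pow_mem (A.neg_mem A.one_mem) _)
          (ih _ ha.2 (by omega))) (hp _ (by omega) (by omega))
      have h3 := A.smul_mem h2 ((j : ℂ)⁻¹)
      have hj0 : (j : ℂ) ≠ 0 := by exact_mod_cast hj.ne'
      have h4 : ((j : ℂ)⁻¹) • ((j : MvPolynomial (Fin N) ℂ) * MvPolynomial.esymm (Fin N) ℂ j)
          = MvPolynomial.esymm (Fin N) ℂ j := by
        have : (j : MvPolynomial (Fin N) ℂ) = MvPolynomial.C (j : ℂ) := by simp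
        rw [this, ← MvPolynomial.smul_eq_C_mul, smul_smul, inv_mul_cancel₀ hj0, one_smul]
      rwa [h4] at h3
  let e : MvPolynomial (Fin N) ℂ ≃ₐ[ℂ] S := MvPolynomial.esymmAlgEquiv (Fin N) ℂ (by simp)
  have hsurj : Function.Surjective φ := by
    have hr : ∀ q, e q ∈ φ.range := by
      intro q
      induction q using MvPolynomial.induction_on with
      | C a =>
        refine ⟨MvPolynomial.C a, ?_⟩
        have h1 : (MvPolynomial.C a : MvPolynomial (Fin N) ℂ) = algebraMap ℂ _ a := rfl
        simp only [h1, AlgHom.toRingHom_eq_coe, RingHom.coe_coe]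
        rw [AlgHom.commutes, AlgEquiv.commutes]
      | add p q hp hq => rw [map_add]; exact add_mem hp hq
      | mul_X p i hp =>
        rw [map_mul]
        refine mul_mem hp ?_
        obtain ⟨y, hy⟩ := he (i + 1) (by omega)
        refine ⟨y, Subtype.ext ?_⟩
        have h5 : ((e (MvPolynomial.X i) : S) : MvPolynomial (Fin N) ℂ)
            = MvPolynomial.esymm (Fin N) ℂ (i + 1) := by
          simp [e, MvPolynomial.esymmAlgEquiv, MvPolynomial.esymmAlgHom]
        rw [h5]
        exact hy
    intro s
    obtain ⟨y, hy⟩ := hr (e.symm s)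
    exact ⟨y, by simpa using hy⟩
  have hinj : Function.Injective (e.symm.toAlgHom.comp φ).toRingHom :=
    ringHom_injective_of_surjective _ (by
      intro q
      obtain ⟨y, hy⟩ := hsurj (e q)
      exact ⟨y, by simp [hy]⟩)
  have hφ : Function.Injective φ := by
    intro a b hab
    apply hinj
    simp [hab]
  have h6 : MvPolynomial.aeval (fun i : Fin N => MvPolynomial.psum (Fin N) ℂ (i + 1))
      = S.val.comp φ := by
    ext i; simp [φ]
  rw [algebraicIndependent_iff_injective_aeval, h6]
  exact Subtype.val_injective.comp hφ

/-- The power sums `p₁, p₂, …` are algebraically independent. -/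
theorem powerSum_algebraicIndependent :
    AlgebraicIndependent ℂ (fun j : ℕ => powerSum (j + 1)) := by
  classical
  apply algebraicIndependent_of_finite_type
  intro t ht
  obtain ⟨N, hN⟩ := ht.bddAbove
  let ι : Fin (N + 1) ↪ ℕ := Fin.valEmbedding
  have h1 : AlgebraicIndependent ℂ (fun i : Fin (N + 1) => powerSum (i + 1)) := by
    refine AlgebraicIndependent.of_comp (MvPowerSeries.killCompl ι) ?_
    have h2 := (psum_algebraicIndependent (N + 1)).map'
      (f := MvPolynomial.coeToMvPowerSeries.algHom ℂ)
      (by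
        intro a b hab
        simpa using hab)
    convert h2 using 1
    funext i
    ext m
    have hs : (∃ a, m.embDomain ι = Finsupp.single a ((i : ℕ) + 1)) ↔
        ∃ a : Fin (N + 1), m = Finsupp.single a ((i : ℕ) + 1) := by
      constructor
      · rintro ⟨a, ha⟩
        have hmem : a ∈ (m.embDomain ι).support := by rw [ha]; simp
        rw [Finsupp.support_embDomain, Finset.mem_map] at hmem
        obtain ⟨b, -, rfl⟩ := hmem
        refine ⟨b, Finsupp.embDomain_injective ι ?_⟩
        rw [ha, Finsupp.embDomain_single]
      · rintro ⟨a, rfl⟩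
        exact ⟨ι a, by rw [Finsupp.embDomain_single]⟩
    have hl : MvPowerSeries.coeff m (MvPowerSeries.killCompl ι (powerSum ((i : ℕ) + 1)))
        = if ∃ a : Fin (N + 1), m = Finsupp.single a ((i : ℕ) + 1) then 1 else 0 := by
      rw [MvPowerSeries.coeff_killCompl]
      simp only [powerSum, MvPowerSeries.coeff_apply, hs]
    simp only [Function.comp_apply, hl]
    simp only [MvPolynomial.coeToMvPowerSeries.algHom_apply, MvPolynomial.psum, Algebra.algebraMap_self,
      MvPowerSeries.map_id, RingHom.id_apply, MvPolynomial.coeff_coe, MvPolynomial.coeff_sum,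
      MvPolynomial.coeff_X_pow]
    by_cases hm : ∃ a : Fin (N + 1), m = Finsupp.single a ((i : ℕ) + 1)
    · obtain ⟨a, rfl⟩ := hm
      have h3 : ∀ b : Fin (N + 1), (Finsupp.single b ((i : ℕ) + 1) = Finsupp.single a ((i : ℕ) + 1))
          ↔ b = a := by
        intro b
        constructor
        · intro h
          have := (Finsupp.single_left_injective (Nat.succ_ne_zero (i : ℕ))) h
          exact this
        · rintro rfl; rfl
      rw [if_pos ⟨a, rfl⟩]
      simp only [h3, Finset.sum_ite_eq', Finset.mem_univ, if_true]
    · rw [if_neg hm]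
      symm
      apply Finset.sum_eq_zero
      intro b _
      rw [if_neg]
      intro h
      exact hm ⟨b, h.symm⟩
  exact h1.comp (fun j : t => (⟨j, Nat.lt_succ_of_le (hN j.2)⟩ : Fin (N + 1)))
    (fun a b h => Subtype.ext (by simpa using h))

/-- `Λ` is freely generated by the power sums: `Xⱼ` corresponds to `p_{j+1}`. -/
noncomputable def SymFun.equivMvPolynomial : MvPolynomial ℕ ℂ ≃ₐ[ℂ] SymFun :=
  powerSum_algebraicIndependent.aevalEquiv

/-- The power sum `p_{j+1}` as an element of `Λ`. -/
noncomputable def SymFun.p (j : ℕ) : SymFun :=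
  ⟨powerSum (j + 1), Algebra.subset_adjoin ⟨j, rfl⟩⟩

theorem SymFun.equivMvPolynomial_X (j : ℕ) :
    SymFun.equivMvPolynomial (MvPolynomial.X j) = SymFun.p j := by
  apply Subtype.ext
  have h := powerSum_algebraicIndependent.algebraMap_aevalEquiv (MvPolynomial.X j)
  rw [MvPolynomial.aeval_X] at h
  exact h

/-- The algebra homomorphism on `Λ` with prescribed values on the power sums. -/
noncomputable def SymFun.lift {B : Type*} [CommSemiring B] [Algebra ℂ B] (f : ℕ → B) :
    SymFun →ₐ[ℂ] B :=
  (MvPolynomial.aeval f).comp SymFun.equivMvPolynomial.symm.toAlgHom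

@[simp] theorem SymFun.lift_p {B : Type*} [CommSemiring B] [Algebra ℂ B] (f : ℕ → B) (j : ℕ) :
    SymFun.lift f (SymFun.p j) = f j := by
  rw [← SymFun.equivMvPolynomial_X]
  simp [SymFun.lift]

theorem SymFun.algHom_ext {B : Type*} [Semiring B] [Algebra ℂ B] {f g : SymFun →ₐ[ℂ] B}
    (h : ∀ j, f (SymFun.p j) = g (SymFun.p j)) : f = g := by
  have h1 : f.comp SymFun.equivMvPolynomial.toAlgHom = g.comp SymFun.equivMvPolynomial.toAlgHom := by
    ext j
    simpa [SymFun.equivMvPolynomial_X] using h j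
  ext x
  have := congrArg (fun F => F (SymFun.equivMvPolynomial.symm x)) h1
  simpa using this

/-- The bialgebra structure of `Λ`: `Δ p_r = p_r ⊗ 1 + 1 ⊗ p_r` and `ε p_r = 0`. -/
noncomputable instance SymFun.instBialgebra : Bialgebra ℂ SymFun :=
  Bialgebra.ofAlgHom
    (SymFun.lift fun j => SymFun.p j ⊗ₜ[ℂ] 1 + 1 ⊗ₜ[ℂ] SymFun.p j)
    (SymFun.lift fun _ => 0)
    (by
      apply SymFun.algHom_ext
      intro j
      simp [Algebra.TensorProduct.one_def, TensorProduct.add_tmul, TensorProduct.tmul_add]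
      abel)
    (by apply SymFun.algHom_ext; intro j; simp)
    (by apply SymFun.algHom_ext; intro j; simp)

theorem SymFun.comulAlgHom_p (j : ℕ) :
    Bialgebra.comulAlgHom ℂ SymFun (SymFun.p j) = SymFun.p j ⊗ₜ[ℂ] 1 + 1 ⊗ₜ[ℂ] SymFun.p j :=
  SymFun.lift_p _ j

theorem SymFun.counitAlgHom_p (j : ℕ) : Bialgebra.counitAlgHom ℂ SymFun (SymFun.p j) = 0 :=
  SymFun.lift_p _ j

/-- The Hopf algebra structure of `Λ`, with antipode `p_r ↦ -p_r`. -/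
noncomputable instance SymFun.instHopfAlgebra : HopfAlgebra ℂ SymFun :=
  HopfAlgebra.ofAlgHom (SymFun.lift fun j => -SymFun.p j)
    (by
      apply SymFun.algHom_ext
      intro j
      simp only [AlgHom.comp_apply, SymFun.comulAlgHom_p, SymFun.counitAlgHom_p, map_add, map_zero]
      erw [Algebra.TensorProduct.lift_tmul, Algebra.TensorProduct.lift_tmul]
      simp)
    (by
      apply SymFun.algHom_ext
      intro j
      simp only [AlgHom.comp_apply, SymFun.comulAlgHom_p, SymFun.counitAlgHom_p, map_add, map_zero]
      erw [Algebra.TensorProduct.lift_tmul, Algebra.TensorProduct.lift_tmul]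
      simp)

/-! ## Weights and the extended affine setting -/

/-- The alcove `A⁺ₖ(n)`: weights `n ≥ λ₁ ≥ … ≥ λₖ ≥ 1`. The part `λᵢ` is stored at the
index `i - 1 : Fin k`. -/
def Alcove (n k : ℕ) : Type :=
  {lam : Fin k → ℤ // Antitone lam ∧ ∀ i, 1 ≤ lam i ∧ lam i ≤ n}

instance (n k : ℕ) : Finite (Alcove n k) := by
  have h : {lam : Fin k → ℤ | Antitone lam ∧ ∀ i, 1 ≤ lam i ∧ lam i ≤ n}.Finite :=
    (Set.finite_Icc (fun _ : Fin k => (1 : ℤ)) (fun _ => (n : ℤ))).subset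
      fun lam h => ⟨fun i => (h.2 i).1, fun i => (h.2 i).2⟩
  exact h.to_subtype

noncomputable instance (n k : ℕ) : Fintype (Alcove n k) := Fintype.ofFinite _

namespace Alcove

variable {n k : ℕ}

/-- The size `|λ| = λ₁ + ⋯ + λₖ`. -/
def size (lam : Alcove n k) : ℤ := ∑ i, lam.1 i

/-- The multiplicity `mₙ(λ)` of the part `n`. -/
def multTop (lam : Alcove n k) : ℤ := (Finset.univ.filter fun i => lam.1 i = (n : ℤ)).card

/-- The rectangular weight `nᵏ = (n, …, n)`. -/
def top (n k : ℕ) [NeZero n] : Alcove n k :=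
  ⟨fun _ => n, fun _ _ _ => le_rfl,
    fun _ => ⟨by change (1 : ℤ) ≤ (n : ℤ); exact_mod_cast Nat.one_le_iff_ne_zero.mpr (NeZero.ne n),
      le_rfl⟩⟩

/-- The extension of a weight to the map `λ : ℤ → ℤ` with `λ_{i+k} = λᵢ - n`. -/
def ext [NeZero k] (lam : Alcove n k) (i : ℤ) : ℤ :=
  lam.1 (Fin.ofNat k ((i - 1) % k).toNat) - n * ((i - 1) / k)

end Alcove

/-- The affine symmetric group `S̃ₖ`: bijections `w : ℤ → ℤ` with `w (m + k) = w m + k` and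
`∑_{m=1}^k w m = ∑_{m=1}^k m`. -/
def IsAffinePerm (k : ℕ) (w : Equiv.Perm ℤ) : Prop :=
  (∀ m, w (m + k) = w m + k) ∧ ∑ m ∈ Finset.Icc (1 : ℤ) k, w m = ∑ m ∈ Finset.Icc (1 : ℤ) k, m

section Cylindric

variable {n k : ℕ} [NeZero n] [NeZero k]

/-- The points `μ ∘ w` of the level-`n` orbit of `μ` under the affine symmetric group. They are in
bijection with the minimal length representatives of the cosets `S_μ \ S̃ₖ`. -/
def affineOrbit (mu : Alcove n k) : Set (ℤ → ℤ) :=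
  {α | ∃ w : Equiv.Perm ℤ, IsAffinePerm k w ∧ α = fun i => mu.ext (w i)}

/-- `λ/d/μ` is a cylindric skew shape: `μᵢ ≤ (λ ∘ τᵈ)ᵢ = λ_{i-d}` for all `i`. -/
def IsCylShape (lam : Alcove n k) (d : ℤ) (mu : Alcove n k) : Prop :=
  ∀ i, mu.ext i ≤ lam.ext (i - d)

/-- `λ/d/μ` is a cylindric vertical strip: at most one box in each row. -/
def IsCylVertStrip (lam : Alcove n k) (d : ℤ) (mu : Alcove n k) : Prop :=
  ∀ i, lam.ext (i - d) - mu.ext i = 0 ∨ lam.ext (i - d) - mu.ext i = 1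

/-- The number of boxes of `λ/d/μ` in the rows `1, …, k`. -/
noncomputable def cylShapeSize (lam : Alcove n k) (d : ℤ) (mu : Alcove n k) : ℕ :=
  {b : ℤ × ℤ | (1 ≤ b.1 ∧ b.1 ≤ k) ∧ mu.ext b.1 < b.2 ∧ b.2 ≤ lam.ext (b.1 - d)}.ncard

/-- The weight factor `θ_{λ/d/μ}`, the number of `μ ∘ w ≤ λ ∘ τᵈ`. -/
noncomputable def cylTheta (lam : Alcove n k) (d : ℤ) (mu : Alcove n k) : ℕ :=
  {α ∈ affineOrbit mu | ∀ i, α i ≤ lam.ext (i - d)}.ncard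

/-- The weight factor `ψ_{λ/d/μ}`, the number of `μ ∘ w` with all `(λ ∘ τᵈ)ᵢ - (μ ∘ w)ᵢ ∈ {0, 1}`. -/
noncomputable def cylPsi (lam : Alcove n k) (d : ℤ) (mu : Alcove n k) : ℕ :=
  {α ∈ affineOrbit mu | ∀ i, lam.ext (i - d) - α i = 0 ∨ lam.ext (i - d) - α i = 1}.ncard

/-- A cylindric reverse plane partition of shape `λ/d/μ`, as a sequence of cylindric loops
`μ[0] = λ⁽⁰⁾[d₀], λ⁽¹⁾[d₁], …` that is eventually constant, equal to `λ[d]`, and whose successive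
differences `λ⁽ⁱ⁺¹⁾/(dᵢ₊₁ - dᵢ)/λ⁽ⁱ⁾`, the preimages of the successive entries, are cylindric skew
shapes. -/
structure CRPP (lam : Alcove n k) (d : ℤ) (mu : Alcove n k) where
  wt : ℕ → Alcove n k
  deg : ℕ → ℤ
  wt_zero : wt 0 = mu
  deg_zero : deg 0 = 0
  deg_le : ∀ i, deg i ≤ deg (i + 1)
  shape : ∀ i, IsCylShape (wt (i + 1)) (deg (i + 1) - deg i) (wt i)
  eventually_eq : ∃ l, ∀ i, l ≤ i → wt i = lam ∧ deg i = d

namespace CRPP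

variable {lam mu : Alcove n k} {d : ℤ}

/-- The number of boxes with the `i`-th entry, which is the exponent of `uᵢ`. -/
noncomputable def content (π : CRPP lam d mu) (i : ℕ) : ℕ :=
  cylShapeSize (π.wt (i + 1)) (π.deg (i + 1) - π.deg i) (π.wt i)

/-- Row strictness: each entry occupies a cylindric vertical strip. -/
def IsRowStrict (π : CRPP lam d mu) : Prop :=
  ∀ i, IsCylVertStrip (π.wt (i + 1)) (π.deg (i + 1) - π.deg i) (π.wt i)

/-- `θ_π`, a product with finitely many factors different from `1`. -/
noncomputable def theta (π : CRPP lam d mu) : ℕ :=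
  ∏ᶠ i, cylTheta (π.wt (i + 1)) (π.deg (i + 1) - π.deg i) (π.wt i)

/-- `ψ_π`, a product with finitely many factors different from `1`. -/
noncomputable def psi (π : CRPP lam d mu) : ℕ :=
  ∏ᶠ i, cylPsi (π.wt (i + 1)) (π.deg (i + 1) - π.deg i) (π.wt i)

end CRPP

/-- The cylindric complete symmetric function `h_{λ/d/μ} = ∑_π θ_π u^π`, the sum running over all
cylindric reverse plane partitions of shape `λ/d/μ`. -/
noncomputable def cylH (lam : Alcove n k) (d : ℤ) (mu : Alcove n k) : MvPowerSeries ℕ ℂ :=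
  fun m => ∑ᶠ π : {π : CRPP lam d mu // ∀ i, π.content i = m i}, (π.1.theta : ℂ)

/-- The cylindric elementary symmetric function `e_{λ/d/μ} = ∑_T ψ_T u^T`, the sum running over all
row strict cylindric reverse plane partitions of shape `λ/d/μ`. -/
noncomputable def cylE (lam : Alcove n k) (d : ℤ) (mu : Alcove n k) : MvPowerSeries ℕ ℂ :=
  fun m => ∑ᶠ T : {T : CRPP lam d mu // T.IsRowStrict ∧ ∀ i, T.content i = m i}, (T.1.psi : ℂ)

/-- The non-skew member `f_{λ/d/∅} = f_{λ/(d+k)/nᵏ}` of a family `f_{λ/d/μ}`: the cylindric loop of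
`∅ = (0, …, 0)` is the loop of `nᵏ` translated by `k`. -/
def nonSkew {B : Type*} (f : Alcove n k → ℤ → Alcove n k → B) (lam : Alcove n k) (d : ℤ) : B :=
  f lam (d + k) (Alcove.top n k)

end Cylindric

/-! ## The generalised symmetric group and the fusion coefficients -/

/-- The generalised symmetric group `G(n,1,k) = Cₙᵏ ⋊ Sₖ`, with `Cₙ` the complex `n`-th roots of
unity and `Sₖ` permuting the factors. -/
abbrev GenSymGroup (n k : ℕ) : Type :=
  (Fin k → rootsOfUnity n ℂ) ⋊[mulAutArrow] Equiv.Perm (Fin k)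

/-- The value at `y` of the character `y ↦ ∏ᵢ yᵢ ^ pᵢ` of the normal subgroup `Cₙᵏ`. -/
def torusChar {n k : ℕ} (p : Fin k → ℤ) (y : Fin k → rootsOfUnity n ℂ) : ℂ :=
  ((∏ i, (y i : ℂˣ) ^ p i : ℂˣ) : ℂ)

section Reps

variable {n k : ℕ} {V : Type*} [AddCommGroup V] [Module ℂ V]

/-- The subspace on which `Cₙᵏ` acts through the character of the weight `p`. -/
def torusWeightSpace (ρ : Representation ℂ (GenSymGroup n k) V) (p : Fin k → ℤ) :
    Submodule ℂ V where
  carrier := {v | ∀ y, ρ (SemidirectProduct.inl y) v = torusChar p y • v}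
  zero_mem' := by simp
  add_mem' := by
    intro a b ha hb y
    rw [map_add, ha y, hb y, smul_add]
  smul_mem' := by
    intro c a ha y
    rw [map_smul, ha y, smul_comm]

/-- `ρ` has type `λ`: its restriction to `Cₙᵏ` contains the character of the weight `λ`. -/
def HasType (ρ : Representation ℂ (GenSymGroup n k) V) (lam : Alcove n k) : Prop :=
  torusWeightSpace ρ lam.1 ≠ ⊥

/-- The multiplicity of the character of `λ` in the restriction of `ρ` to `Cₙᵏ`. For irreducible
`ρ = L(λ⁽¹⁾, …, λ⁽ⁿ⁾)` of type `λ` this is the number `∏ᵢ f_{λ⁽ⁱ⁾}` of tuples of standard tableaux. -/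
noncomputable def typeMult (ρ : Representation ℂ (GenSymGroup n k) V) (lam : Alcove n k) : ℕ :=
  Module.finrank ℂ (torusWeightSpace ρ lam.1)

end Reps

/-- The distinct permutations of `λ`. -/
def permOrbit {n k : ℕ} (lam : Alcove n k) : Type :=
  {p : Fin k → ℤ // ∃ w : Equiv.Perm (Fin k), p = lam.1 ∘ w}

/-- The right action of `Sₖ` on the distinct permutations of `λ`. -/
def permOrbit.act {n k : ℕ} {lam : Alcove n k} (p : permOrbit lam) (w : Equiv.Perm (Fin k)) :
    permOrbit lam :=
  ⟨p.1 ∘ w, by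
    obtain ⟨v, hv⟩ := p.2
    exact ⟨v * w, by rw [hv]; rfl⟩⟩

/-- The irreducible module `L_λ` induced from the character of `λ`, extended by the trivial
representation of `S_λ`, of the stabiliser `Cₙᵏ ⋊ S_λ`: functions on the distinct permutations `p`
of `λ`, where `Cₙᵏ` acts on the value at `p` through the character of `p` and `Sₖ` permutes. -/
noncomputable def standardIrrep {n k : ℕ} (lam : Alcove n k) :
    Representation ℂ (GenSymGroup n k) (permOrbit lam → ℂ) where
  toFun g :=
    { toFun := fun f p => torusChar p.1 g.left * f (p.act g.right)
      map_add' := by intro a b; funext p; simp [mul_add]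
      map_smul' := by intro c a; funext p; simp [mul_left_comm] }
  map_one' := by
    refine LinearMap.ext fun f => funext fun p => ?_
    simp [torusChar, permOrbit.act]
    rfl
  map_mul' := by
    intro g h
    refine LinearMap.ext fun f => funext fun p => ?_
    have h1 : torusChar p.1 (g * h).left
        = torusChar p.1 g.left * torusChar (p.act g.right).1 h.left := by
      simp only [torusChar, SemidirectProduct.mul_left, Pi.mul_apply, Subgroup.coe_mul, mul_zpow,
        Finset.prod_mul_distrib, Units.val_mul]
      congr 2
      refine (Equiv.prod_comp g.right _).symm.trans (Finset.prod_congr rfl fun i _ => ?_)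
      have h2 : (mulAutArrow g.right h.left) (g.right i) = h.left i := by
        change h.left (g.right⁻¹ • (g.right i)) = h.left i
        simp
      rw [h2]
      rfl
    have h3 : p.act (g * h).right = (p.act g.right).act h.right := rfl
    change torusChar p.1 (g * h).left * f (p.act (g * h).right) = _
    rw [h1, h3, mul_assoc]
    rfl

/-- Finite-dimensional irreducible complex representations of `G(n,1,k)`, on the spaces `ℂᵐ`. -/
def Irrep (n k : ℕ) : Type :=
  Σ m : ℕ, {ρ : Representation ℂ (GenSymGroup n k) (Fin m → ℂ) // ρ.IsIrreducible}

/-- Isomorphism of irreducible representations. -/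
def Irrep.setoid (n k : ℕ) : Setoid (Irrep n k) where
  r U W := Nonempty (Representation.Equiv U.2.1 W.2.1)
  iseqv :=
    ⟨fun _ => ⟨.refl _⟩, fun ⟨e⟩ => ⟨e.symm⟩, fun ⟨e⟩ ⟨f⟩ => ⟨e.trans f⟩⟩

/-- The isomorphism classes of irreducible representations of `G(n,1,k)`. -/
def IrrepClass (n k : ℕ) : Type := Quotient (Irrep.setoid n k)

/-- A representative of an isomorphism class. -/
noncomputable def IrrepClass.rep {n k : ℕ} (c : IrrepClass n k) :
    Representation ℂ (GenSymGroup n k) (Fin (Quotient.out c).1 → ℂ) :=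
  (Quotient.out c).2.1

/-- The fusion coefficient `N_{λμ}^ν`: the sum, over the irreducible representations `U` of type
`ν`, of the tensor multiplicity of `U` in `L_λ ⊗ L_μ` times the multiplicity of the character of
`ν` in `U`. -/
noncomputable def fusionCoeff {n k : ℕ} (lam mu nu : Alcove n k) : ℕ :=
  ∑ᶠ (c : IrrepClass n k) (_ : HasType c.rep nu),
    Module.finrank ℂ
      (Representation.IntertwiningMap c.rep ((standardIrrep lam).tprod (standardIrrep mu)))
      * typeMult c.rep nu

/-! ## Positive subcoalgebras -/

/-- The family `f` is a basis of a subcoalgebra of `Λ` in which the coproduct has the non-negative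
integer structure constants `c`: `Δ (f x) = ∑_{y,z} c x y z • f y ⊗ f z`, a finite sum. -/
def IsPositiveSubcoalgebra {ι : Type*} (f : ι → SymFun) (c : ι → ι → ι → ℕ) : Prop :=
  LinearIndependent ℂ f ∧
  (∀ a ∈ Submodule.span ℂ (Set.range f), Coalgebra.comul (R := ℂ) a ∈
    LinearMap.range (TensorProduct.map (Submodule.span ℂ (Set.range f)).subtype
      (Submodule.span ℂ (Set.range f)).subtype)) ∧
  ∀ x, ∃ s : Finset (ι × ι), (∀ y z, c x y z ≠ 0 ↔ (y, z) ∈ s) ∧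
    Coalgebra.comul (R := ℂ) (f x) = ∑ q ∈ s, c x q.1 q.2 • (f q.1 ⊗ₜ[ℂ] f q.2)

/-- The index set of the non-skew functions: pairs `(λ, d)` with `d ≥ -mₙ(λ)`. -/
abbrev NonSkewIndex (n k : ℕ) : Type := {x : Alcove n k × ℤ // -x.1.multTop ≤ x.2}

/-- The structure constants of the non-skew families: `N_{μν}^λ` where degrees add up, that is, where
`|λ| + d n = (|μ| + d₁ n) + (|ν| + d₂ n)`, and zero elsewhere. -/
noncomputable def cylStructureConst {n k : ℕ} (x y z : NonSkewIndex n k) : ℕ :=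
  open Classical in
  if x.1.1.size + x.1.2 * n = (y.1.1.size + y.1.2 * n) + (z.1.1.size + z.1.2 * n) then
    fusionCoeff y.1.1 z.1.1 x.1.1 else 0

/-! Reduction modulo $n$ identifies weights with the $\mathsf S_k$-orbits on $(\mathbb Z/n)^k$. Let
$f_r$ be $h_r$ or $e_r$ and put $R_r(x)=\sum f_{b_1}\cdots f_{b_k}$, over all $b\in\mathbb N^k$ with
$|b|=r$ and $b\equiv x$ mod $n$ (`residueSum`). The cylindric functions are
$f_{\lambda/d/\mu}=\sum_y R_{|\lambda|+dn-|\mu|}(y)$, over all $y$ with $\lambda-y$ in the orbit of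
$\mu$ (`cylSum`), and in particular $f_{\lambda/d/\emptyset}=R_{|\lambda|+dn}(\lambda)$.

Given this, $\Delta f_b=\sum_a f_a\otimes f_{b-a}$ yields $\Delta R_r(x)=\sum_{t,y}R_{r-t}(y)\otimes
R_t(x-y)$ (`comul_residueSum`). Since $R_r$ is constant on orbits, grouping the $y$ by the orbits of
both $y$ and $\lambda-y$ gives part 1, and grouping by the orbit of $\lambda-y$ alone gives part 2.
Part 3 groups the sum that defines `cylSum`. The group sizes are the fusion coefficients: by
complete reducibility $N_{\mu\nu}^\lambda$ is the dimension of the $\lambda$-weight space of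
$L_\mu\otimes L_\nu$, which counts pairs of rearrangements of $\mu$ and $\nu$ with sum $\lambda$ mod
$n$ (`fusionCoeff_eq_card`). Linear independence holds because the $f_r$, $r\ge1$, are algebraically
free and distinct non-skew functions involve disjoint sets of monomials in them.

It remains to expand over reverse plane partitions. A point of the affine orbit of $\mu$ is a
quasi-periodic map with window sum $|\mu|$ and the residues of $\mu$ in some order
(`mem_affineOrbit_iff`). Subtracting it from $\lambda\circ\tau^d$ leaves a composition $b$ with
$\lambda-b$ in the orbit of $\mu$, so $\theta$ and $\psi$ count such $b$ (`ncard_stripSet`). A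
non-zero count already forces a cylindric shape, or a vertical strip, because sorting preserves
inequalities (`le_of_charge_le`). Hence the sum over plane partitions is a sum over unrestricted
paths of weights. The coefficient of $u^m$ in `cylSum` counts matrices with rows indexed by the
factors and columns by the variables; reading them column by column gives the same paths
(`matCount_eq_pathSum`). -/

/-! ## Weights and their residues -/

namespace Alcove

variable {n k : ℕ}

/-- The residues modulo `n` of the parts of a weight. -/
def res (lam : Alcove n k) : Fin k → ZMod n := fun i => (lam.1 i : ZMod n)

theorem eq_of_intCast_eq {a b : ℤ} (ha : 1 ≤ a ∧ a ≤ n) (hb : 1 ≤ b ∧ b ≤ n)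
    (h : (a : ZMod n) = b) : a = b := by
  rw [ZMod.intCast_eq_intCast_iff, Int.modEq_iff_dvd] at h
  obtain ⟨c, hc⟩ := h
  have h1 : c < 1 := by
    by_contra! h1
    nlinarith [mul_le_mul_of_nonneg_left h1 (Int.natCast_nonneg n)]
  have h2 : -1 < c := by
    by_contra! h1
    nlinarith [mul_le_mul_of_nonneg_left h1 (Int.natCast_nonneg n)]
  have : c = 0 := by omega
  subst this
  simp at hc
  omega

theorem eq_of_res_comp_eq {lam mu : Alcove n k} {σ τ : Equiv.Perm (Fin k)}
    (h : lam.res ∘ σ = mu.res ∘ τ) : lam = mu := by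
  have h1 : lam.1 ∘ σ = mu.1 ∘ τ := by
    funext i
    exact eq_of_intCast_eq (lam.2.2 _) (mu.2.2 _) (congrFun h i)
  have h2 : lam.1 = mu.1 ∘ (τ * σ⁻¹ : Equiv.Perm (Fin k)) := by
    funext i
    have := congrFun h1 (σ⁻¹ i)
    simpa using this
  have h3 : mu.1 ∘ (τ * σ⁻¹ : Equiv.Perm (Fin k)) = mu.1 ∘ (1 : Equiv.Perm (Fin k)) :=
    Tuple.unique_antitone (h2 ▸ lam.2.1) mu.2.1
  exact Subtype.ext (h2.trans h3)

theorem exists_eq_res_comp [NeZero n] (x : Fin k → ZMod n) :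
    ∃ (lam : Alcove n k) (σ : Equiv.Perm (Fin k)), x = lam.res ∘ σ := by
  -- Representatives in $1,\dots,n$ rather than $0,\dots,n-1$: the residue $0$ is lifted to $n$.
  let r : Fin k → ℤ := fun i => n - ((-x i).val : ℤ)
  have hr : ∀ i, (r i : ZMod n) = x i := fun i => by simp [r]
  have hb : ∀ i, 1 ≤ r i ∧ r i ≤ n := fun i => by
    have := ZMod.val_lt (-x i)
    simp only [r]
    omega
  let σ := Tuple.sort (fun i => -r i)
  refine ⟨⟨r ∘ σ, fun i j hij => ?_, fun i => hb _⟩, σ⁻¹, ?_⟩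
  · have := Tuple.monotone_sort (fun i => -r i) hij
    simpa [σ] using this
  · funext i
    simp [res, hr]

/-- The weight whose parts have the given residues modulo `n`. -/
noncomputable def ofRes [NeZero n] (x : Fin k → ZMod n) : Alcove n k :=
  (exists_eq_res_comp x).choose

theorem ofRes_spec [NeZero n] (x : Fin k → ZMod n) :
    ∃ σ : Equiv.Perm (Fin k), x = (ofRes x).res ∘ σ :=
  (exists_eq_res_comp x).choose_spec

theorem ofRes_eq_iff [NeZero n] {x : Fin k → ZMod n} {lam : Alcove n k} :
    ofRes x = lam ↔ ∃ σ : Equiv.Perm (Fin k), x = lam.res ∘ σ := by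
  obtain ⟨τ, hτ⟩ := ofRes_spec x
  constructor
  · rintro rfl
    exact ⟨τ, hτ⟩
  · rintro ⟨σ, hσ⟩
    exact eq_of_res_comp_eq (hτ.symm.trans hσ)

@[simp] theorem ofRes_res [NeZero n] (lam : Alcove n k) : ofRes lam.res = lam :=
  ofRes_eq_iff.mpr ⟨1, rfl⟩

theorem ofRes_comp [NeZero n] (x : Fin k → ZMod n) (σ : Equiv.Perm (Fin k)) :
    ofRes (x ∘ σ) = ofRes x := by
  obtain ⟨τ, hτ⟩ := ofRes_spec x
  exact ofRes_eq_iff.mpr ⟨τ * σ, congrArg (· ∘ σ) hτ⟩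

theorem ofRes_eq_ofRes_iff [NeZero n] {x y : Fin k → ZMod n} :
    ofRes x = ofRes y ↔ ∃ σ : Equiv.Perm (Fin k), x = y ∘ σ := by
  constructor
  · intro h
    obtain ⟨σ, hσ⟩ := ofRes_eq_iff.mp h
    obtain ⟨τ, hτ⟩ := ofRes_spec y
    refine ⟨τ⁻¹ * σ, ?_⟩
    rw [hσ]
    conv_rhs => rw [hτ]
    funext i
    simp
  · rintro ⟨σ, rfl⟩
    exact ofRes_comp y σ

theorem sum_res (lam : Alcove n k) : ∑ i, lam.res i = (lam.size : ZMod n) := by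
  simp [res, size]

theorem sum_eq_size_ofRes [NeZero n] (x : Fin k → ZMod n) :
    ∑ i, x i = ((ofRes x).size : ZMod n) := by
  obtain ⟨τ, hτ⟩ := ofRes_spec x
  rw [← sum_res]
  conv_lhs => rw [hτ]
  exact Equiv.sum_comp τ (ofRes x).res

theorem top_res [NeZero n] : (top n k).res = 0 := by
  funext i
  simp [res, top]

/-- The orbit of $n^k$ is the single point $0$; this is why skewing by $n^k$ behaves like skewing by
the empty shape. -/
theorem ofRes_eq_top_iff [NeZero n] {x : Fin k → ZMod n} : ofRes x = top n k ↔ x = 0 := by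
  rw [ofRes_eq_iff, top_res]
  constructor
  · rintro ⟨σ, rfl⟩; rfl
  · rintro rfl; exact ⟨1, rfl⟩

theorem size_top [NeZero n] : (top n k).size = k * n := by
  simp [size, top]

end Alcove

/-! ## Complete and elementary symmetric functions -/

namespace SymFun

/-- The solution of Newton's recursion `r f_r = ∑_{i=1}^r ε^{i-1} p_i f_{r-i}`, `f_0 = 1`. It is
`h_r` for `ε = 1` and `e_r` for `ε = -1`. -/
noncomputable def newton (ε : ℂ) : ℕ → SymFun
  | 0 => 1
  | r + 1 => ((r : ℂ) + 1)⁻¹ • ∑ i : Fin (r + 1), ε ^ (i : ℕ) • (p i * newton ε (r - i))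

theorem newton_zero (ε : ℂ) : newton ε 0 = 1 := by rw [newton]

/-- Indices are shifted: `p i` is the power sum $p_{i+1}$. -/
theorem newton_succ (ε : ℂ) (r : ℕ) : ((r : ℂ) + 1) • newton ε (r + 1) =
    ∑ i ∈ Finset.range (r + 1), ε ^ i • (p i * newton ε (r - i)) := by
  have h : (r : ℂ) + 1 ≠ 0 := by exact_mod_cast r.succ_ne_zero
  rw [newton, smul_smul, mul_inv_cancel₀ h, one_smul, Finset.sum_range]

/-- Newton's recursion characterises its solution. -/
theorem eq_newton_of_recursion {B : Type*} [CommRing B] [Algebra ℂ B] (φ : SymFun →ₐ[ℂ] B) (ε : ℂ)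
    (x : ℕ → B) (h0 : x 0 = 1) (h : ∀ r : ℕ, ((r : ℂ) + 1) • x (r + 1) =
      ∑ i ∈ Finset.range (r + 1), ε ^ i • (φ (p i) * x (r - i))) (r : ℕ) :
    φ (newton ε r) = x r := by
  induction r using Nat.strong_induction_on with
  | _ r ih =>
    rcases r with _ | r
    · rw [newton_zero, map_one, h0]
    have hr : (r : ℂ) + 1 ≠ 0 := by exact_mod_cast r.succ_ne_zero
    apply smul_right_injective B hr
    change ((r : ℂ) + 1) • φ (newton ε (r + 1)) = ((r : ℂ) + 1) • x (r + 1)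
    rw [h, ← map_smul, newton_succ, map_sum]
    refine Finset.sum_congr rfl fun i hi => ?_
    rw [map_smul, map_mul, ih (r - i) (by omega)]

/-- The values of a power sum under the homomorphism with prescribed values on `newton ε`. -/
noncomputable def newtonInv {B : Type*} [CommRing B] [Algebra ℂ B] (ε : ℂ) (x : ℕ → B) : ℕ → B
  | r => (ε ^ r)⁻¹ • (((r : ℂ) + 1) • x (r + 1) -
      ∑ i : Fin r, ε ^ (i : ℕ) • (newtonInv ε x i * x (r - i)))

/-- The functions `newton ε r`, `r ≥ 1`, are algebraically free. -/
theorem exists_algHom_newton {B : Type*} [CommRing B] [Algebra ℂ B] {ε : ℂ} (hε : ε ≠ 0)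
    (x : ℕ → B) (h0 : x 0 = 1) : ∃ φ : SymFun →ₐ[ℂ] B, ∀ r, φ (newton ε r) = x r := by
  refine ⟨lift (newtonInv ε x), eq_newton_of_recursion _ ε x h0 fun r => ?_⟩
  simp only [lift_p]
  rw [Finset.sum_range_succ, Nat.sub_self, h0, mul_one]
  conv_rhs => rw [newtonInv, smul_smul, mul_inv_cancel₀ (pow_ne_zero r hε), one_smul]
  rw [Finset.sum_range]
  abel

/-- The convolution on the right satisfies Newton's recursion with $\Delta p_i$ in place of $p_i$:
multiplication by the degree acts as a derivation on tensors, and $\Delta p_i$ splits in the same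
way. -/
theorem comul_newton (ε : ℂ) (r : ℕ) : Bialgebra.comulAlgHom ℂ SymFun (newton ε r) =
    ∑ q ∈ Finset.HasAntidiagonal.antidiagonal r, newton ε q.1 ⊗ₜ[ℂ] newton ε q.2 := by
  refine eq_newton_of_recursion (Bialgebra.comulAlgHom ℂ SymFun) ε
    (fun r => ∑ q ∈ Finset.HasAntidiagonal.antidiagonal r, newton ε q.1 ⊗ₜ[ℂ] newton ε q.2)
    (by simp [newton_zero, Algebra.TensorProduct.one_def]) (fun r => ?_) r
  -- The recursion in a form that also covers $s=0$, where both sides vanish.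
  have key : ∀ s : ℕ, (s : ℂ) • newton ε s =
      ∑ i ∈ Finset.range s, ε ^ i • (p i * newton ε (s - 1 - i)) := by
    rintro (_ | s)
    · simp
    · rw [Nat.add_sub_cancel, ← newton_succ]
      push_cast
      rfl
  have hl : ((r : ℂ) + 1) • ∑ q ∈ Finset.HasAntidiagonal.antidiagonal (r + 1), newton ε q.1 ⊗ₜ[ℂ] newton ε q.2 =
      (∑ q ∈ Finset.HasAntidiagonal.antidiagonal (r + 1), ((q.1 : ℂ) • newton ε q.1) ⊗ₜ[ℂ] newton ε q.2) +
      ∑ q ∈ Finset.HasAntidiagonal.antidiagonal (r + 1), newton ε q.1 ⊗ₜ[ℂ] ((q.2 : ℂ) • newton ε q.2) := by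
    rw [Finset.smul_sum, ← Finset.sum_add_distrib]
    refine Finset.sum_congr rfl fun q hq => ?_
    have : (r : ℂ) + 1 = q.1 + q.2 := by
      rw [Finset.HasAntidiagonal.mem_antidiagonal] at hq
      exact_mod_cast hq.symm
    rw [this, add_smul, TensorProduct.smul_tmul', TensorProduct.tmul_smul,
      TensorProduct.smul_tmul']
  have h1 : ∑ q ∈ Finset.HasAntidiagonal.antidiagonal (r + 1), ((q.1 : ℂ) • newton ε q.1) ⊗ₜ[ℂ] newton ε q.2 =
      ∑ i ∈ Finset.range (r + 1), ∑ q ∈ Finset.HasAntidiagonal.antidiagonal (r - i),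
        ε ^ i • ((p i * newton ε q.1) ⊗ₜ[ℂ] newton ε q.2) := by
    simp_rw [key, TensorProduct.sum_tmul]
    rw [Finset.sum_sigma', Finset.sum_sigma']
    refine Finset.sum_nbij' (fun a => ⟨a.2, (a.1.1 - 1 - a.2, a.1.2)⟩)
      (fun a => ⟨(a.2.1 + a.1 + 1, a.2.2), a.1⟩) ?_ ?_ ?_ ?_ ?_
    · rintro ⟨⟨a, b⟩, i⟩ h
      simp only [Finset.mem_sigma, Finset.HasAntidiagonal.mem_antidiagonal, Finset.mem_range] at h ⊢
      omega
    · rintro ⟨i, ⟨a, b⟩⟩ h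
      simp only [Finset.mem_sigma, Finset.HasAntidiagonal.mem_antidiagonal, Finset.mem_range] at h ⊢
      omega
    · rintro ⟨⟨a, b⟩, i⟩ h
      simp only [Finset.mem_sigma, Finset.HasAntidiagonal.mem_antidiagonal, Finset.mem_range] at h ⊢
      have : a - 1 - i + i + 1 = a := by omega
      rw [this]
    · rintro ⟨i, ⟨a, b⟩⟩ h
      have : a + i + 1 - 1 - i = a := by omega
      simp only [this]
    · rintro ⟨⟨a, b⟩, i⟩ h
      simp only [TensorProduct.smul_tmul']
  have h2 : ∑ q ∈ Finset.HasAntidiagonal.antidiagonal (r + 1), newton ε q.1 ⊗ₜ[ℂ] ((q.2 : ℂ) • newton ε q.2) =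
      ∑ i ∈ Finset.range (r + 1), ∑ q ∈ Finset.HasAntidiagonal.antidiagonal (r - i),
        ε ^ i • (newton ε q.1 ⊗ₜ[ℂ] (p i * newton ε q.2)) := by
    simp_rw [key, TensorProduct.tmul_sum]
    rw [Finset.sum_sigma', Finset.sum_sigma']
    refine Finset.sum_nbij' (fun a => ⟨a.2, (a.1.1, a.1.2 - 1 - a.2)⟩)
      (fun a => ⟨(a.2.1, a.2.2 + a.1 + 1), a.1⟩) ?_ ?_ ?_ ?_ ?_
    · rintro ⟨⟨a, b⟩, i⟩ h
      simp only [Finset.mem_sigma, Finset.HasAntidiagonal.mem_antidiagonal, Finset.mem_range] at h ⊢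
      omega
    · rintro ⟨i, ⟨a, b⟩⟩ h
      simp only [Finset.mem_sigma, Finset.HasAntidiagonal.mem_antidiagonal, Finset.mem_range] at h ⊢
      omega
    · rintro ⟨⟨a, b⟩, i⟩ h
      simp only [Finset.mem_sigma, Finset.HasAntidiagonal.mem_antidiagonal, Finset.mem_range] at h ⊢
      have : b - 1 - i + i + 1 = b := by omega
      rw [this]
    · rintro ⟨i, ⟨a, b⟩⟩ h
      have : b + i + 1 - 1 - i = b := by omega
      simp only [this]
    · rintro ⟨⟨a, b⟩, i⟩ h
      simp only [TensorProduct.tmul_smul]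
  rw [hl, h1, h2, ← Finset.sum_add_distrib]
  refine Finset.sum_congr rfl fun i _ => ?_
  rw [comulAlgHom_p, Finset.mul_sum, Finset.smul_sum, ← Finset.sum_add_distrib]
  refine Finset.sum_congr rfl fun q _ => ?_
  rw [add_mul, Algebra.TensorProduct.tmul_mul_tmul, Algebra.TensorProduct.tmul_mul_tmul, one_mul,
    one_mul, smul_add]

end SymFun

/-! ### Monomial expansions of $h_r$ and $e_r$ -/

/-- The sum of all monomials of degree `r` in which every exponent satisfies `A`. -/
noncomputable def monomialSeries (A : ℕ → Prop) (r : ℕ) : MvPowerSeries ℕ ℂ :=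
  open Classical in fun m => if m.degree = r ∧ ∀ i, A (m i) then 1 else 0

open Classical in
theorem coeff_monomialSeries (A : ℕ → Prop) (r : ℕ) (m : ℕ →₀ ℕ) :
    MvPowerSeries.coeff m (monomialSeries A r) = if m.degree = r ∧ ∀ i, A (m i) then 1 else 0 :=
  rfl

theorem monomialSeries_zero {A : ℕ → Prop} (hA : A 0) : monomialSeries A 0 = 1 := by
  classical
  ext m
  rw [coeff_monomialSeries, MvPowerSeries.coeff_one]
  congr 1
  rw [Finsupp.degree_eq_zero_iff]
  exact propext ⟨fun h => h.1, fun h => ⟨h, fun i => by simpa [h] using hA⟩⟩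

/-- The monomials of $p_{s+1}$ are the $u_j^{s+1}$, so only the variables whose power $u_j^{s+1}$
divides $u^m$ contribute. -/
theorem coeff_powerSum_mul (s : ℕ) (g : MvPowerSeries ℕ ℂ) (m : ℕ →₀ ℕ) :
    MvPowerSeries.coeff m (powerSum (s + 1) * g) =
      ∑ j ∈ m.support with s + 1 ≤ m j,
        MvPowerSeries.coeff (m - Finsupp.single j (s + 1)) g := by
  classical
  rw [MvPowerSeries.coeff_mul]
  have h : ∀ q : (ℕ →₀ ℕ) × (ℕ →₀ ℕ), MvPowerSeries.coeff q.1 (powerSum (s + 1)) *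
      MvPowerSeries.coeff q.2 g =
      if ∃ i, q.1 = Finsupp.single i (s + 1) then MvPowerSeries.coeff q.2 g else 0 := by
    intro q
    simp only [powerSum, MvPowerSeries.coeff_apply, ite_mul, one_mul, zero_mul]
  simp_rw [h]
  rw [← Finset.sum_filter]
  symm
  refine Finset.sum_nbij (fun j => (Finsupp.single j (s + 1), m - Finsupp.single j (s + 1)))
    ?_ ?_ ?_ ?_
  · intro j hj
    simp only [Finset.mem_filter, Finset.HasAntidiagonal.mem_antidiagonal] at hj ⊢
    refine ⟨?_, j, rfl⟩
    exact add_tsub_cancel_of_le (Finsupp.single_le_iff.mpr hj.2)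
  · intro a _ b _ hab
    exact Finsupp.single_left_injective (Nat.succ_ne_zero s) (Prod.ext_iff.mp hab).1
  · rintro ⟨a, b⟩ hab
    simp only [Finset.coe_filter, Finset.HasAntidiagonal.mem_antidiagonal, Set.mem_ofPred_eq] at hab
    obtain ⟨h1, j, rfl⟩ := hab
    have h2 : s + 1 ≤ m j := by rw [← h1]; simp
    refine ⟨j, ?_, ?_⟩
    · simp only [Finset.coe_filter, Set.mem_ofPred_eq, Finsupp.mem_support_iff]
      exact ⟨by omega, h2⟩
    · simp only [Prod.mk.injEq, true_and]
      rw [← h1, add_tsub_cancel_left]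
  · intro j _
    rfl

/-- Newton's recursion for `monomialSeries`, reduced to a statement about a single exponent. -/
theorem monomialSeries_recursion (A : ℕ → Prop) (ε : ℂ)
    (hA : open Classical in ∀ s, 0 < s → (∑ i ∈ Finset.range s, if A (s - (i + 1)) then ε ^ i else 0)
      = if A s then (s : ℂ) else 0) (r : ℕ) :
    ((r : ℂ) + 1) • monomialSeries A (r + 1) =
      ∑ i ∈ Finset.range (r + 1), ε ^ i • (powerSum (i + 1) * monomialSeries A (r - i)) := by
  classical
  ext m
  rw [map_sum, map_smul, coeff_monomialSeries]
  simp only [map_smul, coeff_powerSum_mul, coeff_monomialSeries, smul_eq_mul]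
  by_cases hd : m.degree = r + 1
  swap
  · rw [if_neg (fun h => hd h.1), mul_zero]
    symm
    refine Finset.sum_eq_zero fun i hi => ?_
    rw [Finset.sum_eq_zero, mul_zero]
    intro j hj
    rw [if_neg]
    rintro ⟨h, -⟩
    apply hd
    rw [Finset.mem_filter] at hj
    have h1 : m - Finsupp.single j (i + 1) + Finsupp.single j (i + 1) = m :=
      tsub_add_cancel_of_le (Finsupp.single_le_iff.mpr hj.2)
    have h2 := congrArg Finsupp.degree h1
    rw [map_add, Finsupp.degree_single, h] at h2
    rw [Finset.mem_range] at hi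
    omega
  have hle : ∀ j, m j ≤ r + 1 := fun j => hd ▸ Finsupp.le_degree j m
  have h1 : ∀ i ∈ Finset.range (r + 1), ε ^ i * ∑ j ∈ m.support with i + 1 ≤ m j,
      (if (m - Finsupp.single j (i + 1)).degree = r - i ∧
        ∀ a, A ((m - Finsupp.single j (i + 1)) a) then (1 : ℂ) else 0) =
      ∑ j ∈ m.support, if i + 1 ≤ m j then if ∀ a, A ((m - Finsupp.single j (i + 1)) a) then
        ε ^ i else 0 else 0 := by
    intro i hi
    rw [Finset.mul_sum, Finset.sum_filter]
    refine Finset.sum_congr rfl fun j _ => ?_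
    split_ifs with h2 h3 h4 h4
    · simp
    · exact absurd h3.2 h4
    · refine absurd ⟨?_, h4⟩ h3
      have h1 : m - Finsupp.single j (i + 1) + Finsupp.single j (i + 1) = m :=
        tsub_add_cancel_of_le (Finsupp.single_le_iff.mpr h2)
      have h2 := congrArg Finsupp.degree h1
      rw [map_add, Finsupp.degree_single, hd] at h2
      rw [Finset.mem_range] at hi
      omega
    · simp
    · rfl
  -- With the variable $u_j$ fixed, the sum over the exponent removed from it is the one-exponent
  -- identity `hA` at $m_j$; summing $m_j$ over $j$ gives back the degree.
  rw [Finset.sum_congr rfl h1, Finset.sum_comm]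
  have h2 : ∀ j ∈ m.support, (∑ i ∈ Finset.range (r + 1), if i + 1 ≤ m j then
      if ∀ a, A ((m - Finsupp.single j (i + 1)) a) then ε ^ i else 0 else 0) =
      if ∀ a, A (m a) then (m j : ℂ) else 0 := by
    intro j hj
    have hj0 : 0 < m j := Nat.pos_of_ne_zero (Finsupp.mem_support_iff.mp hj)
    rw [← Finset.sum_filter]
    have h3 : (Finset.range (r + 1)).filter (fun i => i + 1 ≤ m j) = Finset.range (m j) := by
      ext i
      have := hle j
      simp only [Finset.mem_filter, Finset.mem_range]
      omega
    have h4 : ∀ i, (∀ a, A ((m - Finsupp.single j (i + 1)) a)) ↔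
        (∀ a, a ≠ j → A (m a)) ∧ A (m j - (i + 1)) := by
      intro i
      constructor
      · intro h
        refine ⟨fun a ha => ?_, by simpa using h j⟩
        have := h a
        rwa [Finsupp.tsub_apply, Finsupp.single_eq_of_ne ha, Nat.sub_zero] at this
      · rintro ⟨h, h'⟩ a
        rcases eq_or_ne a j with rfl | ha
        · simpa using h'
        · rw [Finsupp.tsub_apply, Finsupp.single_eq_of_ne ha, Nat.sub_zero]
          exact h a ha
    rw [h3]
    -- If some other exponent is inadmissible, both sides vanish.
    by_cases hP : ∀ a, a ≠ j → A (m a)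
    · have h5 : (∀ a, A (m a)) ↔ A (m j) :=
        ⟨fun h => h j, fun h a => by
          rcases eq_or_ne a j with rfl | ha
          · exact h
          · exact hP a ha⟩
      simp only [h4, h5]
      rw [← hA _ hj0]
      refine Finset.sum_congr rfl fun i _ => ?_
      exact if_congr (and_iff_right hP) rfl rfl
    · rw [if_neg fun h => hP fun a _ => h a]
      refine Finset.sum_eq_zero fun i _ => ?_
      rw [if_neg fun h => hP ((h4 i).mp h).1]
  rw [Finset.sum_congr rfl h2]
  by_cases h : ∀ a, A (m a)
  · simp only [h, hd, implies_true, and_self, if_true, mul_one]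
    rw [← Nat.cast_sum, ← Finsupp.degree_apply, hd]
    push_cast
    rfl
  · simp [h]

namespace SymFun

theorem coe_newton_one (r : ℕ) :
    (newton 1 r : MvPowerSeries ℕ ℂ) = monomialSeries (fun _ => True) r := by
  refine eq_newton_of_recursion SymFun.val 1 _ (monomialSeries_zero trivial) (fun r => ?_) r
  exact monomialSeries_recursion (fun _ => True) 1 (fun s _ => by simp) r

theorem coe_newton_neg_one (r : ℕ) :
    (newton (-1) r : MvPowerSeries ℕ ℂ) = monomialSeries (fun s => s ≤ 1) r := by
  refine eq_newton_of_recursion SymFun.val (-1) _ (monomialSeries_zero zero_le_one) (fun r => ?_) r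
  refine monomialSeries_recursion (fun s => s ≤ 1) (-1) (fun s hs => ?_) r
  obtain rfl | ⟨t, rfl⟩ : s = 1 ∨ ∃ t, s = t + 2 := by
    rcases s with _ | _ | t
    · omega
    · left; rfl
    · right; exact ⟨t, rfl⟩
  · simp
  -- For $s\ge2$ only $i=s-2$ and $i=s-1$ leave an exponent at most $1$, and their signs cancel.
  · rw [Finset.sum_range_succ, Finset.sum_range_succ, Finset.sum_eq_zero]
    · simp [pow_succ]
    · intro i hi
      rw [Finset.mem_range] at hi
      rw [if_neg (by omega)]

end SymFun

/-! ## Multiplicities in representations of the generalised symmetric group -/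

section Rep

open Representation

section General

variable {K G V W : Type*} [Field K] [Group G] [AddCommGroup V] [Module K V] [AddCommGroup W]
  [Module K W] {ρ : Representation K G V} {σ : Representation K G W}

/-- The subrepresentations of isomorphic representations correspond to each other. -/
def Representation.Equiv.subrepresentationOrderIso (e : Representation.Equiv ρ σ) :
    Subrepresentation ρ ≃o Subrepresentation σ where
  toFun p := ⟨p.toSubmodule.comap e.symm.toLinearMap, fun g v hv => by
    have h : e.symm (σ g v) = ρ g (e.symm v) :=
      e.symm.toIntertwiningMap.isIntertwining _ _ g v
    change e.symm (σ g v) ∈ p.toSubmodule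
    rw [h]
    exact p.apply_mem_toSubmodule g hv⟩
  invFun p := ⟨p.toSubmodule.comap e.toLinearMap, fun g v hv => by
    have h : e (ρ g v) = σ g (e v) := e.toIntertwiningMap.isIntertwining _ _ g v
    change e (ρ g v) ∈ p.toSubmodule
    rw [h]
    exact p.apply_mem_toSubmodule g hv⟩
  left_inv p := by
    apply Subrepresentation.toSubmodule_injective
    ext v
    change e.symm (e v) ∈ p.toSubmodule ↔ _
    rw [e.symm_apply_apply]
  right_inv p := by
    apply Subrepresentation.toSubmodule_injective
    ext v
    change e (e.symm v) ∈ p.toSubmodule ↔ _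
    rw [e.apply_symm_apply]
  map_rel_iff' := by
    intro p q
    constructor
    · intro h v hv
      have h1 : e.symm (e v) ∈ q.toSubmodule :=
        h (show e.symm (e v) ∈ p.toSubmodule by rwa [e.symm_apply_apply])
      rwa [e.symm_apply_apply] at h1
    · intro h v hv
      exact h hv

theorem Representation.Equiv.isIrreducible (e : Representation.Equiv ρ σ) [ρ.IsIrreducible] :
    σ.IsIrreducible :=
  e.subrepresentationOrderIso.symm.isSimpleOrder

/-- A pair of complementary subrepresentations decomposes a representation. -/
noncomputable def Subrepresentation.prodEquivOfIsCompl {p q : Subrepresentation ρ}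
    (h : IsCompl p.toSubmodule q.toSubmodule) :
    Representation.Equiv (p.toRepresentation.prod q.toRepresentation) ρ :=
  .mk (Submodule.prodEquivOfIsCompl _ _ h) fun g => by
    ext v <;> simp [Representation.prod, Subrepresentation.toRepresentation]

/-- Intertwining maps into a product. -/
noncomputable def Representation.IntertwiningMap.prodLinearEquiv {U : Type*} [AddCommGroup U] [Module K U]
    (τ : Representation K G U) (ρ : Representation K G V) (σ : Representation K G W) :
    IntertwiningMap τ (ρ.prod σ) ≃ₗ[K] IntertwiningMap τ ρ × IntertwiningMap τ σ where
  toFun f := ((IntertwiningMap.fst K ρ σ).comp f, (IntertwiningMap.snd K ρ σ).comp f)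
  invFun f := f.1.prod f.2
  map_add' _ _ := rfl
  map_smul' _ _ := rfl
  left_inv _ := rfl
  right_inv _ := rfl

/-- Intertwining maps into isomorphic representations. -/
def Representation.IntertwiningMap.congrRight {U : Type*} [AddCommGroup U] [Module K U]
    (τ : Representation K G U) (e : Representation.Equiv ρ σ) :
    IntertwiningMap τ ρ ≃ₗ[K] IntertwiningMap τ σ where
  toFun f := e.toIntertwiningMap.comp f
  invFun f := e.symm.toIntertwiningMap.comp f
  map_add' f g := by ext v; exact map_add e _ _
  map_smul' c f := by ext v; exact map_smul e _ _
  left_inv f := by ext v; exact e.symm_apply_apply _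
  right_inv f := by ext v; exact e.apply_symm_apply _

end General

section Weights

variable {n k : ℕ} {V W : Type*} [AddCommGroup V] [Module ℂ V] [AddCommGroup W] [Module ℂ W]
  {ρ : Representation ℂ (GenSymGroup n k) V} {σ : Representation ℂ (GenSymGroup n k) W}

theorem typeMult_congr (e : Representation.Equiv ρ σ) (lam : Alcove n k) :
    typeMult ρ lam = typeMult σ lam := by
  refine LinearEquiv.finrank_eq ?_
  refine e.toLinearEquiv.ofSubmodules _ _ ?_
  ext w
  simp only [Submodule.mem_map]
  constructor
  · rintro ⟨v, hv, rfl⟩ y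
    have h : e (ρ (SemidirectProduct.inl y) v) = σ (SemidirectProduct.inl y) (e v) :=
      e.toIntertwiningMap.isIntertwining _ _ _ v
    change σ (SemidirectProduct.inl y) (e v) = _ • (e v)
    rw [← h, hv y, map_smul]
  · intro hw
    refine ⟨e.symm w, fun y => ?_, e.apply_symm_apply w⟩
    have h : e.symm (σ (SemidirectProduct.inl y) w) = ρ (SemidirectProduct.inl y) (e.symm w) :=
      e.symm.toIntertwiningMap.isIntertwining _ _ _ w
    rw [← h, hw y, map_smul]

theorem typeMult_prod [FiniteDimensional ℂ V] [FiniteDimensional ℂ W] (lam : Alcove n k) :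
    typeMult (ρ.prod σ) lam = typeMult ρ lam + typeMult σ lam := by
  rw [typeMult, typeMult, typeMult, ← Module.finrank_prod]
  refine LinearEquiv.finrank_eq ?_
  have h : torusWeightSpace (ρ.prod σ) lam.1 =
      (torusWeightSpace ρ lam.1).prod (torusWeightSpace σ lam.1) := by
    ext v
    rw [Submodule.mem_prod]
    constructor
    · intro hv
      exact ⟨fun y => congrArg Prod.fst (hv y), fun y => congrArg Prod.snd (hv y)⟩
    · intro hv y
      exact Prod.ext (hv.1 y) (hv.2 y)
  rw [h]
  exact
    { toFun := fun v => (⟨v.1.1, v.2.1⟩, ⟨v.1.2, v.2.2⟩)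
      invFun := fun v => ⟨(v.1.1, v.2.1), v.1.2, v.2.2⟩
      map_add' := fun _ _ => rfl
      map_smul' := fun _ _ => rfl
      left_inv := fun _ => rfl
      right_inv := fun _ => rfl }

instance [NeZero n] : Finite (GenSymGroup n k) :=
  Finite.of_equiv _ SemidirectProduct.equivProd.symm

/-- Maschke's theorem for subrepresentations. -/
theorem exists_isCompl_subrepresentation [NeZero n] (p : Subrepresentation ρ) :
    ∃ q : Subrepresentation ρ, IsCompl p.toSubmodule q.toSubmodule := by
  have : NeZero ((Nat.card (GenSymGroup n k) : ℕ) : ℂ) :=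
    ⟨by exact_mod_cast Nat.card_pos.ne'⟩
  have h : IsSemisimpleRepresentation ρ := by
    rw [isSemisimpleRepresentation_iff_isSemisimpleModule_asModule]
    infer_instance
  obtain ⟨q, hq⟩ := exists_isCompl p
  refine ⟨q, ?_⟩
  rw [isCompl_iff, disjoint_iff, codisjoint_iff] at hq ⊢
  exact ⟨congrArg Subrepresentation.toSubmodule hq.1, congrArg Subrepresentation.toSubmodule hq.2⟩

instance (c : IrrepClass n k) : c.rep.IsIrreducible := (Quotient.out c).2.2

/-- Irreducibles are classified on the spaces $\mathbb C^m$ only; a basis transports any other one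
there. -/
theorem exists_irrepClass_equiv [FiniteDimensional ℂ V] [ρ.IsIrreducible] :
    ∃ c : IrrepClass n k, Nonempty (Representation.Equiv c.rep ρ) := by
  let b := (Module.finBasis ℂ V).equivFun
  let ρ' : Representation ℂ (GenSymGroup n k) (Fin (Module.finrank ℂ V) → ℂ) :=
    { toFun := fun g => b.toLinearMap ∘ₗ ρ g ∘ₗ b.symm.toLinearMap
      map_one' := by ext; simp
      map_mul' := fun g h => by ext; simp }
  let e : Representation.Equiv ρ ρ' := .mk b fun g => by ext; simp [ρ']
  have h : ρ'.IsIrreducible := e.isIrreducible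
  let U : Irrep n k := ⟨_, ρ', h⟩
  refine ⟨Quotient.mk (Irrep.setoid n k) U, ?_⟩
  obtain ⟨f⟩ : (Irrep.setoid n k).r (Quotient.out (Quotient.mk (Irrep.setoid n k) U)) U :=
    Quotient.mk_out (s := Irrep.setoid n k) U
  exact ⟨f.trans e.symm⟩

/-- Schur's lemma over $\mathbb C$. -/
theorem finrank_intertwiningMap_of_irreducible [FiniteDimensional ℂ V] [ρ.IsIrreducible]
    {c₀ : IrrepClass n k} (e : Representation.Equiv c₀.rep ρ) (c : IrrepClass n k) :
    Module.finrank ℂ (IntertwiningMap c.rep ρ) = open Classical in if c = c₀ then 1 else 0 := by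
  split_ifs with h
  · subst h
    rw [← (IntertwiningMap.congrRight c.rep e).finrank_eq]
    exact IsIrreducible.finrank_intertwiningMap_self c.rep
  · have : IsEmpty (Representation.Equiv c.rep ρ) := by
      refine ⟨fun f => h ?_⟩
      rw [← Quotient.out_eq c, ← Quotient.out_eq c₀]
      exact Quotient.sound ⟨f.trans e.symm⟩
    exact Module.finrank_zero_of_subsingleton

/-- Both sides are additive in $\rho$, so Maschke's theorem and induction on the dimension reduce to
an irreducible $\rho$. The finite support is part of the induction because additivity of `finsum`
needs it. -/
theorem typeMult_eq_finsum_aux [NeZero n] (lam : Alcove n k) (N : ℕ) :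
    ∀ (V : Type*) [AddCommGroup V] [Module ℂ V] [FiniteDimensional ℂ V]
      (ρ : Representation ℂ (GenSymGroup n k) V), Module.finrank ℂ V = N →
      (Function.support fun c : IrrepClass n k =>
        Module.finrank ℂ (IntertwiningMap c.rep ρ) * typeMult c.rep lam).Finite ∧
      ∑ᶠ c : IrrepClass n k, Module.finrank ℂ (IntertwiningMap c.rep ρ) * typeMult c.rep lam =
        typeMult ρ lam := by
  induction N using Nat.strong_induction_on with
  | _ N ih =>
    intro V _ _ _ ρ hN
    by_cases hirr : ρ.IsIrreducible
    · obtain ⟨c₀, ⟨e⟩⟩ := exists_irrepClass_equiv (ρ := ρ)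
      have h0 : ∀ c ≠ c₀, Module.finrank ℂ (IntertwiningMap c.rep ρ) * typeMult c.rep lam = 0 := by
        intro c hc
        rw [finrank_intertwiningMap_of_irreducible e, if_neg hc, zero_mul]
      refine ⟨(Set.finite_singleton c₀).subset fun c hc => ?_, ?_⟩
      · by_contra h
        exact hc (h0 c h)
      · rw [finsum_eq_single _ c₀ h0, finrank_intertwiningMap_of_irreducible e, if_pos rfl, one_mul,
          typeMult_congr e]
    by_cases htriv : Subsingleton V
    · have h0 : ∀ c : IrrepClass n k,
          Module.finrank ℂ (IntertwiningMap c.rep ρ) * typeMult c.rep lam = 0 := by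
        intro c
        have : Subsingleton (IntertwiningMap c.rep ρ) :=
          ⟨fun f g => DFunLike.ext _ _ fun v => Subsingleton.elim _ _⟩
        rw [Module.finrank_zero_of_subsingleton, zero_mul]
      simp only [h0, finsum_zero]
      exact ⟨by simp [Function.support], Module.finrank_zero_of_subsingleton.symm⟩
    rw [not_subsingleton_iff_nontrivial] at htriv
    have hbt : (⊥ : Subrepresentation ρ) ≠ ⊤ := fun h =>
      bot_ne_top (congrArg Subrepresentation.toSubmodule h : (⊥ : Submodule ℂ V) = ⊤)
    obtain ⟨p, hp0, hp1⟩ : ∃ p : Subrepresentation ρ, p ≠ ⊥ ∧ p ≠ ⊤ := by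
      by_contra! h
      exact hirr
        { exists_pair_ne := ⟨⊥, ⊤, hbt⟩
          eq_bot_or_eq_top := fun p => or_iff_not_imp_left.mpr (h p) }
    obtain ⟨q, hpq⟩ := exists_isCompl_subrepresentation p
    have hsum := Submodule.finrank_add_eq_of_isCompl hpq
    have hp0' : 0 < Module.finrank ℂ p.toSubmodule := by
      rw [Nat.pos_iff_ne_zero, ne_eq, Submodule.finrank_eq_zero]
      exact fun h => hp0 (Subrepresentation.toSubmodule_injective h)
    have hp1' : Module.finrank ℂ p.toSubmodule < Module.finrank ℂ V := by
      refine Submodule.finrank_lt fun h => hp1 (Subrepresentation.toSubmodule_injective h)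
    obtain ⟨fp, sp⟩ := ih _ (by omega) p.toSubmodule p.toRepresentation rfl
    obtain ⟨fq, sq⟩ := ih _ (by omega) q.toSubmodule q.toRepresentation rfl
    have e := Subrepresentation.prodEquivOfIsCompl hpq
    have hc : ∀ c : IrrepClass n k,
        Module.finrank ℂ (IntertwiningMap c.rep ρ) * typeMult c.rep lam =
        Module.finrank ℂ (IntertwiningMap c.rep p.toRepresentation) * typeMult c.rep lam +
        Module.finrank ℂ (IntertwiningMap c.rep q.toRepresentation) * typeMult c.rep lam := by
      intro c
      rw [← (IntertwiningMap.congrRight c.rep e).finrank_eq,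
        (IntertwiningMap.prodLinearEquiv c.rep _ _).finrank_eq, Module.finrank_prod, add_mul]
    simp only [hc]
    refine ⟨(fp.union fq).subset (Function.support_add _ _), ?_⟩
    rw [finsum_add_distrib fp fq, sp, sq, ← typeMult_prod, typeMult_congr e]

/-- The dimension of a weight space as a sum over the irreducible constituents. -/
theorem typeMult_eq_finsum [NeZero n] [FiniteDimensional ℂ V] (lam : Alcove n k) :
    ∑ᶠ (c : IrrepClass n k) (_ : HasType c.rep lam),
      Module.finrank ℂ (IntertwiningMap c.rep ρ) * typeMult c.rep lam = typeMult ρ lam := by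
  classical
  rw [← (typeMult_eq_finsum_aux lam _ V ρ rfl).2]
  refine finsum_congr fun c => ?_
  by_cases h : HasType c.rep lam
  -- The restriction to type $\lambda$ is harmless: every other class has multiplicity zero.
  · rw [finsum_eq_if, if_pos h]
  · rw [finsum_eq_if, if_neg h]
    have : torusWeightSpace c.rep lam.1 = ⊥ := by simpa [HasType] using h
    rw [typeMult, this, finrank_bot, mul_zero]

end Weights
end Rep

/-! ## The fusion coefficients count factorisations of residues -/

section Fusion

open Representation

variable {n k : ℕ}

/-- A subspace cut out by the vanishing of coordinates is spanned by the remaining basis vectors. It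
serves to compute weight spaces from a basis of weight vectors. -/
theorem Module.Basis.finrank_eq_ncard_of_mem_iff {K V ι : Type*} [Field K] [AddCommGroup V]
    [Module K V] [Finite ι] (b : Module.Basis ι K V) (S : Set ι) (T : Submodule K V)
    (h : ∀ v, v ∈ T ↔ ∀ i, i ∉ S → b.repr v i = 0) : Module.finrank K T = S.ncard := by
  classical
  have := Fintype.ofFinite ι
  have hT : T = Submodule.span K (Set.range fun i : S => b i) := by
    ext v
    have h1 : (Set.range fun i : S => b i) = b '' S := by
      ext; simp
    rw [h, h1, b.mem_span_image]
    constructor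
    · intro hv i hi
      by_contra hiS
      exact Finsupp.mem_support_iff.mp hi (hv i hiS)
    · intro hv i hi
      by_contra h0
      exact hi (hv (Finsupp.mem_support_iff.mpr h0))
  rw [hT]
  refine (finrank_span_eq_card (b.linearIndependent.comp _ Subtype.val_injective)).trans ?_
  rw [← Nat.card_eq_fintype_card, Nat.card_coe_set_eq]

instance (lam : Alcove n k) : Finite (permOrbit lam) :=
  Finite.of_surjective (fun w : Equiv.Perm (Fin k) => (⟨lam.1 ∘ w, w, rfl⟩ : permOrbit lam))
    fun ⟨_, w, hw⟩ => ⟨w, Subtype.ext hw.symm⟩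

theorem torusChar_add (p q : Fin k → ℤ) (y : Fin k → rootsOfUnity n ℂ) :
    torusChar (p + q) y = torusChar p y * torusChar q y := by
  simp only [torusChar, Pi.add_apply, zpow_add, Finset.prod_mul_distrib, Units.val_mul]

theorem torusChar_eq_iff [NeZero n] (p q : Fin k → ℤ) :
    (∀ y : Fin k → rootsOfUnity n ℂ, torusChar p y = torusChar q y) ↔
      ∀ i, (p i : ZMod n) = q i := by
  constructor
  · intro h i
    -- The characters are compared on the element with a primitive root in position $i$ and $1$
    -- elsewhere.
    have hζ := Complex.isPrimitiveRoot_exp n (NeZero.ne n)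
    let ζ := hζ.toRootsOfUnity
    have h1 : ∀ r : Fin k → ℤ, torusChar r (Pi.mulSingle i ζ) =
        Complex.exp (2 * Real.pi * Complex.I / n) ^ r i := by
      intro r
      rw [torusChar, Finset.prod_eq_single i]
      · rw [Pi.mulSingle_eq_same]
        simp [ζ]
      · intro j _ hj
        rw [Pi.mulSingle_eq_of_ne hj]
        simp
      · simp
    have h2 := h (Pi.mulSingle i ζ)
    rw [h1, h1] at h2
    rw [← sub_eq_zero, ← Int.cast_sub, ZMod.intCast_zmod_eq_zero_iff_dvd,
      ← hζ.zpow_eq_one_iff_dvd, zpow_sub₀ (Complex.exp_ne_zero _), h2]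
    exact div_self (zpow_ne_zero _ (Complex.exp_ne_zero _))
  · intro h y
    rw [torusChar, torusChar]
    congr 1
    refine Finset.prod_congr rfl fun i _ => ?_
    obtain ⟨c, hc⟩ := (ZMod.intCast_eq_intCast_iff_dvd_sub _ _ _).mp (h i)
    have hy : ((y i : rootsOfUnity n ℂ) : ℂˣ) ^ n = 1 := (mem_rootsOfUnity _ _).mp (y i).2
    rw [show q i = p i + n * c by omega, zpow_add, zpow_mul, zpow_natCast, hy, one_zpow, mul_one]

/-- The tensors of indicator functions are weight vectors: the one at $(p,q)$ has weight $p+q$. -/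
theorem repr_tprod_standardIrrep {mu nu : Alcove n k} (y : Fin k → rootsOfUnity n ℂ)
    (v : (permOrbit mu → ℂ) ⊗[ℂ] (permOrbit nu → ℂ)) (i : permOrbit mu × permOrbit nu) :
    ((Pi.basisFun ℂ (permOrbit mu)).tensorProduct (Pi.basisFun ℂ (permOrbit nu))).repr
      (((standardIrrep mu).tprod (standardIrrep nu)) (SemidirectProduct.inl y) v) i =
    torusChar (i.1.1 + i.2.1) y *
      ((Pi.basisFun ℂ (permOrbit mu)).tensorProduct (Pi.basisFun ℂ (permOrbit nu))).repr v i := by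
  induction v with
  | zero => simp
  | add a b ha hb => rw [map_add, map_add, Finsupp.add_apply, ha, hb, map_add, Finsupp.add_apply,
      mul_add]
  | tmul a b =>
    obtain ⟨p, q⟩ := i
    rw [torusChar_add]
    have h : ∀ (lam : Alcove n k) (f : permOrbit lam → ℂ) (p : permOrbit lam),
        standardIrrep lam (SemidirectProduct.inl y) f p = torusChar p.1 y * f p := fun _ _ _ => rfl
    simp only [Representation.tprod_apply, TensorProduct.map_tmul,
      Module.Basis.tensorProduct_repr_tmul_apply, Pi.basisFun_repr, h, smul_eq_mul]
    ring

-- The left side is the dimension of the weight space of $\lambda$ in $L_\mu\otimes L_\nu$, so it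
-- counts the pairs $(p,q)$ with $p+q\equiv\lambda$. Parts in $1,\dots,n$ are determined by their
-- residues, hence $p$ by $y$ and $q$ by $\lambda-y$.
open Classical in
theorem fusionCoeff_eq_card [NeZero n] (mu nu lam : Alcove n k) :
    fusionCoeff mu nu lam = (Finset.univ.filter fun y : Fin k → ZMod n =>
      Alcove.ofRes y = mu ∧ Alcove.ofRes (lam.res - y) = nu).card := by
  rw [fusionCoeff, typeMult_eq_finsum, typeMult,
    ((Pi.basisFun ℂ (permOrbit mu)).tensorProduct
      (Pi.basisFun ℂ (permOrbit nu))).finrank_eq_ncard_of_mem_iff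
      {i | ∀ j, ((i.1.1 j + i.2.1 j : ℤ) : ZMod n) = lam.1 j}]
  · rw [← Set.ncard_coe_finset]
    refine Set.ncard_congr (fun i _ => fun j => ((i.1.1 j : ℤ) : ZMod n)) ?_ ?_ ?_
    · rintro ⟨⟨p, w, hp⟩, ⟨q, w', hq⟩⟩ h
      simp only [Set.mem_ofPred_eq, Int.cast_add, Finset.coe_filter, Finset.mem_univ,
        true_and] at h ⊢
      refine ⟨Alcove.ofRes_eq_iff.mpr ⟨w, ?_⟩, Alcove.ofRes_eq_iff.mpr ⟨w', ?_⟩⟩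
      · subst hp; rfl
      · subst hq
        funext j
        rw [Pi.sub_apply, Alcove.res, ← h j, add_sub_cancel_left]
        rfl
    · rintro ⟨⟨p, w, hp⟩, ⟨q, w', hq⟩⟩ ⟨⟨p', v, hp'⟩, ⟨q', v', hq'⟩⟩ h h' heq
      simp only [Set.mem_ofPred_eq, Int.cast_add] at h h'
      have h1 : p = p' := by
        subst hp hp'
        funext j
        exact Alcove.eq_of_intCast_eq (mu.2.2 _) (mu.2.2 _) (congrFun heq j)
      have h2 : q = q' := by
        subst hq hq'
        funext j
        refine Alcove.eq_of_intCast_eq (nu.2.2 _) (nu.2.2 _) ?_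
        have := (h j).trans (h' j).symm
        rw [h1] at this
        exact add_left_cancel this
      subst h1 h2
      rfl
    · intro y hy
      simp only [Finset.coe_filter, Finset.mem_univ, true_and, Set.mem_ofPred_eq] at hy
      obtain ⟨w, hw⟩ := Alcove.ofRes_eq_iff.mp hy.1
      obtain ⟨w', hw'⟩ := Alcove.ofRes_eq_iff.mp hy.2
      refine ⟨(⟨mu.1 ∘ w, w, rfl⟩, ⟨nu.1 ∘ w', w', rfl⟩), fun j => ?_, hw.symm⟩
      have h1 := congrFun hw j
      have h2 := congrFun hw' j
      simp only [Function.comp, Alcove.res, Pi.sub_apply] at h1 h2 ⊢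
      rw [Int.cast_add, ← h1, ← h2, add_sub_cancel]
  · intro v
    set b := (Pi.basisFun ℂ (permOrbit mu)).tensorProduct (Pi.basisFun ℂ (permOrbit nu))
    constructor
    · intro hv i hi
      by_contra h0
      refine hi ((torusChar_eq_iff (i.1.1 + i.2.1) lam.1).mp fun y => ?_)
      have h1 := congrArg (fun w => b.repr w i) (hv y)
      simp only [map_smul, Finsupp.smul_apply, smul_eq_mul] at h1
      rw [repr_tprod_standardIrrep] at h1
      exact mul_right_cancel₀ h0 h1
    · intro hv y
      apply b.repr.injective
      ext i
      rw [repr_tprod_standardIrrep, map_smul, Finsupp.smul_apply, smul_eq_mul]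
      by_cases hi : ∀ j, ((i.1.1 j + i.2.1 j : ℤ) : ZMod n) = lam.1 j
      · rw [(torusChar_eq_iff (i.1.1 + i.2.1) lam.1).mpr hi y]
      · rw [hv i hi, mul_zero, mul_zero]

end Fusion

/-! ## Sums over compositions with prescribed residues -/

section ResidueSum

open Finset.HasAntidiagonal

variable {n k : ℕ}

/-- Otherwise $a\ge b+n\ge n$. -/
theorem le_of_natCast_eq_intCast {a : ℤ} {b : ℕ} (ha : a < n) (h : (b : ZMod n) = (a : ZMod n)) :
    a ≤ b := by
  have h1 : ((b : ℤ) : ZMod n) = (a : ZMod n) := by exact_mod_cast h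
  obtain ⟨c, hc⟩ := (ZMod.intCast_eq_intCast_iff_dvd_sub _ _ _).mp h1
  by_contra! hlt
  have h2 : 0 < c := by
    by_contra! h3
    nlinarith [mul_nonneg (Int.natCast_nonneg n) (neg_nonneg.mpr h3)]
  nlinarith [mul_le_mul_of_nonneg_left (show (1 : ℤ) ≤ c by omega) (Int.natCast_nonneg n),
    Int.natCast_nonneg b]

open Classical in
/-- The compositions of `r` with `k` parts, zero allowed, that have the residues `x`. -/
noncomputable def residueComp (r : ℤ) (x : Fin k → ZMod n) : Finset (Fin k → ℕ) :=
  (Finset.piAntidiag Finset.univ r.toNat).filter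
    -- This condition empties the set for negative $r$, where `toNat` would give $0$.
    fun b => (r.toNat : ℤ) = r ∧ ∀ i, (b i : ZMod n) = x i

theorem mem_residueComp {r : ℤ} {x : Fin k → ZMod n} {b : Fin k → ℕ} :
    b ∈ residueComp r x ↔ ∑ i, (b i : ℤ) = r ∧ ∀ i, (b i : ZMod n) = x i := by
  rw [residueComp, Finset.mem_filter, Finset.mem_piAntidiag, ← and_assoc]
  refine and_congr_left fun _ => ⟨fun h => ?_, fun h => ?_⟩
  · rw [← h.2, ← h.1.1]
    push_cast
    rfl
  · have : (0 : ℤ) ≤ ∑ i, (b i : ℤ) := Finset.sum_nonneg fun _ _ => Int.natCast_nonneg _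
    rw [h] at this
    have h2 := Int.toNat_of_nonneg this
    refine ⟨⟨?_, fun _ _ => Finset.mem_univ _⟩, h2⟩
    zify
    rw [h, h2]

theorem nonneg_of_mem_residueComp {r : ℤ} {x : Fin k → ZMod n} {b : Fin k → ℕ}
    (h : b ∈ residueComp r x) : 0 ≤ r := by
  rw [← (mem_residueComp.mp h).1]
  exact Finset.sum_nonneg fun _ _ => Int.natCast_nonneg _

theorem intCast_eq_sum_of_mem_residueComp {r : ℤ} {x : Fin k → ZMod n} {b : Fin k → ℕ}
    (h : b ∈ residueComp r x) : (r : ZMod n) = ∑ i, x i := by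
  rw [mem_residueComp] at h
  rw [← h.1]
  push_cast
  exact Finset.sum_congr rfl fun i _ => h.2 i

/-- The least natural number with the residue of $\lambda_i$ is $\lambda_i$ itself, or $0$ when
$\lambda_i=n$. This is the origin of the bound $d\ge-m_n(\lambda)$. -/
theorem size_sub_le_of_mem_residueComp {r : ℤ} {lam : Alcove n k} {b : Fin k → ℕ}
    (h : b ∈ residueComp r lam.res) : lam.size - lam.multTop * n ≤ r := by
  rw [mem_residueComp] at h
  rw [← h.1, Alcove.size, Alcove.multTop, Finset.card_filter]
  push_cast
  rw [Finset.sum_mul, ← Finset.sum_sub_distrib]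
  refine Finset.sum_le_sum fun i _ => ?_
  have h2 := lam.2.2 i
  split_ifs with h1
  · rw [h1]
    simp
  · rw [zero_mul, sub_zero]
    exact le_of_natCast_eq_intCast (lt_of_le_of_ne h2.2 h1) (h.2 i)

/-- Here $b_i\equiv\lambda_i-\mu_{\sigma(i)}<n$, so each $b_i$ is at least this difference. It is
used to obtain $d_1\ge0$ in part 2. -/
theorem size_sub_size_le_of_mem_residueComp [NeZero n] {r : ℤ} {lam mu : Alcove n k}
    {y : Fin k → ZMod n} (hy : Alcove.ofRes (lam.res - y) = mu) {b : Fin k → ℕ}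
    (h : b ∈ residueComp r y) : lam.size - mu.size ≤ r := by
  rw [mem_residueComp] at h
  obtain ⟨σ, hσ⟩ := Alcove.ofRes_eq_iff.mp hy
  rw [← h.1, Alcove.size, Alcove.size, ← Equiv.sum_comp σ mu.1, ← Finset.sum_sub_distrib]
  refine Finset.sum_le_sum fun i _ => ?_
  have h1 := lam.2.2 i
  have h2 := mu.2.2 (σ i)
  refine le_of_natCast_eq_intCast (n := n) (by omega) ?_
  rw [h.2 i, Int.cast_sub]
  have h3 := congrFun hσ i
  simp only [Pi.sub_apply, Function.comp, Alcove.res] at h3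
  rw [← h3, sub_sub_cancel]

theorem size_sub_multTop_nonneg (lam : Alcove n k) : 0 ≤ lam.size - lam.multTop * n := by
  rw [Alcove.size, Alcove.multTop, Finset.card_filter]
  push_cast
  rw [Finset.sum_mul, ← Finset.sum_sub_distrib]
  refine Finset.sum_nonneg fun i _ => ?_
  have h2 := lam.2.2 i
  split_ifs with h1
  · rw [h1]; simp
  · omega

theorem residueComp_res_nonempty [NeZero k] (lam : Alcove n k) {d : ℤ} (hd : -lam.multTop ≤ d) :
    (residueComp (lam.size + d * n) lam.res).Nonempty := by
  let j : Fin k := 0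
  -- The minimal composition, with every part $n$ replaced by $0$; the missing $(d+m_n(\lambda))n$
  -- goes into the first part.
  let b : Fin k → ℕ := fun i => (if lam.1 i = n then 0 else (lam.1 i).toNat) +
    if i = j then (d + lam.multTop).toNat * n else 0
  refine ⟨b, mem_residueComp.mpr ⟨?_, fun i => ?_⟩⟩
  · have h1 : ∀ i, (b i : ℤ) = (lam.1 i - (if lam.1 i = n then (1 : ℤ) else 0) * n) +
        if i = j then (d + lam.multTop) * n else 0 := by
      intro i
      simp only [b]
      push_cast
      rw [Int.toNat_of_nonneg (by omega : 0 ≤ d + lam.multTop)]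
      congr 1
      have := lam.2.2 i
      split_ifs with h
      · rw [h]; simp
      · rw [Int.toNat_of_nonneg (by omega)]; simp
    simp_rw [h1]
    rw [Finset.sum_add_distrib, Finset.sum_sub_distrib, ← Finset.sum_mul, Finset.sum_ite_eq',
      if_pos (Finset.mem_univ _), Finset.sum_boole]
    change lam.size - lam.multTop * n + _ = _
    ring
  · simp only [b, Alcove.res]
    have := lam.2.2 i
    have h2 : ((if lam.1 i = n then 0 else (lam.1 i).toNat : ℕ) : ZMod n) = (lam.1 i : ZMod n) := by
      split_ifs with h
      · rw [h]; simp
      · rw [← Int.cast_natCast, Int.toNat_of_nonneg (by omega)]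
    rw [Nat.cast_add, h2]
    split_ifs <;> simp

variable {R : Type*} [CommRing R]

/-- The sum of `f_{b_1} ⋯ f_{b_k}` over the compositions `b` of `r` with residues `x`. -/
noncomputable def residueSum (f : ℕ → R) (r : ℤ) (x : Fin k → ZMod n) : R :=
  ∑ b ∈ residueComp r x, ∏ i, f (b i)

theorem exists_mem_of_residueSum_ne_zero {f : ℕ → R} {r : ℤ} {x : Fin k → ZMod n}
    (h : residueSum f r x ≠ 0) : ∃ b, b ∈ residueComp r x := by
  obtain ⟨b, hb, -⟩ := Finset.exists_ne_zero_of_sum_ne_zero h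
  exact ⟨b, hb⟩

theorem residueSum_comp (f : ℕ → R) (r : ℤ) (x : Fin k → ZMod n) (σ : Equiv.Perm (Fin k)) :
    residueSum f r (x ∘ σ) = residueSum f r x := by
  refine Finset.sum_nbij' (fun b => b ∘ σ.symm) (fun b => b ∘ σ) ?_ ?_ ?_ ?_ ?_
  · intro b hb
    rw [mem_residueComp] at hb ⊢
    refine ⟨?_, fun i => by simpa using hb.2 (σ.symm i)⟩
    rw [← hb.1]
    exact Equiv.sum_comp σ.symm fun i => (b i : ℤ)
  · intro b hb
    rw [mem_residueComp] at hb ⊢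
    refine ⟨?_, fun i => by simpa using hb.2 (σ i)⟩
    rw [← hb.1]
    exact Equiv.sum_comp σ fun i => (b i : ℤ)
  · intro b _; funext i; simp
  · intro b _; funext i; simp
  · intro b _
    exact (Equiv.prod_comp σ.symm fun i => f (b i)).symm

theorem residueSum_eq_res [NeZero n] (f : ℕ → R) (r : ℤ) (x : Fin k → ZMod n) :
    residueSum f r x = residueSum f r (Alcove.ofRes x).res := by
  obtain ⟨σ, hσ⟩ := Alcove.ofRes_spec x
  conv_lhs => rw [hσ]
  exact residueSum_comp f r _ σ

theorem map_residueSum {B : Type*} [CommRing B] [Algebra ℂ R] [Algebra ℂ B] (φ : R →ₐ[ℂ] B)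
    (f : ℕ → R) (r : ℤ) (x : Fin k → ZMod n) :
    φ (residueSum f r x) = residueSum (fun s => φ (f s)) r x := by
  simp [residueSum]

theorem prod_tmul_eq {A ι : Type*} [CommRing A] [Algebra ℂ A] (s : Finset ι) (a b : ι → A) :
    ∏ i ∈ s, a i ⊗ₜ[ℂ] b i = (∏ i ∈ s, a i) ⊗ₜ[ℂ] (∏ i ∈ s, b i) := by
  classical
  induction s using Finset.induction_on with
  | empty => simp [Algebra.TensorProduct.one_def]
  | insert i s hi ih => rw [Finset.prod_insert hi, Finset.prod_insert hi, Finset.prod_insert hi, ih,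
      Algebra.TensorProduct.tmul_mul_tmul]

/-- The coproduct of a residue sum. -/
theorem comul_residueSum [NeZero n] (ε : ℂ) (r : ℤ) (x : Fin k → ZMod n) :
    Coalgebra.comul (R := ℂ) (residueSum (SymFun.newton ε) r x) =
      ∑ t ∈ Finset.Icc 0 r, ∑ y : Fin k → ZMod n,
        residueSum (SymFun.newton ε) (r - t) y ⊗ₜ[ℂ] residueSum (SymFun.newton ε) t (x - y) := by
  classical
  have h1 : ∀ b : Fin k → ℕ, Bialgebra.comulAlgHom ℂ SymFun (∏ i, SymFun.newton ε (b i)) =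
      ∑ c ∈ Fintype.piFinset fun i => antidiagonal (b i),
        (∏ i, SymFun.newton ε (c i).1) ⊗ₜ[ℂ] (∏ i, SymFun.newton ε (c i).2) := by
    intro b
    rw [map_prod]
    simp_rw [SymFun.comul_newton, Finset.prod_univ_sum, prod_tmul_eq]
  change Bialgebra.comulAlgHom ℂ SymFun _ = _
  simp_rw [residueSum, map_sum, h1, TensorProduct.sum_tmul, TensorProduct.tmul_sum]
  simp_rw [Finset.sum_sigma']
  -- A composition split part by part into two is a pair of compositions, sorted by the total $t$ of
  -- the second and the residues $y$ of the first.
  refine Finset.sum_bij'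
    (fun c _ => ⟨∑ i, ((c.2 i).2 : ℤ), fun i => ((c.2 i).1 : ZMod n), fun i => (c.2 i).1,
      fun i => (c.2 i).2⟩)
    (fun c _ => ⟨fun i => c.2.2.1 i + c.2.2.2 i, fun i => (c.2.2.1 i, c.2.2.2 i)⟩) ?_ ?_ ?_ ?_ ?_
  · rintro ⟨b, c⟩ h
    simp only [Finset.mem_sigma, Fintype.mem_piFinset, mem_antidiagonal, mem_residueComp,
      Finset.mem_Icc, Finset.mem_univ, true_and, implies_true, and_true] at h ⊢
    obtain ⟨⟨hr, hx⟩, hc⟩ := h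
    have hsum : r = ∑ i, ((c i).1 : ℤ) + ∑ i, ((c i).2 : ℤ) := by
      rw [← hr, ← Finset.sum_add_distrib]
      exact Finset.sum_congr rfl fun i _ => by rw [← hc i]; push_cast; rfl
    have h1 : (0 : ℤ) ≤ ∑ i, ((c i).1 : ℤ) := Finset.sum_nonneg fun _ _ => Int.natCast_nonneg _
    have h2 : (0 : ℤ) ≤ ∑ i, ((c i).2 : ℤ) := Finset.sum_nonneg fun _ _ => Int.natCast_nonneg _
    refine ⟨⟨h2, by omega⟩, by omega, fun i => ?_⟩
    rw [Pi.sub_apply, ← hx i, ← hc i]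
    push_cast
    ring
  · rintro ⟨t, y, b, c⟩ h
    simp only [Finset.mem_sigma, Fintype.mem_piFinset, mem_antidiagonal, mem_residueComp,
      Finset.mem_Icc, Finset.mem_univ, true_and, implies_true, and_true] at h ⊢
    obtain ⟨-, ⟨hb, hy⟩, hc, hz⟩ := h
    refine ⟨?_, fun i => ?_⟩
    · push_cast
      rw [Finset.sum_add_distrib, hb, hc]
      ring
    · rw [Nat.cast_add, hy, hz, Pi.sub_apply, add_sub_cancel]
  · rintro ⟨b, c⟩ h
    simp only [Finset.mem_sigma, Fintype.mem_piFinset, mem_antidiagonal] at h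
    have : b = fun i => (c i).1 + (c i).2 := funext fun i => (h.2 i).symm
    subst this
    rfl
  · rintro ⟨t, y, b, c⟩ h
    simp only [Finset.mem_sigma, mem_residueComp] at h
    obtain ⟨-, -, ⟨-, hy⟩, hc, -⟩ := h
    have h1 : y = fun i => (b i : ZMod n) := funext fun i => (hy i).symm
    subst h1 hc
    rfl
  · rintro ⟨b, c⟩ h
    rfl

end ResidueSum

/-! ## The family of cylindric functions as residue sums -/

section CylSum

variable {n k : ℕ} [NeZero n]

section

variable {R : Type*} [CommRing R]

open Classical in
/-- The expansion of a cylindric function `f_{λ/d/μ}` into products `f_{b_1} ⋯ f_{b_k}`. -/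
noncomputable def cylSum (f : ℕ → R) (lam : Alcove n k) (d : ℤ) (mu : Alcove n k) : R :=
  ∑ y : Fin k → ZMod n with Alcove.ofRes (lam.res - y) = mu,
    residueSum f (lam.size + d * n - mu.size) y

/-- Only $y=\lambda$ survives, since $n^k$ has residue zero, and the shift of $d$ by $k$ cancels
$|n^k|=kn$. -/
theorem nonSkew_cylSum [NeZero k] (f : ℕ → R) (lam : Alcove n k) (d : ℤ) :
    nonSkew (cylSum f) lam d = residueSum f (lam.size + d * n) lam.res := by
  classical
  rw [nonSkew, cylSum, Finset.sum_eq_single lam.res]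
  · rw [Alcove.size_top]
    congr 1
    ring
  · intro y hy hne
    rw [Finset.mem_filter, Alcove.ofRes_eq_top_iff, sub_eq_zero] at hy
    exact absurd hy.2.symm hne
  · intro h
    rw [Finset.mem_filter, Alcove.ofRes_eq_top_iff, sub_self] at h
    exact absurd ⟨Finset.mem_univ _, rfl⟩ h

/-- A residue sum of non-zero value belongs to a member of the non-skew family. -/
theorem exists_degree_of_residueSum_ne_zero {f : ℕ → R} {r : ℤ} {nu : Alcove n k}
    (h : residueSum f r nu.res ≠ 0) : ∃ d, -nu.multTop ≤ d ∧ r = nu.size + d * n := by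
  obtain ⟨b, hb⟩ := exists_mem_of_residueSum_ne_zero h
  -- The residues force $r\equiv|\nu|$ mod $n$, which produces $d$; the least possible total bounds
  -- it below.
  have h1 := intCast_eq_sum_of_mem_residueComp hb
  rw [Alcove.sum_res] at h1
  obtain ⟨d, hd⟩ := (ZMod.intCast_eq_intCast_iff_dvd_sub _ _ _).mp h1.symm
  have h2 := size_sub_le_of_mem_residueComp hb
  have hn : (0 : ℤ) < n := by exact_mod_cast Nat.pos_of_ne_zero (NeZero.ne n)
  refine ⟨d, ?_, by rw [mul_comm]; omega⟩
  refine le_of_mul_le_mul_right ?_ hn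
  rw [mul_comm d, ← hd]
  linarith

end

/-! ### Linear independence -/

/-- The multiset of the non-zero parts of a composition. -/
noncomputable def partCount (b : Fin k → ℕ) : ℕ →₀ ℕ :=
  ∑ i, if b i = 0 then 0 else Finsupp.single (b i) 1

/-- The number of zero parts, which `partCount` ignores, is recovered from the fixed total number
$k$ of parts. -/
theorem exists_perm_of_partCount_eq {b c : Fin k → ℕ} (h : partCount b = partCount c) :
    ∃ σ : Equiv.Perm (Fin k), b = c ∘ σ := by
  have h1 : ∀ (b : Fin k → ℕ) (a : ℕ), a ≠ 0 →
      partCount b a = (Finset.univ.filter fun i => b i = a).card := by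
    intro b a ha
    rw [partCount, Finsupp.finsetSum_apply, Finset.card_filter]
    refine Finset.sum_congr rfl fun i _ => ?_
    by_cases hb : b i = 0
    · rw [if_pos hb, if_neg (by omega)]
      rfl
    · rw [if_neg hb, Finsupp.single_apply]
  have h2 : ∀ b : Fin k → ℕ,
      (partCount b).degree + (Finset.univ.filter fun i => b i = 0).card = k := by
    intro b
    rw [partCount, map_sum, Finset.card_filter, ← Finset.sum_add_distrib]
    refine (Finset.sum_congr rfl fun i _ => ?_).trans (Finset.card_fin k ▸ Finset.card_eq_sum_ones
      (Finset.univ : Finset (Fin k))).symm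
    split_ifs <;> simp
  have h3 : ∀ a, (Finset.univ.filter fun i => b i = a).card =
      (Finset.univ.filter fun i => c i = a).card := by
    intro a
    rcases eq_or_ne a 0 with rfl | ha
    · have hb := h2 b
      have hc := h2 c
      rw [h] at hb
      omega
    · rw [← h1 b a ha, ← h1 c a ha, h]
  have e : ∀ a, Nonempty ({i // b i = a} ≃ {i // c i = a}) := fun a =>
    Fintype.card_eq.mp (by rw [Fintype.card_subtype, Fintype.card_subtype, h3])
  exact ⟨Equiv.ofFiberEquiv fun a => (e a).some,
    funext fun i => (Equiv.ofFiberEquiv_map _ i).symm⟩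

/-- Sending $f_r$ to a variable $X_r$ turns each function into a non-empty sum of monomials with
positive coefficients. A monomial determines the composition up to order, hence $\lambda$ by
residues and $d$ by the total, so different indices share no monomial. -/
theorem linearIndependent_nonSkew [NeZero k] {ε : ℂ} (hε : ε ≠ 0) :
    LinearIndependent ℂ fun x : NonSkewIndex n k =>
      residueSum (SymFun.newton ε) (x.1.1.size + x.1.2 * n) x.1.1.res := by
  classical
  obtain ⟨φ, hφ⟩ := SymFun.exists_algHom_newton hε
    (fun r => if r = 0 then (1 : MvPolynomial ℕ ℂ) else MvPolynomial.X r) (if_pos rfl)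
  -- For each index, one composition whose monomial detects that index alone.
  choose w hw using fun x : NonSkewIndex n k => residueComp_res_nonempty x.1.1 x.2
  have himg : ∀ x : NonSkewIndex n k,
      φ (residueSum (SymFun.newton ε) (x.1.1.size + x.1.2 * n) x.1.1.res) =
      ∑ b ∈ residueComp (x.1.1.size + x.1.2 * n) x.1.1.res,
        MvPolynomial.monomial (partCount b) 1 := by
    intro x
    rw [map_residueSum, residueSum]
    refine Finset.sum_congr rfl fun b _ => ?_
    rw [partCount, MvPolynomial.monomial_sum_one]
    refine Finset.prod_congr rfl fun i _ => ?_
    rw [hφ]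
    split_ifs
    · rfl
    · rfl
  have hcoeff : ∀ x y : NonSkewIndex n k, MvPolynomial.coeff (partCount (w x))
      (φ (residueSum (SymFun.newton ε) (y.1.1.size + y.1.2 * n) y.1.1.res)) =
      (((residueComp (y.1.1.size + y.1.2 * n) y.1.1.res).filter
        fun b => partCount b = partCount (w x)).card : ℂ) := by
    intro x y
    rw [himg, MvPolynomial.coeff_sum]
    simp only [MvPolynomial.coeff_monomial]
    rw [Finset.sum_boole]
  have hoff : ∀ x y : NonSkewIndex n k, y ≠ x → MvPolynomial.coeff (partCount (w x))
      (φ (residueSum (SymFun.newton ε) (y.1.1.size + y.1.2 * n) y.1.1.res)) = 0 := by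
    intro x y hne
    rw [hcoeff, Nat.cast_eq_zero, Finset.card_eq_zero, Finset.filter_eq_empty_iff]
    intro b hb heq
    apply hne
    obtain ⟨σ, rfl⟩ := exists_perm_of_partCount_eq heq
    have hx := mem_residueComp.mp (hw x)
    rw [mem_residueComp] at hb
    have h1 : y.1.1 = x.1.1 := by
      rw [← Alcove.ofRes_res y.1.1, ← Alcove.ofRes_res x.1.1, Alcove.ofRes_eq_ofRes_iff]
      exact ⟨σ, funext fun i => (hb.2 i).symm.trans (hx.2 (σ i))⟩
    have h2 : y.1.1.size + y.1.2 * n = x.1.1.size + x.1.2 * n := by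
      rw [← hb.1, ← hx.1]
      exact Equiv.sum_comp σ fun i => (w x i : ℤ)
    rw [h1] at h2
    have h3 : y.1.2 * (n : ℤ) = x.1.2 * n := by omega
    exact Subtype.ext (Prod.ext h1 (mul_right_cancel₀ (by exact_mod_cast NeZero.ne n) h3))
  have hdiag : ∀ x : NonSkewIndex n k, MvPolynomial.coeff (partCount (w x))
      (φ (residueSum (SymFun.newton ε) (x.1.1.size + x.1.2 * n) x.1.1.res)) ≠ 0 := by
    intro x
    rw [hcoeff, Nat.cast_ne_zero]
    refine (Finset.card_pos.mpr ?_).ne'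
    exact ⟨w x, Finset.mem_filter.mpr ⟨hw x, rfl⟩⟩
  rw [linearIndependent_iff']
  intro s g hg x hx
  have h := congrArg (fun v => MvPolynomial.coeff (partCount (w x)) (φ v)) hg
  simp only [map_sum, map_smul, map_zero, MvPolynomial.coeff_sum, MvPolynomial.coeff_smul,
    MvPolynomial.coeff_zero, smul_eq_mul] at h
  rw [Finset.sum_eq_single x (fun y _ hy => by rw [hoff x y hy, mul_zero])
    (fun h => absurd hx h)] at h
  exact (mul_eq_zero.mp h).resolve_right (hdiag x)

/-! ### The coproduct and the expansion of skew functions -/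

variable (ε : ℂ)

-- The $y$ are grouped by the orbits of $y$ and of $\lambda-y$; the fibre sizes are the fusion
-- coefficients.
open Classical in
theorem sum_fiberwise_fusion {M : Type*} [AddCommMonoid M] (lam : Alcove n k)
    (g : Alcove n k → Alcove n k → M) :
    ∑ y : Fin k → ZMod n, g (Alcove.ofRes y) (Alcove.ofRes (lam.res - y)) =
      ∑ mu : Alcove n k, ∑ nu : Alcove n k, fusionCoeff mu nu lam • g mu nu := by
  rw [← Finset.sum_fiberwise _ (fun y => Alcove.ofRes y)]
  refine Finset.sum_congr rfl fun mu _ => ?_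
  rw [← Finset.sum_fiberwise _ (fun y => Alcove.ofRes (lam.res - y))]
  refine Finset.sum_congr rfl fun nu _ => ?_
  rw [Finset.filter_filter, fusionCoeff_eq_card, ← Finset.sum_const]
  refine Finset.sum_congr rfl fun y hy => ?_
  rw [Finset.mem_filter] at hy
  rw [hy.2.1, hy.2.2]

theorem comul_residueSum_eq_fusion (lam : Alcove n k) (r : ℤ) :
    Coalgebra.comul (R := ℂ) (residueSum (SymFun.newton ε) r lam.res) =
      ∑ mu : Alcove n k, ∑ nu : Alcove n k, ∑ t ∈ Finset.Icc 0 r, fusionCoeff mu nu lam •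
        (residueSum (SymFun.newton ε) (r - t) mu.res ⊗ₜ[ℂ]
          residueSum (SymFun.newton ε) t nu.res) := by
  rw [comul_residueSum, Finset.sum_comm]
  simp_rw [← Finset.smul_sum]
  rw [← sum_fiberwise_fusion lam fun mu nu => ∑ t ∈ Finset.Icc 0 r,
    residueSum (SymFun.newton ε) (r - t) mu.res ⊗ₜ[ℂ] residueSum (SymFun.newton ε) t nu.res]
  refine Finset.sum_congr rfl fun y _ => Finset.sum_congr rfl fun t _ => ?_
  rw [← residueSum_eq_res, ← residueSum_eq_res]

theorem finite_cylStructureConst [NeZero k] (x : NonSkewIndex n k) :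
    {q : NonSkewIndex n k × NonSkewIndex n k | cylStructureConst x q.1 q.2 ≠ 0}.Finite := by
  -- Degrees are non-negative, so both factors have degree at most that of $x$; moreover
  -- $d\ge-m_n\ge-k$.
  let D : Set (NonSkewIndex n k) :=
    Subtype.val ⁻¹' ((Set.univ : Set (Alcove n k)) ×ˢ
      Set.Icc (-(k : ℤ)) (x.1.1.size + x.1.2 * n))
  have hD : D.Finite :=
    (Set.finite_univ.prod (Set.finite_Icc _ _)).preimage Subtype.val_injective.injOn
  have hn : (1 : ℤ) ≤ n := by exact_mod_cast Nat.pos_of_ne_zero (NeZero.ne n)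
  have hdeg : ∀ y : NonSkewIndex n k, 0 ≤ y.1.1.size + y.1.2 * n := by
    intro y
    nlinarith [size_sub_multTop_nonneg y.1.1, y.2,
      mul_le_mul_of_nonneg_right y.2 (by omega : (0 : ℤ) ≤ n)]
  have hmem : ∀ y : NonSkewIndex n k,
      y.1.1.size + y.1.2 * n ≤ x.1.1.size + x.1.2 * n → y ∈ D := by
    intro y hy
    refine ⟨trivial, ?_, ?_⟩
    · refine le_trans ?_ y.2
      have : (Finset.univ.filter fun i => y.1.1.1 i = (n : ℤ)).card ≤ k := by
        simpa using Finset.card_filter_le (Finset.univ : Finset (Fin k)) _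
      rw [Alcove.multTop]
      omega
    · rcases le_or_gt y.1.2 0 with h0 | h0
      · exact h0.trans (hdeg x)
      · have h1 : 0 ≤ y.1.1.size := Finset.sum_nonneg fun i _ => by have := y.1.1.2.2 i; omega
        nlinarith [mul_le_mul_of_nonneg_left hn h0.le]
  refine (hD.prod hD).subset fun q hq => ?_
  have h : x.1.1.size + x.1.2 * n = (q.1.1.1.size + q.1.1.2 * n) + (q.2.1.1.size + q.2.1.2 * n) := by
    by_contra h
    exact hq (by rw [cylStructureConst, if_neg h])
  have h1 := hdeg q.1
  have h2 := hdeg q.2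
  exact ⟨hmem _ (by omega), hmem _ (by omega)⟩

theorem comul_nonSkew_eq_sum_cylStructureConst [NeZero k] (x : NonSkewIndex n k) :
    Coalgebra.comul (R := ℂ)
      (residueSum (SymFun.newton ε) (x.1.1.size + x.1.2 * n) x.1.1.res) =
    ∑ q ∈ (finite_cylStructureConst x).toFinset, cylStructureConst x q.1 q.2 •
      (residueSum (SymFun.newton ε) (q.1.1.1.size + q.1.1.2 * n) q.1.1.1.res ⊗ₜ[ℂ]
        residueSum (SymFun.newton ε) (q.2.1.1.size + q.2.1.2 * n) q.2.1.1.res) := by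
  have hn : (n : ℤ) ≠ 0 := by exact_mod_cast NeZero.ne n
  have hdeg : ∀ y : NonSkewIndex n k, 0 ≤ y.1.1.size + y.1.2 * n := by
    intro y
    obtain ⟨b, hb⟩ := residueComp_res_nonempty y.1.1 y.2
    exact nonneg_of_mem_residueComp hb
  have hq : ∀ q : NonSkewIndex n k × NonSkewIndex n k,
      q ∈ (finite_cylStructureConst x).toFinset →
      x.1.1.size + x.1.2 * n =
        (q.1.1.1.size + q.1.1.2 * n) + (q.2.1.1.size + q.2.1.2 * n) := by
    intro q hq
    rw [Set.Finite.mem_toFinset] at hq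
    by_contra h
    exact hq (by rw [cylStructureConst, if_neg h])
  rw [comul_residueSum_eq_fusion]
  simp_rw [← Finset.sum_product']
  symm
  -- The summation index $t$ is the degree of the second factor. A $t$ that is not the degree of an
  -- index contributes a zero residue sum.
  refine Finset.sum_bij_ne_zero
    (fun q _ _ => (q.1.1.1, q.2.1.1, q.2.1.1.size + q.2.1.2 * n)) ?_ ?_ ?_ ?_
  · intro q h _
    have h1 := hq q h
    have h2 := hdeg q.1
    have h3 := hdeg q.2
    simp only [Finset.mem_product, Finset.mem_univ, Finset.mem_Icc, true_and]
    omega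
  · rintro ⟨⟨⟨mu, d⟩, hd⟩, ⟨⟨nu, d'⟩, hd'⟩⟩ h _ ⟨⟨⟨mu', e⟩, he⟩, ⟨⟨nu', e'⟩, he'⟩⟩ h' _ heq
    have h1 := hq _ h
    have h2 := hq _ h'
    simp only [Prod.mk.injEq] at heq h1 h2
    obtain ⟨rfl, rfl, h3⟩ := heq
    have h4 : d' = e' := mul_right_cancel₀ hn (by omega)
    subst h4
    have h5 : d = e := mul_right_cancel₀ hn (by omega)
    subst h5
    rfl
  · rintro ⟨mu, nu, t⟩ ht hne
    have hN : fusionCoeff mu nu x.1.1 ≠ 0 := fun h => hne (by rw [h, zero_smul])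
    have h1 : residueSum (SymFun.newton ε) (x.1.1.size + x.1.2 * n - t) mu.res ≠ 0 :=
      fun h => hne (by rw [h, TensorProduct.zero_tmul, smul_zero])
    have h2 : residueSum (SymFun.newton ε) t nu.res ≠ 0 :=
      fun h => hne (by rw [h, TensorProduct.tmul_zero, smul_zero])
    obtain ⟨d₁, hd₁, h1⟩ := exists_degree_of_residueSum_ne_zero h1
    obtain ⟨d₂, hd₂, rfl⟩ := exists_degree_of_residueSum_ne_zero h2
    have hc : cylStructureConst x ⟨(mu, d₁), hd₁⟩ ⟨(nu, d₂), hd₂⟩ = fusionCoeff mu nu x.1.1 := by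
      rw [cylStructureConst, if_pos (by simp only; omega)]
    refine ⟨(⟨(mu, d₁), hd₁⟩, ⟨(nu, d₂), hd₂⟩), ?_, ?_, rfl⟩
    · rw [Set.Finite.mem_toFinset]
      exact hc.trans_ne hN
    · rw [hc, ← h1]
      exact hne
  · intro q h _
    have h1 := hq q h
    rw [cylStructureConst, if_pos h1]
    congr 3
    simp only
    omega

theorem isPositiveSubcoalgebra_cylSum [NeZero k] {ε : ℂ} (hε : ε ≠ 0) :
    IsPositiveSubcoalgebra
      (fun x : NonSkewIndex n k => nonSkew (cylSum (SymFun.newton ε)) x.1.1 x.1.2)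
      cylStructureConst := by
  simp_rw [nonSkew_cylSum]
  refine ⟨linearIndependent_nonSkew hε, fun a ha => ?_, fun x =>
    ⟨(finite_cylStructureConst x).toFinset, fun y z => ?_,
      comul_nonSkew_eq_sum_cylStructureConst ε x⟩⟩
  · induction ha using Submodule.span_induction with
    | mem a ha =>
      obtain ⟨x, rfl⟩ := ha
      simp only
      rw [comul_nonSkew_eq_sum_cylStructureConst]
      refine Submodule.sum_mem _ fun q _ => ?_
      refine Submodule.smul_of_tower_mem _ _ ⟨⟨_, Submodule.subset_span ⟨q.1, rfl⟩⟩ ⊗ₜ[ℂ]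
        ⟨_, Submodule.subset_span ⟨q.2, rfl⟩⟩, ?_⟩
      rw [TensorProduct.map_tmul]
      rfl
    | zero => rw [map_zero]; exact Submodule.zero_mem _
    | add a b _ _ ha hb => rw [map_add]; exact Submodule.add_mem _ ha hb
    | smul c a _ ha => rw [map_smul]; exact Submodule.smul_mem _ c ha
  · rw [Set.Finite.mem_toFinset]
    rfl

/-- Grouping only by the orbit $\mu$ of $\lambda-y$ makes the second factor a non-skew function,
while the remaining sum over $y$ assembles the skew function on the left. -/
theorem comul_nonSkew_cylSum [NeZero k] (lam : Alcove n k) (d : ℤ) :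
    Coalgebra.comul (R := ℂ) (nonSkew (cylSum (SymFun.newton ε)) lam d) =
      ∑ mu : Alcove n k, ∑ d₂ ∈ Finset.Icc (-mu.multTop) d,
        cylSum (SymFun.newton ε) lam (d - d₂) mu ⊗ₜ[ℂ]
          nonSkew (cylSum (SymFun.newton ε)) mu d₂ := by
  classical
  have hn : (0 : ℤ) < n := by exact_mod_cast Nat.pos_of_ne_zero (NeZero.ne n)
  simp_rw [nonSkew_cylSum, cylSum, TensorProduct.sum_tmul]
  rw [comul_residueSum, Finset.sum_comm, ← Finset.sum_fiberwise _
    (fun y => Alcove.ofRes (lam.res - y))]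
  refine Finset.sum_congr rfl fun mu _ => ?_
  rw [Finset.sum_comm (s := Finset.Icc _ _)]
  refine Finset.sum_congr rfl fun y hy => ?_
  rw [Finset.mem_filter] at hy
  symm
  refine Finset.sum_bij_ne_zero (fun d₂ _ _ => mu.size + d₂ * n) ?_ ?_ ?_ ?_
  · intro d₂ _ hne
    have hl : residueSum (SymFun.newton ε) (lam.size + (d - d₂) * n - mu.size) y ≠ 0 :=
      fun h => hne (by rw [h, TensorProduct.zero_tmul])
    have hr : residueSum (SymFun.newton ε) (mu.size + d₂ * n) mu.res ≠ 0 :=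
      fun h => hne (by rw [h, TensorProduct.tmul_zero])
    obtain ⟨b, hb⟩ := exists_mem_of_residueSum_ne_zero hl
    obtain ⟨c, hc⟩ := exists_mem_of_residueSum_ne_zero hr
    have h1 := nonneg_of_mem_residueComp hb
    have h2 := nonneg_of_mem_residueComp hc
    rw [sub_mul] at h1
    rw [Finset.mem_Icc]
    omega
  · intro a _ _ b _ _ h
    exact mul_right_cancel₀ hn.ne' (by omega)
  · intro t _ hne
    have h1 : residueSum (SymFun.newton ε) t (lam.res - y) ≠ 0 :=
      fun h => hne (by rw [h, TensorProduct.tmul_zero])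
    rw [residueSum_eq_res, hy.2] at h1
    obtain ⟨d₂, hd₂, rfl⟩ := exists_degree_of_residueSum_ne_zero h1
    obtain ⟨b, hb⟩ := exists_mem_of_residueSum_ne_zero
      fun h => hne (by rw [h, TensorProduct.zero_tmul])
    -- A non-zero left factor has degree at least $|\lambda|-|\mu|$, that is, $d_2\le d$.
    have h2 := size_sub_size_le_of_mem_residueComp hy.2 hb
    refine ⟨d₂, Finset.mem_Icc.mpr ⟨hd₂, ?_⟩, ?_, rfl⟩
    · exact le_of_mul_le_mul_right (by omega) hn
    · rw [residueSum_eq_res _ _ (lam.res - y), hy.2] at hne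
      rwa [show lam.size + (d - d₂) * n - mu.size = lam.size + d * n - (mu.size + d₂ * n) by ring]
  · intro d₂ _ _
    rw [residueSum_eq_res _ _ (lam.res - y), hy.2]
    congr 2
    ring

theorem cylSum_eq_sum_fusionCoeff [NeZero k] (lam mu : Alcove n k) (d₁ : ℤ) :
    cylSum (SymFun.newton ε) lam d₁ mu =
      ∑ nu : Alcove n k, ∑ᶠ (d₁' : ℤ) (_ : nu.size = lam.size + d₁' * n - mu.size),
        fusionCoeff mu nu lam • nonSkew (cylSum (SymFun.newton ε)) nu (d₁ - d₁') := by
  classical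
  have hn : (n : ℤ) ≠ 0 := by exact_mod_cast NeZero.ne n
  set r := lam.size + d₁ * n - mu.size with hr
  have h1 : cylSum (SymFun.newton ε) lam d₁ mu = ∑ nu : Alcove n k,
      fusionCoeff mu nu lam • residueSum (SymFun.newton ε) r nu.res := by
    have h2 := sum_fiberwise_fusion lam fun mu' nu =>
      if mu' = mu then residueSum (SymFun.newton ε) r nu.res else 0
    rw [Finset.sum_eq_single mu (fun mu' _ hne => by simp [hne]) (by simp)] at h2
    simp only [if_true] at h2
    -- The substitution $y\mapsto\lambda-y$ moves the condition on $\mu$ from $\lambda-y$ to $y$,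
    -- the first slot of the fusion coefficient.
    rw [← h2, cylSum, Finset.sum_filter, ← (Equiv.subLeft lam.res).sum_comp]
    refine Finset.sum_congr rfl fun y _ => ?_
    simp only [Equiv.subLeft_apply, sub_sub_cancel, ← residueSum_eq_res, ← hr]
  rw [h1]
  refine Finset.sum_congr rfl fun nu _ => ?_
  simp_rw [nonSkew_cylSum]
  by_cases h : ∃ d₁' : ℤ, nu.size = lam.size + d₁' * n - mu.size
  · obtain ⟨d₁', hd⟩ := h
    rw [finsum_eq_single _ d₁', finsum_eq_if, if_pos hd]
    · congr 2
      rw [hd, hr]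
      ring
    · intro e he
      rw [finsum_eq_if, if_neg]
      intro h
      exact he (mul_right_cancel₀ hn (by omega))
  -- Without a solution $d_1'$ the degree is incongruent to $|\nu|$ and the residue sum is empty.
  · push Not at h
    have h0 : residueSum (SymFun.newton ε) r nu.res = 0 := by
      by_contra hne
      obtain ⟨d, -, hd⟩ := exists_degree_of_residueSum_ne_zero hne
      refine h (d₁ - d) ?_
      rw [sub_mul]
      omega
    rw [h0, smul_zero]
    symm
    refine finsum_eq_zero_of_forall_eq_zero fun e => ?_
    rw [finsum_eq_if, if_neg (h e)]

end CylSum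

/-! ## Quasi-periodic maps and the level-`n` orbits of the affine symmetric group -/

section Loops

variable {n k : ℕ}

/-- Maps `f : ℤ → ℤ` with `f (i + k) = f i - c`. -/
def QuasiPeriodic (k : ℕ) (c : ℤ) (f : ℤ → ℤ) : Prop := ∀ i, f (i + k) = f i - c

theorem QuasiPeriodic.add_mul {c : ℤ} {f : ℤ → ℤ} (h : QuasiPeriodic k c f) (i j : ℤ) :
    f (i + k * j) = f i - c * j := by
  induction j using Int.induction_on with
  | zero => simp
  | succ j ih =>
    rw [mul_add, mul_one, ← add_assoc, h, ih]
    ring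
  | pred j ih =>
    have := h (i + k * (-(j : ℤ) - 1))
    rw [show i + k * (-(j : ℤ) - 1) + k = i + k * -(j : ℤ) by ring, ih] at this
    linarith

/-- Moving the window by one place replaces a value by the value $k$ places later, a loss of $c$. -/
theorem QuasiPeriodic.sum_window {c : ℤ} {f : ℤ → ℤ} (h : QuasiPeriodic k c f) (a : ℤ) :
    ∑ j : Fin k, f (j + a) = ∑ j : Fin k, f j - c * a := by
  have step : ∀ a, ∑ j : Fin k, f (j + (a + 1)) = ∑ j : Fin k, f (j + a) - c := by
    intro a
    have h1 := Finset.sum_range_succ (fun j : ℕ => f (j + a)) k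
    rw [Finset.sum_range_succ', add_comm (k : ℤ), h, Finset.sum_range, Finset.sum_range] at h1
    simp only [Nat.cast_add, Nat.cast_one, Nat.cast_zero, zero_add] at h1
    have h2 : ∀ j : Fin k, f (j + (a + 1)) = f (j + 1 + a) := fun j => by congr 1; ring
    simp_rw [h2]
    linarith
  induction a using Int.induction_on with
  | zero => simp
  | succ a ih => rw [step, ih]; ring
  | pred a ih =>
    have := step (-(a : ℤ) - 1)
    rw [sub_add_cancel, ih] at this
    linarith

theorem exists_window [NeZero k] (m : ℤ) : ∃ (i : Fin k) (j : ℤ), m = i + 1 + k * j := by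
  have hk : (0 : ℤ) < k := by exact_mod_cast Nat.pos_of_ne_zero (NeZero.ne k)
  have h0 := Int.emod_nonneg (m - 1) hk.ne'
  have h1 := Int.emod_lt_of_pos (m - 1) hk
  refine ⟨⟨((m - 1) % k).toNat, by omega⟩, (m - 1) / k, ?_⟩
  have := Int.mul_ediv_add_emod (m - 1) k
  simp only [Int.toNat_of_nonneg h0]
  linarith

theorem QuasiPeriodic.eq_of_window [NeZero k] {c : ℤ} {f g : ℤ → ℤ} (hf : QuasiPeriodic k c f)
    (hg : QuasiPeriodic k c g) (h : ∀ i : Fin k, f (i + 1) = g (i + 1)) : f = g := by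
  funext m
  obtain ⟨i, j, rfl⟩ := exists_window (k := k) m
  rw [hf.add_mul, hg.add_mul, h]

theorem sum_Icc_eq_sum_fin {M : Type*} [AddCommMonoid M] (f : ℤ → M) :
    ∑ m ∈ Finset.Icc (1 : ℤ) k, f m = ∑ i : Fin k, f (i + 1) := by
  symm
  refine Finset.sum_nbij (fun i : Fin k => (i : ℤ) + 1) ?_ ?_ ?_ ?_
  · intro i _
    have := i.2
    simp only [Finset.mem_Icc]
    omega
  · intro i _ j _ h
    have : (i : ℤ) + 1 = j + 1 := h
    exact Fin.ext (by omega)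
  · intro m hm
    simp only [Finset.coe_Icc, Set.mem_Icc] at hm
    refine ⟨⟨(m - 1).toNat, by omega⟩, by simp, ?_⟩
    simp only
    omega
  · intro i _
    rfl

/-- The residues of the values on a window are permuted by a map commuting with the shift. -/
theorem exists_perm_window [NeZero k] {w : ℤ → ℤ} (hw : Function.Injective w)
    (hk : ∀ m, w (m + k) = w m + k) :
    ∃ (σ : Equiv.Perm (Fin k)) (q : Fin k → ℤ), ∀ i : Fin k, w (i + 1) = σ i + 1 + k * q i := by
  choose s q h using fun i : Fin k => exists_window (k := k) (w (i + 1))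
  have hqp : QuasiPeriodic k (-(k : ℤ)) w := fun m => by rw [hk]; ring
  have hinj : Function.Injective s := by
    intro i j hij
    -- Equal residues would make $w$ take one value at two points, by equivariance under the shift
    -- by $k$.
    have h1 : w (i + 1 + k * (q j - q i)) = w (j + 1) := by
      rw [hqp.add_mul, h, h, hij]
      ring
    have h2 := hw h1
    have h3 : (i : ℤ) - j = k * (q i - q j) := by linarith
    have hi := i.2
    have hj := j.2
    have h4 : q i - q j < 1 := by
      by_contra! h5
      nlinarith
    have h5 : -1 < q i - q j := by
      by_contra! h5
      nlinarith
    have h6 : q i - q j = 0 := by omega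
    rw [h6] at h3
    exact Fin.ext (by omega)
  exact ⟨Equiv.ofBijective s (Finite.injective_iff_bijective.mp hinj), q, h⟩

namespace Alcove

variable [NeZero k] (lam : Alcove n k)

theorem ext_quasiPeriodic : QuasiPeriodic k n lam.ext := by
  intro i
  have hk : (k : ℤ) ≠ 0 := by exact_mod_cast NeZero.ne k
  rw [ext, ext, show i + k - 1 = i - 1 + k by ring, Int.add_emod_right,
    Int.add_ediv_of_dvd_right (dvd_refl _), Int.ediv_self hk]
  ring

theorem ext_window (i : Fin k) : lam.ext (i + 1) = lam.1 i := by
  have hi := i.2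
  rw [ext, add_sub_cancel_right, Int.emod_eq_of_lt (by omega) (by omega),
    Int.ediv_eq_zero_of_lt (by omega) (by omega), mul_zero, sub_zero]
  refine congrArg lam.1 (Fin.ext ?_)
  change (i : ℤ).toNat % k = i
  rw [Int.toNat_natCast, Nat.mod_eq_of_lt hi]

theorem sum_ext_window (d : ℤ) : ∑ i : Fin k, lam.ext (i + 1 - d) = lam.size + d * n := by
  have h1 := lam.ext_quasiPeriodic.sum_window (1 - d)
  have h2 := lam.ext_quasiPeriodic.sum_window 1
  simp_rw [ext_window] at h2
  simp_rw [add_sub_assoc, h1]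
  rw [size, h2]
  ring

theorem ext_antitone : Antitone lam.ext := by
  have hk : (k : ℤ) ≠ 0 := by exact_mod_cast NeZero.ne k
  refine antitone_int_of_succ_le fun m => ?_
  obtain ⟨i, j, rfl⟩ := exists_window (k := k) m
  rw [lam.ext_quasiPeriodic.add_mul, ext_window]
  by_cases hi : (i : ℕ) + 1 < k
  · have h := lam.ext_window ⟨i + 1, hi⟩
    simp only [Nat.cast_add, Nat.cast_one] at h
    rw [show (i : ℤ) + 1 + k * j + 1 = (i + 1 + 1) + k * j by ring, lam.ext_quasiPeriodic.add_mul, h]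
    have : lam.1 ⟨i + 1, hi⟩ ≤ lam.1 i := lam.2.1 (Fin.le_def.mpr (Nat.le_succ _))
    omega
  -- At the seam between windows, $\lambda_{k+1}=\lambda_1-n\le0<\lambda_k$.
  · have hi' : (i : ℕ) + 1 = k := by have := i.2; omega
    have hi'' : (i : ℤ) + 1 = k := by exact_mod_cast hi'
    have h := lam.ext_window 0
    simp only [Fin.val_zero, Nat.cast_zero] at h
    rw [show (i : ℤ) + 1 + k * j + 1 = (0 + 1) + k * (j + 1) by rw [hi'']; ring,
      lam.ext_quasiPeriodic.add_mul, h]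
    have h1 := lam.2.2 0
    have h2 := lam.2.2 i
    rw [mul_add]
    omega

theorem exists_perm_ext_window (d : ℤ) :
    ∃ σ : Equiv.Perm (Fin k), ∀ i : Fin k, (lam.ext (i + 1 - d) : ZMod n) = lam.res (σ i) := by
  obtain ⟨σ, q, h⟩ := exists_perm_window (k := k) (w := fun m => m - d)
    (sub_left_injective) (fun m => by ring)
  refine ⟨σ, fun i => ?_⟩
  rw [h, lam.ext_quasiPeriodic.add_mul, ext_window]
  simp [res]

end Alcove

section Charge

variable [NeZero n]

/-- The charge of the set where `f ≥ c`, up to a constant. -/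
def charge (n k : ℕ) (c : ℤ) (f : ℤ → ℤ) : ℤ := ∑ i : Fin k, (f (i + 1) - c) / n

theorem charge_mono (c : ℤ) {f g : ℤ → ℤ} (h : ∀ i, f i ≤ g i) :
    charge n k c f ≤ charge n k c g :=
  Finset.sum_le_sum fun i _ => Int.ediv_le_ediv
    (by exact_mod_cast Nat.pos_of_ne_zero (NeZero.ne n)) (by have := h (i + 1); omega)

/-- For antitone $f$ the set $\{f\ge c\}$ is a ray, and the charge locates its end. Comparing
charges for all $c$ therefore compares the functions. -/
theorem le_of_charge_le {f g : ℤ → ℤ} (hf : QuasiPeriodic k n f) (hg : QuasiPeriodic k n g)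
    (hfa : Antitone f) (hga : Antitone g) (h : ∀ c, charge n k c f ≤ charge n k c g) (i : ℤ) :
    f i ≤ g i := by
  have hn : (0 : ℤ) < n := by exact_mod_cast Nat.pos_of_ne_zero (NeZero.ne n)
  by_contra! hlt
  set c := f i
  have hqp : ∀ f : ℤ → ℤ, QuasiPeriodic k n f →
      QuasiPeriodic k 1 (fun m => (f m - c) / n) := by
    intro f hf m
    simp only
    rw [hf, show f m - n - c = f m - c + n * (-1) by ring, Int.add_mul_ediv_left _ _ hn.ne']
    ring
  have hsum : ∀ f : ℤ → ℤ, QuasiPeriodic k n f → ∀ a : ℤ,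
      ∑ j : Fin k, (f (j + a) - c) / n = charge n k c f + 1 - a := by
    intro f hf a
    have h1 := (hqp f hf).sum_window a
    have h2 := (hqp f hf).sum_window 1
    rw [charge]
    rw [h1, h2]
    ring
  -- If $g(i)<c=f(i)$, then $g<c$ on the window starting at $i$ and $f\ge c$ on the window ending at
  -- $i$, so the charge of $g$ is at most $i-1-k$ and that of $f$ at least $i-k$.
  have hg1 := hsum g hg i
  have hf1 := hsum f hf (i + 1 - k)
  have hg2 : ∑ j : Fin k, (g (j + i) - c) / n ≤ ∑ j : Fin k, (-1 : ℤ) := by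
    refine Finset.sum_le_sum fun j _ => ?_
    have h1 : g (j + i) ≤ g i := hga (by omega)
    have h2 : (g (j + i) - c) / n < 0 := Int.ediv_neg_of_neg_of_pos (by omega) hn
    omega
  have hf2 : ∑ j : Fin k, (0 : ℤ) ≤ ∑ j : Fin k, (f (j + (i + 1 - k)) - c) / n := by
    refine Finset.sum_le_sum fun j _ => ?_
    have h1 : f i ≤ f (j + (i + 1 - k)) := hfa (by have := j.2; omega)
    exact Int.ediv_nonneg (by omega) hn.le
  simp only [Finset.sum_const, Finset.card_univ, Fintype.card_fin, smul_zero, nsmul_eq_mul] at hf2 hg2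
  have := h c
  linarith

end Charge

section Shift

variable [NeZero k]

theorem quasiPeriodic_shift (lam : Alcove n k) (d : ℤ) :
    QuasiPeriodic k n fun i => lam.ext (i - d) := by
  intro i
  simp only
  rw [add_sub_right_comm, lam.ext_quasiPeriodic]

theorem antitone_shift (lam : Alcove n k) (d : ℤ) : Antitone fun i => lam.ext (i - d) :=
  fun _ _ h => lam.ext_antitone (sub_le_sub_right h d)

end Shift

variable [NeZero n] [NeZero k]

/-- An affine permutation consists of a permutation $\sigma$ of the window and translations by
$kq_i$ with $\sum_i q_i=0$. On $\mu$ it gives the values $\mu_{\sigma(i)}-nq_i$, and the sum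
condition says exactly that $\sum_i q_i=0$. -/
theorem mem_affineOrbit_iff {mu : Alcove n k} {α : ℤ → ℤ} :
    α ∈ affineOrbit mu ↔ QuasiPeriodic k n α ∧ ∑ i : Fin k, α (i + 1) = mu.size ∧
      ∃ σ : Equiv.Perm (Fin k), ∀ i : Fin k, (α (i + 1) : ZMod n) = mu.res (σ i) := by
  have hn : (n : ℤ) ≠ 0 := by exact_mod_cast NeZero.ne n
  have hk : (k : ℤ) ≠ 0 := by exact_mod_cast NeZero.ne k
  constructor
  · rintro ⟨w, ⟨hw, hsum⟩, rfl⟩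
    obtain ⟨σ, q, h⟩ := exists_perm_window w.injective hw
    rw [sum_Icc_eq_sum_fin, sum_Icc_eq_sum_fin] at hsum
    simp_rw [h, Finset.sum_add_distrib, ← Finset.mul_sum] at hsum
    rw [Equiv.sum_comp σ fun i : Fin k => (i : ℤ)] at hsum
    have hq : ∑ i, q i = 0 := by
      have : (k : ℤ) * ∑ i, q i = 0 := by linarith
      exact (mul_eq_zero.mp this).resolve_left hk
    have hval : ∀ i : Fin k, mu.ext (w (i + 1)) = mu.1 (σ i) - n * q i := by
      intro i
      rw [h, mu.ext_quasiPeriodic.add_mul, mu.ext_window]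
    refine ⟨fun i => ?_, ?_, σ, fun i => ?_⟩
    · simp only
      rw [hw, mu.ext_quasiPeriodic]
    · simp only [hval]
      rw [Finset.sum_sub_distrib, ← Finset.mul_sum, hq, mul_zero, sub_zero, Equiv.sum_comp σ mu.1]
      rfl
    · simp [hval, Alcove.res]
  · rintro ⟨hα, hsum, σ, hσ⟩
    choose q hq using fun i => (ZMod.intCast_eq_intCast_iff_dvd_sub _ _ _).mp (hσ i)
    have hq0 : ∑ i, q i = 0 := by
      have h1 : ∑ i, (mu.1 (σ i) - α (i + 1)) = n * ∑ i, q i := by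
        rw [Finset.mul_sum]
        exact Finset.sum_congr rfl fun i _ => hq i
      rw [Finset.sum_sub_distrib, Equiv.sum_comp σ mu.1, hsum] at h1
      have h2 : (n : ℤ) * ∑ i, q i = 0 := by rw [← h1]; exact sub_self _
      exact (mul_eq_zero.mp h2).resolve_left hn
    -- The affine permutation in the coordinates quotient and remainder modulo $k$.
    let s : Equiv.Perm (ℤ × Fin k) :=
      { toFun := fun p => (p.1 + q p.2, σ p.2)
        invFun := fun p => (p.1 - q (σ.symm p.2), σ.symm p.2)
        left_inv := fun p => by simp
        right_inv := fun p => by simp }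
    let w : Equiv.Perm ℤ := (Equiv.subRight 1).trans
      ((Int.divModEquiv k).trans (s.trans ((Int.divModEquiv k).symm.trans (Equiv.addRight 1))))
    have hw0 : ∀ (i : Fin k) (j : ℤ), w (i + 1 + k * j) = σ i + 1 + k * (j + q i) := by
      intro i j
      have h1 : (Int.divModEquiv k) (i + k * j) = (j, i) := by
        rw [← Equiv.eq_symm_apply]
        simp only [Int.divModEquiv, Equiv.coe_fn_symm_mk]
        ring
      have h2 : w (i + 1 + k * j) =
          (Int.divModEquiv k).symm (s ((Int.divModEquiv k) (i + 1 + k * j - 1))) + 1 := rfl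
      rw [h2, show (i : ℤ) + 1 + k * j - 1 = i + k * j by ring, h1]
      simp only [s, Int.divModEquiv, Equiv.coe_fn_symm_mk, Equiv.coe_fn_mk]
      ring
    have hw1 : ∀ i : Fin k, w (i + 1) = σ i + 1 + k * q i := by
      intro i
      simpa using hw0 i 0
    have hw2 : ∀ m, w (m + k) = w m + k := by
      intro m
      obtain ⟨i, j, rfl⟩ := exists_window (k := k) m
      rw [show (i : ℤ) + 1 + k * j + k = i + 1 + k * (j + 1) by ring, hw0, hw0]
      ring
    refine ⟨w, ⟨hw2, ?_⟩, ?_⟩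
    · rw [sum_Icc_eq_sum_fin, sum_Icc_eq_sum_fin]
      simp_rw [hw1, Finset.sum_add_distrib, ← Finset.mul_sum]
      rw [hq0, Equiv.sum_comp σ fun i : Fin k => (i : ℤ)]
      ring
    · refine hα.eq_of_window (fun m => ?_) fun i => ?_
      · rw [hw2, mu.ext_quasiPeriodic]
      · rw [hw1, mu.ext_quasiPeriodic.add_mul, mu.ext_window, ← hq]
        ring

/-! ### Sorting -/

/-- Each quotient is (value minus remainder) divided by $n$. The sum of the values and the multiset
of remainders are the same along the orbit. -/
theorem charge_eq_of_mem_affineOrbit {mu : Alcove n k} {α : ℤ → ℤ} (h : α ∈ affineOrbit mu)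
    (c : ℤ) : charge n k c α = charge n k c mu.ext := by
  have hn : (n : ℤ) ≠ 0 := by exact_mod_cast NeZero.ne n
  obtain ⟨-, hs, σ, hσ⟩ := mem_affineOrbit_iff.mp h
  have key : ∀ f : ℤ → ℤ, n * charge n k c f + ∑ i : Fin k, (f (i + 1) - c) % n =
      ∑ i : Fin k, f (i + 1) - k * c := by
    intro f
    rw [charge, Finset.mul_sum, ← Finset.sum_add_distrib]
    simp_rw [Int.mul_ediv_add_emod]
    simp
  have h1 : ∑ i : Fin k, (α (i + 1) - c) % n = ∑ i : Fin k, (mu.ext (i + 1) - c) % n := by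
    rw [← Equiv.sum_comp σ fun i : Fin k => (mu.ext (i + 1) - c) % n]
    refine Finset.sum_congr rfl fun i _ => ?_
    have h2 : (α (i + 1) : ZMod n) = (mu.1 (σ i) : ZMod n) := hσ i
    rw [ZMod.intCast_eq_intCast_iff] at h2
    rw [mu.ext_window]
    exact h2.sub_right c
  have h2 := key α
  have h3 := key mu.ext
  have h4 : ∑ i : Fin k, mu.ext (i + 1) = mu.size := by
    simp_rw [mu.ext_window]
    rfl
  rw [hs, h1] at h2
  rw [h4] at h3
  exact mul_left_cancel₀ hn (by linarith)

/-- The map `mu.ext` is the antitone member of the orbit with the same charges as $\alpha$, and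
inequalities between antitone maps can be read off from charges. -/
theorem isCylShape_of_mem_affineOrbit {lam mu : Alcove n k} {d : ℤ} {α : ℤ → ℤ}
    (hα : α ∈ affineOrbit mu) (h : ∀ i, α i ≤ lam.ext (i - d)) : IsCylShape lam d mu :=
  le_of_charge_le mu.ext_quasiPeriodic (quasiPeriodic_shift lam d) mu.ext_antitone
    (antitone_shift lam d)
    fun c => (charge_eq_of_mem_affineOrbit hα c).symm.le.trans (charge_mono c h)

theorem isCylVertStrip_of_mem_affineOrbit {lam mu : Alcove n k} {d : ℤ} {α : ℤ → ℤ}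
    (hα : α ∈ affineOrbit mu) (h : ∀ i, lam.ext (i - d) - α i = 0 ∨ lam.ext (i - d) - α i = 1) :
    IsCylVertStrip lam d mu := by
  intro i
  have h1 : mu.ext i ≤ lam.ext (i - d) :=
    isCylShape_of_mem_affineOrbit hα (fun i => by rcases h i with h | h <;> omega) i
  have h2 : lam.ext (i - d) - 1 ≤ mu.ext i :=
    le_of_charge_le (f := fun i => lam.ext (i - d) - 1)
      (fun i => by have := quasiPeriodic_shift lam d i; simp only at this ⊢; omega)
      mu.ext_quasiPeriodic (fun a b hab => sub_le_sub_right (antitone_shift lam d hab) 1)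
      mu.ext_antitone
      (fun c => (charge_mono c fun i => by rcases h i with h | h <;> omega).trans
        (charge_eq_of_mem_affineOrbit hα c).le) i
  omega

end Loops

/-! ## Cylindric shapes and their weight factors -/

section Shapes

variable {n k : ℕ} [NeZero k]

/-- The points of the orbit of `μ` that differ from the loop `λ[d]` by entries satisfying `A`. -/
def stripSet (A : ℕ → Prop) (lam : Alcove n k) (d : ℤ) (mu : Alcove n k) : Set (ℤ → ℤ) :=
  {α ∈ affineOrbit mu | ∀ i, ∃ b : ℕ, lam.ext (i - d) = α i + b ∧ A b}

theorem cylTheta_eq_ncard (lam : Alcove n k) (d : ℤ) (mu : Alcove n k) :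
    cylTheta lam d mu = (stripSet (fun _ => True) lam d mu).ncard := by
  rw [cylTheta, stripSet]
  congr 1
  ext α
  refine and_congr_right fun _ => forall_congr' fun i => ?_
  constructor
  · intro h
    exact ⟨(lam.ext (i - d) - α i).toNat, by omega, trivial⟩
  · rintro ⟨b, h, -⟩
    omega

theorem cylPsi_eq_ncard (lam : Alcove n k) (d : ℤ) (mu : Alcove n k) :
    cylPsi lam d mu = (stripSet (fun b => b ≤ 1) lam d mu).ncard := by
  rw [cylPsi, stripSet]
  congr 1
  ext α
  refine and_congr_right fun _ => forall_congr' fun i => ?_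
  constructor
  · intro h
    exact ⟨(lam.ext (i - d) - α i).toNat, by omega, by omega⟩
  · rintro ⟨b, h, hb⟩
    omega

theorem IsCylShape.cylShapeSize_add {lam mu : Alcove n k} {d : ℤ} (h : IsCylShape lam d mu) :
    lam.size + d * n = mu.size + cylShapeSize lam d mu := by
  have hset : {b : ℤ × ℤ | (1 ≤ b.1 ∧ b.1 ≤ k) ∧ mu.ext b.1 < b.2 ∧ b.2 ≤ lam.ext (b.1 - d)} =
      (((Finset.Icc (1 : ℤ) k).sigma fun i => Finset.Ioc (mu.ext i) (lam.ext (i - d))).map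
        (Equiv.sigmaEquivProd ℤ ℤ).toEmbedding : Set (ℤ × ℤ)) := by
    ext ⟨a, b⟩
    simp
  rw [cylShapeSize, hset, Set.ncard_coe_finset, Finset.card_map, Finset.card_sigma]
  push_cast
  rw [sum_Icc_eq_sum_fin, ← lam.sum_ext_window d]
  have h2 : mu.size = ∑ i : Fin k, mu.ext (i + 1) := by
    simp_rw [mu.ext_window]
    rfl
  rw [h2, ← Finset.sum_add_distrib]
  refine Finset.sum_congr rfl fun i _ => ?_
  have := h (i + 1)
  rw [Int.card_Ioc, Int.toNat_of_nonneg (by omega)]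
  ring

/-- For $d<0$ row $k$ would give $1\le\mu_k\le\lambda_{k-d}\le\lambda_{k+1}=\lambda_1-n\le0$. -/
theorem IsCylShape.nonneg {lam mu : Alcove n k} {d : ℤ} (h : IsCylShape lam d mu) : 0 ≤ d := by
  by_contra! hd
  have hk : 0 < k := Nat.pos_of_ne_zero (NeZero.ne k)
  have h1 := mu.ext_window ⟨k - 1, by omega⟩
  have h2 := (mu.2.2 ⟨k - 1, by omega⟩).1
  rw [← h1] at h2
  have h3 := lam.ext_window 0
  have h4 := (lam.2.2 0).2
  rw [← h3] at h4
  simp only [Fin.val_zero, Nat.cast_zero] at h4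
  have h5 := h (((⟨k - 1, by omega⟩ : Fin k) : ℤ) + 1)
  have h6 := lam.ext_antitone (show (0 : ℤ) + 1 + k ≤ ((⟨k - 1, by omega⟩ : Fin k) : ℤ) + 1 - d by
    simp only
    omega)
  rw [lam.ext_quasiPeriodic] at h6
  omega

end Shapes

section Steps

variable {n k : ℕ} [NeZero n]

open Classical in
/-- The number of compositions `b` of `s` with entries satisfying `A` that lead from `μ` to `λ`. -/
noncomputable def stepCount (A : ℕ → Prop) (s : ℕ) (lam mu : Alcove n k) : ℕ :=
  ((Finset.piAntidiag Finset.univ s).filter fun b : Fin k → ℕ =>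
    (∀ i, A (b i)) ∧ Alcove.ofRes (lam.res - fun i => (b i : ZMod n)) = mu).card

theorem stepCount_zero {A : ℕ → Prop} (hA : A 0) (lam : Alcove n k) :
    stepCount A 0 lam lam = 1 := by
  classical
  rw [stepCount, Finset.piAntidiag_zero, Finset.filter_singleton, if_pos, Finset.card_singleton]
  refine ⟨fun _ => hA, ?_⟩
  have : (lam.res - fun i => (((0 : Fin k → ℕ) i : ℕ) : ZMod n)) = lam.res := by
    funext i
    simp
  rw [this, Alcove.ofRes_res]

variable [NeZero k]

/-- The bijection sends $\alpha$ to the difference $\lambda\circ\tau^d-\alpha$ on a window. Orbit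
membership translates into the total $s$ and the residue condition. -/
theorem ncard_stripSet (A : ℕ → Prop) {lam mu : Alcove n k} {d : ℤ} {s : ℕ}
    (hs : lam.size + d * n = mu.size + s) :
    (stripSet A lam d mu).ncard = stepCount A s lam mu := by
  classical
  obtain ⟨ρ, hρ⟩ := lam.exists_perm_ext_window d
  have hqp := quasiPeriodic_shift lam d
  rw [stepCount, ← Set.ncard_coe_finset]
  -- The rows are relabelled by $\rho$, which undoes the rotation of the residues of $\lambda$
  -- caused by $\tau^d$.
  refine Set.ncard_congr
    (fun α _ i => (lam.ext (ρ.symm i + 1 - d) - α (ρ.symm i + 1)).toNat) ?_ ?_ ?_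
  · rintro α ⟨hα, hA⟩
    obtain ⟨hαq, hsum, σ, hσ⟩ := mem_affineOrbit_iff.mp hα
    have hcast : ∀ i : Fin k, ((lam.ext (i + 1 - d) - α (i + 1)).toNat : ℤ) =
        lam.ext (i + 1 - d) - α (i + 1) := by
      intro i
      obtain ⟨b, hb, -⟩ := hA (i + 1)
      omega
    simp only [Finset.coe_filter, Finset.mem_piAntidiag, Finset.mem_univ, implies_true, and_true,
      Set.mem_ofPred_eq]
    refine ⟨?_, fun i => ?_, Alcove.ofRes_eq_iff.mpr ⟨ρ.symm.trans σ, ?_⟩⟩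
    · rw [Equiv.sum_comp ρ.symm fun i : Fin k => (lam.ext (i + 1 - d) - α (i + 1)).toNat]
      zify
      simp_rw [hcast]
      rw [Finset.sum_sub_distrib, lam.sum_ext_window, hsum]
      omega
    · obtain ⟨b, hb, hAb⟩ := hA (ρ.symm i + 1)
      rw [hb, add_sub_cancel_left]
      simpa using hAb
    · funext i
      have h1 := hρ (ρ.symm i)
      rw [Equiv.apply_symm_apply] at h1
      rw [Pi.sub_apply, ← Int.cast_natCast, hcast, Int.cast_sub, h1, sub_sub_cancel, hσ]
      rfl
  · rintro α β ⟨hα, hA⟩ ⟨hβ, hB⟩ heq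
    refine (mem_affineOrbit_iff.mp hα).1.eq_of_window (mem_affineOrbit_iff.mp hβ).1 fun i => ?_
    have h := congrFun heq (ρ i)
    simp only [Equiv.symm_apply_apply] at h
    obtain ⟨b, hb, -⟩ := hA (i + 1)
    obtain ⟨c, hc, -⟩ := hB (i + 1)
    omega
  · intro b hb
    simp only [Finset.coe_filter, Finset.mem_piAntidiag, Finset.mem_univ, implies_true, and_true,
      Set.mem_ofPred_eq] at hb
    obtain ⟨hsum, hA, hres⟩ := hb
    obtain ⟨σ, hσ⟩ := Alcove.ofRes_eq_iff.mp hres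
    have hwin : ∀ (i : Fin k) (j : ℤ), (((i : ℤ) + 1 + k * j - 1) % k).toNat = i := by
      intro i j
      have := i.2
      rw [show (i : ℤ) + 1 + k * j - 1 = i + k * j by ring, Int.add_mul_emod_self_left,
        Int.emod_eq_of_lt (by omega) (by omega), Int.toNat_natCast]
    let α : ℤ → ℤ := fun m =>
      lam.ext (m - d) - b (ρ (Fin.ofNat k ((m - 1) % k).toNat))
    have hα : ∀ (i : Fin k) (j : ℤ),
        α (i + 1 + k * j) = lam.ext (i + 1 + k * j - d) - b (ρ i) := by
      intro i j
      simp only [α]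
      rw [hwin]
      congr 3
      exact congrArg ρ (Fin.ext (Nat.mod_eq_of_lt i.2))
    have hα0 : ∀ i : Fin k, α (i + 1) = lam.ext (i + 1 - d) - b (ρ i) := by
      intro i
      simpa using hα i 0
    have hmem : α ∈ affineOrbit mu := by
      rw [mem_affineOrbit_iff]
      refine ⟨fun m => ?_, ?_, ρ.trans σ, fun i => ?_⟩
      · simp only [α]
        rw [show m + k - 1 = m - 1 + k by ring, Int.add_emod_right]
        have := hqp m
        simp only at this
        rw [this]
        ring
      · simp_rw [hα0]
        rw [Finset.sum_sub_distrib, lam.sum_ext_window, Equiv.sum_comp ρ fun i => (b i : ℤ),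
          ← Nat.cast_sum, hsum]
        omega
      · have h := congrFun hσ (ρ i)
        rw [Pi.sub_apply] at h
        rw [hα0, Int.cast_sub, hρ, Int.cast_natCast, h]
        rfl
    refine ⟨α, ⟨hmem, fun m => ?_⟩, ?_⟩
    · obtain ⟨i, j, rfl⟩ := exists_window (k := k) m
      exact ⟨b (ρ i), by rw [hα]; ring, hA _⟩
    · funext i
      simp [hα0]

/-- Without boxes the two loops agree on a window; equal residues give $\lambda=\mu$, and then the
sizes give $dn=0$. -/
theorem IsCylShape.eq_of_size_zero {lam mu : Alcove n k} {d : ℤ} (h : IsCylShape lam d mu)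
    (h0 : cylShapeSize lam d mu = 0) : lam = mu ∧ d = 0 := by
  have hn : (n : ℤ) ≠ 0 := by exact_mod_cast NeZero.ne n
  have h1 := h.cylShapeSize_add
  rw [h0, Nat.cast_zero, add_zero, ← lam.sum_ext_window d] at h1
  have h2 : mu.size = ∑ i : Fin k, mu.ext (i + 1) := by
    simp_rw [mu.ext_window]
    rfl
  rw [h2] at h1
  have h3 := (Finset.sum_eq_sum_iff_of_le fun i _ => h ((i : Fin k) + 1)).mp h1.symm
  obtain ⟨ρ, hρ⟩ := lam.exists_perm_ext_window d
  have h4 : lam = mu := by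
    refine Alcove.eq_of_res_comp_eq (σ := ρ) (τ := 1) (funext fun i => ?_)
    have h5 := h3 i (Finset.mem_univ i)
    rw [mu.ext_window] at h5
    change lam.res (ρ i) = (mu.1 i : ZMod n)
    rw [← hρ, h5]
  refine ⟨h4, ?_⟩
  subst h4
  have h6 := lam.sum_ext_window d
  rw [h1, ← h2] at h6
  have h7 : d * (n : ℤ) = 0 := by omega
  exact (mul_eq_zero.mp h7).resolve_right hn

end Steps

/-! ## The expansion of cylindric functions over reverse plane partitions -/

section Expansion

variable {n k : ℕ} [NeZero n]

open Classical in
/-- The weighted number of paths of weights from `μ` to `λ` with step sizes `m 0, …, m (N - 1)`. -/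
noncomputable def pathSum (A : ℕ → Prop) (m : ℕ → ℕ) (mu : Alcove n k) : ℕ → Alcove n k → ℕ
  | 0, lam => if lam = mu then 1 else 0
  | N + 1, lam => ∑ kap : Alcove n k, stepCount A (m N) lam kap * pathSum A m mu N kap

open Classical in
theorem sum_paths_eq_pathSum (A : ℕ → Prop) (m : ℕ → ℕ) (mu : Alcove n k) (N : ℕ)
    (lam : Alcove n k) :
    (∑ w : Fin (N + 1) → Alcove n k, if w 0 = mu ∧ w (Fin.last N) = lam then
      ∏ i : Fin N, stepCount A (m i) (w i.succ) (w i.castSucc) else 0) = pathSum A m mu N lam := by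
  induction N generalizing lam with
  | zero =>
    rw [pathSum, ← (Equiv.funUnique (Fin 1) (Alcove n k)).symm.sum_comp]
    simp only [Finset.univ_eq_empty, Finset.prod_empty]
    have : ∀ x : Alcove n k, (Equiv.funUnique (Fin 1) (Alcove n k)).symm x 0 = x := fun _ => rfl
    have h' : ∀ x : Alcove n k, (Equiv.funUnique (Fin 1) (Alcove n k)).symm x (Fin.last 0) = x :=
      fun _ => rfl
    simp only [this, h']
    by_cases h : lam = mu
    · subst h
      simp
    · rw [if_neg h]
      refine Finset.sum_eq_zero fun x _ => if_neg ?_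
      rintro ⟨rfl, rfl⟩
      exact h rfl
  | succ N ih =>
    rw [pathSum, ← (Fin.snocEquiv fun _ => Alcove n k).sum_comp, Fintype.sum_prod_type]
    have h1 : ∀ (x : Alcove n k) (w : Fin (N + 1) → Alcove n k),
        (if (Fin.snocEquiv fun _ => Alcove n k) (x, w) 0 = mu ∧
          (Fin.snocEquiv fun _ => Alcove n k) (x, w) (Fin.last (N + 1)) = lam then
          ∏ i : Fin (N + 1), stepCount A (m i) ((Fin.snocEquiv fun _ => Alcove n k) (x, w) i.succ)
            ((Fin.snocEquiv fun _ => Alcove n k) (x, w) i.castSucc) else 0) =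
        if x = lam then stepCount A (m N) lam (w (Fin.last N)) * (if w 0 = mu then
          ∏ i : Fin N, stepCount A (m i) (w i.succ) (w i.castSucc) else 0) else 0 := by
      intro x w
      have e0 : (Fin.snocEquiv fun _ => Alcove n k) (x, w) 0 = w 0 :=
        Fin.snoc_castSucc (α := fun _ => Alcove n k) x w 0
      have e1 : (Fin.snocEquiv fun _ => Alcove n k) (x, w) (Fin.last (N + 1)) = x :=
        Fin.snoc_last (α := fun _ => Alcove n k) x w
      have e2 : ∀ i : Fin (N + 1),
          (Fin.snocEquiv fun _ => Alcove n k) (x, w) i.castSucc = w i :=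
        fun i => Fin.snoc_castSucc (α := fun _ => Alcove n k) x w i
      rw [Fin.prod_univ_castSucc]
      simp only [Fin.succ_castSucc, Fin.succ_last, e0, e1, e2, Fin.val_castSucc, Fin.val_last]
      by_cases hx : x = lam
      · subst hx
        by_cases hw : w 0 = mu
        · simp only [hw, and_self, if_true]
          rw [mul_comm]
        · simp [hw]
      · simp [hx]
    simp_rw [h1]
    rw [Finset.sum_comm]
    simp only [Finset.sum_ite_eq', Finset.mem_univ, if_true]
    rw [← Finset.sum_fiberwise _ (fun w : Fin (N + 1) → Alcove n k => w (Fin.last N))]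
    refine Finset.sum_congr rfl fun kap _ => ?_
    rw [← ih, Finset.mul_sum, Finset.sum_filter]
    refine Finset.sum_congr rfl fun w _ => ?_
    by_cases h2 : w (Fin.last N) = kap
    · simp [h2]
    · simp [h2]

/-! ### Coefficients of products of monomial series -/

open Classical in
/-- The number of factorisations of the monomial `u^m` into `k` monomials with exponents satisfying
`A`, whose degrees lead from `μ` to the residues `x`. -/
noncomputable def matCount (A : ℕ → Prop) (m : ℕ →₀ ℕ) (x : Fin k → ZMod n) (mu : Alcove n k) : ℕ :=
  ((Finset.piAntidiag Finset.univ m).filter fun l : Fin k → ℕ →₀ ℕ =>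
    (∀ j i, A (l j i)) ∧ Alcove.ofRes (x - fun j => ((l j).degree : ZMod n)) = mu).card

theorem matCount_comp (A : ℕ → Prop) (m : ℕ →₀ ℕ) (x : Fin k → ZMod n) (mu : Alcove n k)
    (σ : Equiv.Perm (Fin k)) : matCount A m (x ∘ σ) mu = matCount A m x mu := by
  refine Finset.card_nbij' (fun l => l ∘ σ.symm) (fun l => l ∘ σ) ?_ ?_ ?_ ?_
  · intro l hl
    simp only [Finset.coe_filter, Finset.mem_piAntidiag, Finset.mem_univ, implies_true, and_true,
      Set.mem_ofPred_eq] at hl ⊢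
    refine ⟨(Equiv.sum_comp σ.symm l).trans hl.1, fun j i => hl.2.1 _ i, ?_⟩
    rw [← hl.2.2, ← Alcove.ofRes_comp _ σ]
    congr 1
    funext j
    simp
  · intro l hl
    simp only [Finset.coe_filter, Finset.mem_piAntidiag, Finset.mem_univ, implies_true, and_true,
      Set.mem_ofPred_eq] at hl ⊢
    refine ⟨(Equiv.sum_comp σ l).trans hl.1, fun j i => hl.2.1 _ i, ?_⟩
    rw [← hl.2.2]
    exact Alcove.ofRes_comp (x - fun j => ((l j).degree : ZMod n)) σ
  · intro l _; funext j; simp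
  · intro l _; funext j; simp

theorem matCount_eq_res (A : ℕ → Prop) (m : ℕ →₀ ℕ) (x : Fin k → ZMod n) (mu : Alcove n k) :
    matCount A m x mu = matCount A m (Alcove.ofRes x).res mu := by
  obtain ⟨σ, hσ⟩ := Alcove.ofRes_spec x
  conv_lhs => rw [hσ]
  exact matCount_comp A m _ mu σ

-- The exponents $b_j$ of the variable $u_N$ are split off from all $k$ factors, which shifts the
-- residues by $b$.
open Classical in
theorem matCount_erase {A : ℕ → Prop} (hA : A 0) (m : ℕ →₀ ℕ) (N : ℕ) (x : Fin k → ZMod n)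
    (mu : Alcove n k) : matCount A m x mu =
      ∑ b ∈ Finset.piAntidiag Finset.univ (m N) with ∀ j, A (b j),
        matCount A (m.erase N) (x - fun j => (b j : ZMod n)) mu := by
  simp_rw [matCount]
  rw [← Finset.card_sigma]
  have hdeg : ∀ l : ℕ →₀ ℕ, l.degree = (l.erase N).degree + l N := by
    intro l
    conv_lhs => rw [← Finsupp.erase_add_single N l]
    rw [map_add, Finsupp.degree_single]
  refine Finset.card_nbij' (fun l => ⟨fun j => l j N, fun j => (l j).erase N⟩)
    (fun p j => p.2 j + Finsupp.single N (p.1 j)) ?_ ?_ ?_ ?_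
  · intro l hl
    simp only [Finset.coe_filter, Finset.mem_piAntidiag, Finset.mem_univ, implies_true, and_true,
      Set.mem_ofPred_eq, Finset.coe_sigma, Set.mem_sigma_iff] at hl ⊢
    obtain ⟨hsum, hl, hx⟩ := hl
    refine ⟨⟨?_, fun j => hl j N⟩, ?_, fun j i => ?_, ?_⟩
    · rw [← hsum, Finsupp.finsetSum_apply]
    · rw [← hsum]
      ext i
      rw [Finsupp.finsetSum_apply, Finsupp.erase_apply]
      split_ifs with h
      · exact Finset.sum_eq_zero fun j _ => by rw [h, Finsupp.erase_same]
      · rw [Finsupp.finsetSum_apply]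
        exact Finset.sum_congr rfl fun j _ => Finsupp.erase_ne h
    · rw [Finsupp.erase_apply]
      split_ifs
      · exact hA
      · exact hl j i
    · rw [← hx]
      congr 1
      funext j
      simp only [Pi.sub_apply]
      rw [hdeg (l j)]
      push_cast
      ring
  · rintro ⟨b, l⟩ h
    simp only [Finset.coe_filter, Finset.mem_piAntidiag, Finset.mem_univ, implies_true, and_true,
      Set.mem_ofPred_eq, Finset.coe_sigma, Set.mem_sigma_iff] at h ⊢
    obtain ⟨⟨hb, hAb⟩, hsum, hl, hx⟩ := h
    -- Natural numbers with sum zero vanish, so no factor still contains $u_N$.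
    have hN : ∀ j, l j N = 0 := by
      intro j
      have h1 := congrArg (fun f => f N) hsum
      simp only [Finsupp.finsetSum_apply, Finsupp.erase_same] at h1
      exact Finset.sum_eq_zero_iff.mp h1 j (Finset.mem_univ j)
    refine ⟨?_, fun j i => ?_, ?_⟩
    · rw [Finset.sum_add_distrib, hsum, ← Finsupp.single_finsetSum, hb, Finsupp.erase_add_single]
    · rw [Finsupp.add_apply, Finsupp.single_apply]
      split_ifs with h
      · subst h
        rw [hN, zero_add]
        exact hAb j
      · exact hl j i
    · rw [← hx]
      congr 1
      funext j
      simp only [Pi.sub_apply, map_add, Finsupp.degree_single]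
      push_cast
      ring
  · intro l _
    funext j
    exact Finsupp.erase_add_single N (l j)
  · rintro ⟨b, l⟩ h
    simp only [Finset.coe_filter, Finset.mem_piAntidiag, Finset.mem_univ, implies_true, and_true,
      Set.mem_ofPred_eq, Finset.coe_sigma, Set.mem_sigma_iff] at h
    obtain ⟨-, hsum, -, -⟩ := h
    have hN : ∀ j, l j N = 0 := by
      intro j
      have h1 := congrArg (fun f => f N) hsum
      simp only [Finsupp.finsetSum_apply, Finsupp.erase_same] at h1
      exact Finset.sum_eq_zero_iff.mp h1 j (Finset.mem_univ j)
    have h1 : (fun j => (l j + Finsupp.single N (b j)) N) = b := by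
      funext j
      simp [hN]
    have h2 : (fun j => (l j + Finsupp.single N (b j)).erase N) = l := by
      funext j
      rw [Finsupp.erase_add, Finsupp.erase_single, add_zero, Finsupp.erase_of_notMem_support]
      simp [hN]
    simp only [h1, h2]

/-- Removing the last variable is the last step of a path. The remaining count depends only on the
orbit of the new residues, which is the previous weight. -/
theorem matCount_eq_pathSum {A : ℕ → Prop} (hA : A 0) (c : ℕ → ℕ) (mu : Alcove n k) (N : ℕ) :
    ∀ (m : ℕ →₀ ℕ) (lam : Alcove n k), (∀ i < N, m i = c i) → (∀ i, N ≤ i → m i = 0) →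
      matCount A m lam.res mu = pathSum A c mu N lam := by
  classical
  induction N with
  | zero =>
    intro m lam _ h
    have hm : m = 0 := Finsupp.ext fun i => h i (Nat.zero_le i)
    subst hm
    have h1 : (lam.res - fun j => ((((0 : Fin k → ℕ →₀ ℕ) j).degree : ℕ) : ZMod n)) = lam.res := by
      funext j
      simp
    rw [matCount, pathSum, Finset.piAntidiag_zero, Finset.filter_singleton, h1, Alcove.ofRes_res]
    by_cases h : lam = mu
    · rw [if_pos ⟨fun _ _ => hA, h⟩, if_pos h, Finset.card_singleton]
    · rw [if_neg fun h' => h h'.2, if_neg h, Finset.card_empty]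
  | succ N ih =>
    intro m lam h1 h2
    rw [matCount_erase hA m N, pathSum, ← Finset.sum_fiberwise _
      (fun b : Fin k → ℕ => Alcove.ofRes (lam.res - fun j => (b j : ZMod n)))]
    refine Finset.sum_congr rfl fun kap _ => ?_
    rw [← h1 N (Nat.lt_succ_self N), stepCount, Finset.filter_filter, ← smul_eq_mul,
      ← Finset.sum_const]
    refine Finset.sum_congr rfl fun b hb => ?_
    rw [matCount_eq_res, (Finset.mem_filter.mp hb).2.2]
    refine ih _ kap (fun i hi => ?_) fun i hi => ?_
    · rw [Finsupp.erase_ne (by omega), h1 i (by omega)]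
    · rcases eq_or_ne i N with rfl | hne
      · exact Finsupp.erase_same
      · rw [Finsupp.erase_ne hne, h2 i (by omega)]

theorem coeff_prod_piAntidiag (f : Fin k → MvPowerSeries ℕ ℂ) (m : ℕ →₀ ℕ) :
    MvPowerSeries.coeff m (∏ j, f j) =
      ∑ l ∈ Finset.piAntidiag Finset.univ m, ∏ j, MvPowerSeries.coeff (l j) (f j) := by
  classical
  rw [MvPowerSeries.coeff_prod]
  refine Finset.sum_nbij' (fun l => ⇑l) (fun l => Finsupp.equivFunOnFinite.symm l) ?_ ?_ ?_ ?_ ?_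
  · intro l hl
    rw [Finset.mem_finsuppAntidiag] at hl
    simpa using hl.1
  · intro l hl
    rw [Finset.mem_piAntidiag] at hl
    rw [Finset.mem_finsuppAntidiag]
    exact ⟨hl.1, Finset.subset_univ _⟩
  · intro l _
    exact Finsupp.equivFunOnFinite.symm_apply_apply l
  · intro l _
    rfl
  · intro l _
    rfl

theorem coeff_cylSum_monomialSeries (A : ℕ → Prop) (lam : Alcove n k) (d : ℤ) (mu : Alcove n k)
    (m : ℕ →₀ ℕ) :
    MvPowerSeries.coeff m (cylSum (monomialSeries A) lam d mu) = open Classical in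
      if lam.size + d * n = mu.size + m.degree then (matCount A m lam.res mu : ℂ) else 0 := by
  classical
  have h1 : ∀ (b : Fin k → ℕ) (l : Fin k → ℕ →₀ ℕ),
      ∏ j, MvPowerSeries.coeff (l j) (monomialSeries A (b j)) =
      if (fun j => (l j).degree) = b ∧ ∀ j i, A (l j i) then (1 : ℂ) else 0 := by
    intro b l
    simp_rw [coeff_monomialSeries]
    rw [Finset.prod_ite_zero]
    simp only [Finset.prod_const_one, Finset.mem_univ, true_imp_iff, funext_iff, forall_and]
  simp_rw [cylSum, residueSum, map_sum, coeff_prod_piAntidiag, h1]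
  simp_rw [Finset.sum_comm (t := Finset.piAntidiag Finset.univ m)]
  rw [matCount, Finset.card_filter, Nat.cast_sum]
  by_cases hr : lam.size + d * n = mu.size + m.degree
  · rw [if_pos hr]
    refine Finset.sum_congr rfl fun l hl => ?_
    rw [Finset.mem_piAntidiag] at hl
    have hdeg : ∑ j, (((l j).degree : ℕ) : ℤ) = lam.size + d * n - mu.size := by
      rw [hr, ← hl.1, map_sum]
      push_cast
      ring
    by_cases hA : ∀ j i, A (l j i)
    -- The degrees of the factors determine $b$ and hence $y$, so both outer sums collapse.
    · rw [Finset.sum_filter, Finset.sum_eq_single fun j => ((l j).degree : ZMod n)]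
      · simp only [hA, implies_true, and_true, true_and]
        rw [Finset.sum_ite_eq, if_pos (mem_residueComp.mpr ⟨hdeg, fun _ => rfl⟩)]
        split_ifs <;> simp
      · intro y _ hy
        split_ifs
        · refine Finset.sum_eq_zero fun b hb => if_neg ?_
          rintro ⟨rfl, -⟩
          exact hy (funext fun j => ((mem_residueComp.mp hb).2 j).symm)
        · rfl
      · intro h
        exact absurd (Finset.mem_univ _) h
    · simp [hA]
  · rw [if_neg hr]
    refine Finset.sum_eq_zero fun l hl => Finset.sum_eq_zero fun y _ =>
      Finset.sum_eq_zero fun b hb => if_neg ?_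
    rintro ⟨rfl, -⟩
    apply hr
    have h2 := (mem_residueComp.mp hb).1
    rw [Finset.mem_piAntidiag] at hl
    rw [← hl.1, map_sum]
    push_cast
    omega

end Expansion

/-! ## Cylindric functions as residue sums -/

theorem coe_cylSum {n k : ℕ} [NeZero n] (f : ℕ → SymFun) (lam : Alcove n k) (d : ℤ) (mu : Alcove n k) :
    ((cylSum f lam d mu : SymFun) : MvPowerSeries ℕ ℂ) =
      cylSum (fun r => (f r : MvPowerSeries ℕ ℂ)) lam d mu := by
  simp [cylSum, residueSum]

section Planar

variable {n k : ℕ} [NeZero k]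

theorem CRPP.ext_of_wt_deg {lam mu : Alcove n k} {d : ℤ} {π ρ : CRPP lam d mu}
    (h : π.wt = ρ.wt) (h' : π.deg = ρ.deg) : π = ρ := by
  cases π
  cases ρ
  subst h h'
  rfl

variable {lam mu : Alcove n k} {d : ℤ}

theorem CRPP.size_add (π : CRPP lam d mu) (i : ℕ) :
    (π.wt (i + 1)).size + π.deg (i + 1) * n = (π.wt i).size + π.deg i * n + π.content i := by
  have h := (π.shape i).cylShapeSize_add
  rw [sub_mul] at h
  rw [CRPP.content]
  linarith

theorem CRPP.size_add_sum (π : CRPP lam d mu) (i : ℕ) :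
    (π.wt i).size + π.deg i * n = mu.size + ∑ j ∈ Finset.range i, (π.content j : ℤ) := by
  induction i with
  | zero => simp [π.wt_zero, π.deg_zero]
  | succ i ih =>
    rw [π.size_add, ih, Finset.sum_range_succ]
    ring

variable [NeZero n]

theorem CRPP.wt_eq_of_le (π : CRPP lam d mu) {N : ℕ} (h : ∀ i, N ≤ i → π.content i = 0) (i : ℕ)
    (hi : N ≤ i) : π.wt i = lam ∧ π.deg i = d := by
  have h1 : ∀ j, π.wt (N + j) = π.wt N ∧ π.deg (N + j) = π.deg N := by
    intro j
    induction j with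
    | zero => exact ⟨rfl, rfl⟩
    | succ j ih =>
      have h2 := (π.shape (N + j)).eq_of_size_zero (h (N + j) (Nat.le_add_right N j))
      exact ⟨h2.1.trans ih.1, (sub_eq_zero.mp h2.2).trans ih.2⟩
  obtain ⟨l, hl⟩ := π.eventually_eq
  have h2 := hl (N + l) (Nat.le_add_left l N)
  obtain ⟨j, rfl⟩ := Nat.exists_eq_add_of_le hi
  rw [(h1 j).1, (h1 j).2, ← (h1 l).1, ← (h1 l).2]
  exact h2

/-- The degrees are determined by $|\lambda^{(i)}|+d_in=|\mu|+$ the number of boxes so far. -/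
theorem CRPP.eq_of_wt_eq {π ρ : CRPP lam d mu} (h : π.wt = ρ.wt)
    (hc : ∀ i, π.content i = ρ.content i) : π = ρ := by
  have hn : (n : ℤ) ≠ 0 := by exact_mod_cast NeZero.ne n
  refine CRPP.ext_of_wt_deg h (funext fun i => mul_right_cancel₀ hn ?_)
  have h1 := π.size_add_sum i
  have h2 := ρ.size_add_sum i
  rw [h, Finset.sum_congr rfl fun j _ => by rw [hc j]] at h1
  linarith

/-- A sequence of weights whose steps have non-zero weight is a reverse plane partition. -/
theorem CRPP.exists_of_stepCount_ne_zero {A : ℕ → Prop} (c : ℕ → ℕ) (N : ℕ)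
    (hc : ∀ i, N ≤ i → c i = 0) (w : ℕ → Alcove n k) (h0 : w 0 = mu) (hN : ∀ i, N ≤ i → w i = lam)
    (hw : ∀ i, stepCount A (c i) (w (i + 1)) (w i) ≠ 0)
    (hd : lam.size + d * n = mu.size + ∑ j ∈ Finset.range N, (c j : ℤ)) :
    ∃ π : CRPP lam d mu, π.wt = w ∧ ∀ i, π.content i = c i := by
  classical
  have hn : (n : ℤ) ≠ 0 := by exact_mod_cast NeZero.ne n
  -- A non-zero count provides a composition, whose residues give the congruence of sizes; the
  -- quotients `q` below are the degrees.
  have hstep : ∀ i, (n : ℤ) ∣ (w i).size + c i - (w (i + 1)).size := by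
    intro i
    obtain ⟨b, hb⟩ := Finset.card_pos.mp (Nat.pos_of_ne_zero (hw i))
    rw [Finset.mem_filter, Finset.mem_piAntidiag] at hb
    obtain ⟨⟨hsum, -⟩, -, hres⟩ := hb
    have h1 := Alcove.sum_eq_size_ofRes ((w (i + 1)).res - fun j => (b j : ZMod n))
    rw [hres] at h1
    simp only [Pi.sub_apply, Finset.sum_sub_distrib, Alcove.sum_res] at h1
    rw [← Nat.cast_sum, hsum] at h1
    rw [← ZMod.intCast_zmod_eq_zero_iff_dvd]
    push_cast
    rw [← h1]
    ring
  have hdvd : ∀ i, (n : ℤ) ∣ mu.size + ∑ j ∈ Finset.range i, (c j : ℤ) - (w i).size := by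
    intro i
    induction i with
    | zero => simp [h0]
    | succ i ih =>
      have h := dvd_add ih (hstep i)
      rw [Finset.sum_range_succ]
      rwa [show mu.size + ∑ j ∈ Finset.range i, (c j : ℤ) - (w i).size +
        ((w i).size + c i - (w (i + 1)).size) =
        mu.size + (∑ j ∈ Finset.range i, (c j : ℤ) + c i) - (w (i + 1)).size by ring] at h
  choose q hq using hdvd
  have hsucc : ∀ i, (w (i + 1)).size + (q (i + 1) - q i) * n = (w i).size + c i := by
    intro i
    have h1 := hq i
    have h2 := hq (i + 1)
    rw [Finset.sum_range_succ] at h2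
    rw [sub_mul, mul_comm (q (i + 1)), mul_comm (q i)]
    linarith
  -- A non-zero step count provides a point of the strip, and this forces a cylindric shape.
  have hshape : ∀ i, IsCylShape (w (i + 1)) (q (i + 1) - q i) (w i) := by
    intro i
    have h1 := hw i
    rw [← ncard_stripSet A (hsucc i)] at h1
    obtain ⟨α, hα, h⟩ := Set.nonempty_of_ncard_ne_zero h1
    refine isCylShape_of_mem_affineOrbit hα fun i => ?_
    obtain ⟨b, hb, -⟩ := h i
    omega
  have hsum : ∀ i, N ≤ i → ∑ j ∈ Finset.range i, (c j : ℤ) = ∑ j ∈ Finset.range N, (c j : ℤ) := by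
    intro i hi
    refine (Finset.sum_subset (Finset.range_mono hi) fun j _ hj => ?_).symm
    rw [hc j (by simpa using hj), Nat.cast_zero]
  let π : CRPP lam d mu :=
    { wt := w
      deg := q
      wt_zero := h0
      deg_zero := by
        have := hq 0
        rw [h0, Finset.sum_range_zero, add_zero, sub_self] at this
        exact (mul_eq_zero.mp this.symm).resolve_left hn
      deg_le := fun i => sub_nonneg.mp (hshape i).nonneg
      shape := hshape
      eventually_eq := ⟨N, fun i hi => ⟨hN i hi, by
        have := hq i
        rw [hN i hi, hsum i hi, ← hd] at this
        refine mul_left_cancel₀ hn ?_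
        rw [← this]
        ring⟩⟩ }
  refine ⟨π, rfl, fun i => ?_⟩
  have h1 := (hshape i).cylShapeSize_add
  have h2 := hsucc i
  have h3 : π.content i = cylShapeSize (w (i + 1)) (q (i + 1) - q i) (w i) := rfl
  rw [h3]
  omega

/-- The sum over reverse plane partitions of given content, where each step contributes the number
of points in its strip. -/
theorem finsum_CRPP_eq_coeff {A : ℕ → Prop} (hA : A 0) (W : Alcove n k → ℤ → Alcove n k → ℕ)
    (hW : ∀ lam d mu, W lam d mu = (stripSet A lam d mu).ncard) (m : ℕ →₀ ℕ)
    (Q : CRPP lam d mu → Prop)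
    (hQ : ∀ π, Q π → ∀ i, π.content i = m i)
    (hQ' : ∀ π, (∀ i, π.content i = m i) →
      (∀ i, (stripSet A (π.wt (i + 1)) (π.deg (i + 1) - π.deg i) (π.wt i)).Nonempty) → Q π) :
    ∑ᶠ π : {π : CRPP lam d mu // Q π},
      ((∏ᶠ i, W (π.1.wt (i + 1)) (π.1.deg (i + 1) - π.1.deg i) (π.1.wt i) : ℕ) : ℂ) =
    MvPowerSeries.coeff m (cylSum (monomialSeries A) lam d mu) := by
  classical
  obtain ⟨N, hN⟩ : ∃ N, ∀ i, N ≤ i → m i = 0 := by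
    obtain ⟨N, hN⟩ := m.support.bddAbove
    refine ⟨N + 1, fun i hi => ?_⟩
    by_contra h
    have := hN (Finsupp.mem_support_iff.mpr h)
    omega
  have hdegree : (m.degree : ℤ) = ∑ j ∈ Finset.range N, (m j : ℤ) := by
    rw [Finsupp.degree_apply, ← Nat.cast_sum, Finset.sum_subset fun i hi => ?_]
    · intro i _ hi
      exact Finsupp.notMem_support_iff.mp hi
    · rw [Finset.mem_range]
      by_contra h
      exact Finsupp.mem_support_iff.mp hi (hN i (by omega))
  have hend : ∀ π : {π : CRPP lam d mu // Q π}, ∀ i, N ≤ i → π.1.wt i = lam ∧ π.1.deg i = d :=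
    fun π => π.1.wt_eq_of_le fun i hi => (hQ π.1 π.2 i).trans (hN i hi)
  rw [coeff_cylSum_monomialSeries]
  by_cases hr : lam.size + d * n = mu.size + m.degree
  -- When the total degrees disagree there is no plane partition, and the coefficient is zero.
  swap
  · rw [if_neg hr]
    have : IsEmpty {π : CRPP lam d mu // Q π} := by
      refine ⟨fun π => hr ?_⟩
      have h1 := π.1.size_add_sum N
      rw [(hend π N le_rfl).1, (hend π N le_rfl).2] at h1
      rw [h1, hdegree]
      congr 1
      exact Finset.sum_congr rfl fun j _ => by rw [hQ π.1 π.2 j]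
    exact finsum_of_isEmpty _
  rw [if_pos hr, matCount_eq_pathSum hA m mu N m lam (fun _ _ => rfl) hN, ← sum_paths_eq_pathSum]
  set G : (Fin (N + 1) → Alcove n k) → ℕ := fun w => if w 0 = mu ∧ w (Fin.last N) = lam then
      ∏ i : Fin N, stepCount A (m i) (w i.succ) (w i.castSucc) else 0 with hG
  -- The first $N+1$ weights determine $\pi$: later ones equal $\lambda$, and the content fixes the
  -- degrees.
  let Φ : {π : CRPP lam d mu // Q π} → (Fin (N + 1) → Alcove n k) := fun π i => π.1.wt i
  have hstep : ∀ (π : {π : CRPP lam d mu // Q π}) (i : ℕ),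
      W (π.1.wt (i + 1)) (π.1.deg (i + 1) - π.1.deg i) (π.1.wt i) =
        stepCount A (m i) (π.1.wt (i + 1)) (π.1.wt i) := by
    intro π i
    rw [hW, ncard_stripSet A, ← hQ π.1 π.2 i]
    exact (π.1.shape i).cylShapeSize_add
  have hval : ∀ π : {π : CRPP lam d mu // Q π},
      ∏ᶠ i, W (π.1.wt (i + 1)) (π.1.deg (i + 1) - π.1.deg i) (π.1.wt i) = G (Φ π) := by
    intro π
    simp_rw [hstep]
    rw [finprod_eq_prod_of_mulSupport_subset (s := Finset.range N), Finset.prod_range, hG]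
    · simp only
      rw [if_pos]
      · rfl
      · exact ⟨π.1.wt_zero, (hend π N le_rfl).1⟩
    · intro i hi
      rw [Function.mem_mulSupport] at hi
      rw [Finset.coe_range, Set.mem_Iio]
      by_contra! h
      refine hi ?_
      rw [(hend π i h).1, (hend π (i + 1) (by omega)).1, hN i h, stepCount_zero hA]
  have hinj : Function.Injective Φ := by
    intro π ρ h
    refine Subtype.ext (CRPP.eq_of_wt_eq (funext fun i => ?_) fun i => ?_)
    · rcases le_or_gt N i with hi | hi
      · rw [(hend π i hi).1, (hend ρ i hi).1]
      · exact congrFun h ⟨i, by omega⟩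
    · rw [hQ π.1 π.2, hQ ρ.1 ρ.2]
  have hsurj : Function.support (fun w => (G w : ℂ)) ⊆ Set.range Φ := by
    intro w hw
    rw [Function.mem_support, Nat.cast_ne_zero] at hw
    have hw1 : w 0 = mu ∧ w (Fin.last N) = lam := by
      by_contra h
      exact hw (if_neg h)
    simp only [hG] at hw
    rw [if_pos hw1, Finset.prod_ne_zero_iff] at hw
    -- The finite path is continued by its last weight, where empty steps have count $1$.
    let v : ℕ → Alcove n k := fun i => w ⟨min i N, by omega⟩
    have hv : ∀ i, N ≤ i → v i = lam := by
      intro i hi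
      rw [← hw1.2]
      simp only [v]
      congr 1
      exact Fin.ext (min_eq_right hi)
    have hvs : ∀ i, stepCount A (m i) (v (i + 1)) (v i) ≠ 0 := by
      intro i
      rcases lt_or_ge i N with hi | hi
      · have h1 := hw ⟨i, hi⟩ (Finset.mem_univ _)
        have h2 : v i = w (Fin.castSucc ⟨i, hi⟩) := by
          simp only [v]
          congr 1
          exact Fin.ext (min_eq_left hi.le)
        have h3 : v (i + 1) = w (Fin.succ ⟨i, hi⟩) := by
          simp only [v]
          congr 1
          exact Fin.ext (min_eq_left hi)
        rw [h2, h3]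
        exact h1
      · rw [hv i hi, hv (i + 1) (by omega), hN i hi, stepCount_zero hA]
        exact one_ne_zero
    obtain ⟨π, hπ, hπc⟩ := CRPP.exists_of_stepCount_ne_zero (A := A) (mu := mu) (lam := lam) (d := d)
      m N hN v (by rw [← hw1.1]; rfl) hv hvs (by rw [hr, hdegree])
    refine ⟨⟨π, hQ' π hπc fun i => Set.nonempty_of_ncard_ne_zero ?_⟩, funext fun i => ?_⟩
    · rw [ncard_stripSet A (s := m i), hπ]
      · exact hvs i
      · rw [← hπc i]
        exact (π.shape i).cylShapeSize_add
    · change π.wt i = w i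
      rw [hπ]
      simp only [v]
      congr 1
      exact Fin.ext (min_eq_left (Nat.lt_succ_iff.mp i.2))
  simp_rw [hval]
  rw [← finsum_mem_range (f := fun w => (G w : ℂ)) hinj, finsum_mem_def,
    Set.indicator_eq_self.mpr hsurj, finsum_eq_sum_of_fintype, ← Nat.cast_sum]

theorem cylH_eq_cylSum (lam : Alcove n k) (d : ℤ) (mu : Alcove n k) :
    cylH lam d mu = cylSum (monomialSeries fun _ => True) lam d mu := by
  ext m
  rw [← finsum_CRPP_eq_coeff (A := fun _ => True) trivial cylTheta cylTheta_eq_ncard m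
    (fun π => ∀ i, π.content i = m i) (fun _ h => h) (fun _ h _ => h)]
  rfl

/-- Row strictness costs nothing: a step with a point in its strip is a vertical strip, and all
other steps have weight zero. -/
theorem cylE_eq_cylSum (lam : Alcove n k) (d : ℤ) (mu : Alcove n k) :
    cylE lam d mu = cylSum (monomialSeries fun b => b ≤ 1) lam d mu := by
  ext m
  rw [← finsum_CRPP_eq_coeff (A := fun b => b ≤ 1) zero_le_one cylPsi cylPsi_eq_ncard m
    (fun π => π.IsRowStrict ∧ ∀ i, π.content i = m i) (fun _ h => h.2) (fun π h hne => ⟨fun i => ?_, h⟩)]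
  · rfl
  · obtain ⟨α, hα, h⟩ := hne i
    refine isCylVertStrip_of_mem_affineOrbit hα fun j => ?_
    obtain ⟨b, hb, hb1⟩ := h j
    omega

end Planar

/-! ### The theorem for both families -/

theorem mainTheorem1 (n k : ℕ) [NeZero n] [NeZero k] :
    ∃ H E : Alcove n k → ℤ → Alcove n k → SymFun,
      (∀ lam d mu, (H lam d mu : MvPowerSeries ℕ ℂ) = cylH lam d mu) ∧
      (∀ lam d mu, (E lam d mu : MvPowerSeries ℕ ℂ) = cylE lam d mu) ∧
      ∀ F : Alcove n k → ℤ → Alcove n k → SymFun, (F = H ∨ F = E) →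
        IsPositiveSubcoalgebra
          (fun x : NonSkewIndex n k => nonSkew F x.1.1 x.1.2) cylStructureConst ∧
        (∀ (lam : Alcove n k) (d : ℤ), -lam.multTop ≤ d →
          Coalgebra.comul (R := ℂ) (nonSkew F lam d) =
            ∑ mu : Alcove n k, ∑ d₂ ∈ Finset.Icc (-mu.multTop) d,
              F lam (d - d₂) mu ⊗ₜ[ℂ] nonSkew F mu d₂) ∧
        (∀ (lam mu : Alcove n k) (d₁ : ℤ), 0 ≤ d₁ →
          F lam d₁ mu =
            ∑ nu : Alcove n k, ∑ᶠ (d₁' : ℤ) (_ : nu.size = lam.size + d₁' * n - mu.size),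
              fusionCoeff mu nu lam • nonSkew F nu (d₁ - d₁')) := by
  refine ⟨cylSum (SymFun.newton 1), cylSum (SymFun.newton (-1)), fun lam d mu => ?_,
    fun lam d mu => ?_, fun F hF => ?_⟩
  · rw [coe_cylSum, cylH_eq_cylSum]
    simp_rw [SymFun.coe_newton_one]
  · rw [coe_cylSum, cylE_eq_cylSum]
    simp_rw [SymFun.coe_newton_neg_one]
  -- Both families are treated at once: $\varepsilon=1$ gives $h$ and $\varepsilon=-1$ gives $e$.
  · obtain ⟨ε, hε, rfl⟩ : ∃ ε : ℂ, ε ≠ 0 ∧ F = cylSum (SymFun.newton ε) := by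
      rcases hF with rfl | rfl
      · exact ⟨1, one_ne_zero, rfl⟩
      · exact ⟨-1, by norm_num, rfl⟩
    exact ⟨isPositiveSubcoalgebra_cylSum hε, fun lam d _ => comul_nonSkew_cylSum ε lam d,
      fun lam mu d₁ _ => cylSum_eq_sum_fusionCoeff ε lam mu d₁⟩
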